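/- Notation. Let $\mathbb F$ be $\mathbb R$, $\mathbb C$ or $\mathbb H$, let $\mathbb F^m$ be the space of column vectors (a right $\mathbb F$-vector space), $\bar g^t$ the conjugate transpose, $J_n=\begin{pmatrix}0&I_n\\-I_n&0\end{pmatrix}$, $D_n=\begin{pmatrix}0&I_n\\I_n&0\end{pmatrix}$, $I_{p,q}=\begin{pmatrix}I_p&0\\0&-I_q\end{pmatrix}$. For a matrix group $\mathbb G$ put $\theta(g)=(\bar g^t)^{-1}$ and let $\mathbb K=\mathbb G^\theta=\{g\in\mathbb G:\theta(g)=g\}$ be its standard maximal compact subgroup. A subgroup $H$ of a Lie group $K$ is called symmetric if there is an involutive automorphism $\sigma$ of $K$ with $(K^\sigma)_e\subseteq H\subseteq K^\sigma$, where $(\cdot)_e$ is the identity component. Consider the following pairs $(\mathbb G,\mathbb P)$. 1. $\mathbb G=\mathrm{GL}(p+q,\mathbb F)$, $\mathbb F=\mathbb R,\mathbb C,\mathbb H$, $p,q\ge 0$; 2. $\mathbb G=\mathrm{Sp}(2n,\mathbb F)=\{g:g^tJ_ng=J_n\}$, $\mathbb F=\mathbb R,\mathbb C$, $n\geq 0$;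 3. $\mathbb G=\mathrm O(2n,\mathbb C)=\{g:g^tD_ng=D_n\}$ or $\mathbb G=\mathrm{SO}(2n,\mathbb C)=\{g\in \mathrm O(2n,\mathbb C):\det g=1\}$, $n\geq 0$; 4. $\mathbb G=\mathrm U(n,n;\mathbb F)=\{g:\bar g^tD_ng=D_n\}$, $\mathbb F=\mathbb R,\mathbb C,\mathbb H$, $n\geq 0$; 5. $\mathbb G=\mathrm{SO}^*(4n)=\{g\in\mathrm{GL}(2n,\mathbb H):\bar g^tJ_ng=J_n\}$, $n\geq 0$; 6. $\mathbb G=\mathrm{SO}(p+1,q+1)_e$, the identity component of $\{g\in\mathrm{SL}(p+q+2,\mathbb R): g^tI_{p+1,q+1}g=I_{p+1,q+1}\}$, $p+q>2$, $p,q\ge0$; 7. $\mathbb G=\mathrm{SO}(n+2,\mathbb C)=\{g\in\mathrm{SL}(n+2,\mathbb C): g^tg=1\}$, $n\ge 3$. In cases 1–5, $\mathbb P$ is the stabilizer in $\mathbb G$ of the span of the first $p$ (in cases 2–5: the first $n$) standard basis vectors, that is, the subgroup of block upper triangular matrices, and $\mathbb L$ is the subgroup of block diagonal matrices in $\mathbb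 G$. In case 6, $\mathbb P$ is the stabilizer of the line spanned by $e_1+e_{p+2}$, and $\mathbb L$ is the subgroup of those elements of $\mathbb P$ which also stabilize the line spanned by $e_1-e_{p+2}$. In case 7, $\mathbb P$ is the stabilizer of the line spanned by $e_1+ie_2$, and $\mathbb L$ is the subgroup of those elements of $\mathbb P$ which also stabilize the line spanned by $e_1-ie_2$. Proposition. For each of these pairs, $\mathbb K$ is compact and acts transitively on $\mathbb G/\mathbb P$; one has $\mathbb P\cap\mathbb K=\mathbb L\cap\mathbb K$, and this is a symmetric subgroup of $\mathbb K$; and the map $k(\mathbb P\cap\mathbb K)\mapsto k\mathbb P$ is a diffeomorphism $\mathbb K/(\mathbb P\cap\mathbb K)\to\mathbb G/\mathbb P$. Thus $\mathbb G/\mathbb P$ is diffeomorphic to the compact symmetric space $\mathbb K/(\mathbb P\cap\mathbb K)=\mathbb K/(\mathbb L\cap\mathbb K)$. Moreover, for $\mathbb F=\mathbb R,\mathbb C,\mathbb H$ and $p,q\ge0$, let $\mathrm U(m,\mathbb F)=\{g\in \mathrm{GL}(m,\mathbb F):\bar g^tg=1\}$ (so $\mathrm O(m)$, $\mathrm U(m)$,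 $\mathrm{Sp}(m)$), with $\mathrm U(p,\mathbb F)\times\mathrm U(q,\mathbb F)$ embedded block diagonally in $\mathrm U(p+q,\mathbb F)$, and let $\mathrm{Gr}_p(\mathbb F^{p+q})$ be the manifold of $p$-dimensional subspaces of $\mathbb F^{p+q}$. Then sending the class of $k$ to the subspace $k\,\mathbb F^p$, where $\mathbb F^p$ is the span of the first $p$ standard basis vectors, defines a diffeomorphism $$\mathrm U(p+q,\mathbb F)/\bigl(\mathrm U(p,\mathbb F)\times\mathrm U(q,\mathbb F)\bigr)\;\cong\;\mathrm{Gr}_p(\mathbb F^{p+q}).$$ -/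

import Mathlib

open scoped ContDiff Matrix Quaternion

namespace Grassmann

/-! ### Smooth functions and diffeomorphisms

All the spaces below are quotients `π : S → X` of an embedded submanifold `S` of a
finite-dimensional real vector space `E` by a surjective submersion `π`.  Their smooth structure is
encoded by its sheaf of smooth real functions: `f` is smooth on the open set `U ⊆ X` exactly when
`f ∘ π` is smooth on the open subset `π⁻¹ U` of the submanifold `S`. -/

/-- The assignment to every (open) set `U` of the functions which are smooth on `U`. -/
abbrev SmoothFunctions (X : Type*) := Set X → Set (X → ℝ)

/-- The smooth functions on the quotient `π : S → X`, where `emb : S → E` is the inclusion of the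
submanifold `S` into the vector space `E`. -/
def quotientSmooth {S E X : Type*} [NormedAddCommGroup E] [NormedSpace ℝ E]
    (emb : S → E) (π : S → X) : SmoothFunctions X :=
  fun U => {f | ∃ F : E → ℝ, (∀ s, π s ∈ U → F (emb s) = f (π s)) ∧
    ContDiffOn ℝ ∞ F (emb '' (π ⁻¹' U))}

/-- A homeomorphism is a diffeomorphism when it and its inverse pull back
smooth functions on open sets to smooth functions. -/
def IsDiffeo {X Y : Type*} [TopologicalSpace X] [TopologicalSpace Y]
    (smX : SmoothFunctions X) (smY : SmoothFunctions Y) (φ : X ≃ₜ Y) : Prop :=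
  ∀ V : Set Y, IsOpen V → ∀ f : Y → ℝ, f ∈ smY V ↔ f ∘ φ ∈ smX (φ ⁻¹' V)

section Symmetric

/-- `H` is a symmetric subgroup of `K`: there is an involutive automorphism `σ` of the topological
group `K` such that `H` lies between the fixed group of `σ` and its identity component. -/
def IsSymmetricSubgroup {K : Type*} [Group K] [TopologicalSpace K] [IsTopologicalGroup K]
    (H : Subgroup K) : Prop :=
  ∃ σ : K ≃* K, Continuous σ ∧ (∀ k, σ (σ k) = k) ∧
    H ≤ MonoidHom.eqLocus σ.toMonoidHom (MonoidHom.id K) ∧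
    (Subgroup.connectedComponentOfOne
      (MonoidHom.eqLocus σ.toMonoidHom (MonoidHom.id K))).map (Subgroup.subtype _) ≤ H

end Symmetric

section Groups

variable {ι F : Type*} [Fintype ι] [DecidableEq ι]

/-- The general linear group over a (possibly noncommutative) ring. -/
abbrev GLin (ι F : Type*) [Fintype ι] [DecidableEq ι] [Ring F] := (Matrix ι ι F)ˣ

/-- The underlying matrix of an element of a matrix group. -/
def mat [Ring F] {G : Subgroup (GLin ι F)} (g : G) : Matrix ι ι F := ((g : GLin ι F) : Matrix ι ι F)

/-- The stabilizer in `G` of a set `W` of column vectors: the `g` with `g W = W`. -/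
def stab [Ring F] (G : Subgroup (GLin ι F)) (W : Set (ι → F)) : Subgroup G where
  carrier := {g | ∀ x, mat g *ᵥ x ∈ W ↔ x ∈ W}
  one_mem' := by intro x; simp [mat]
  mul_mem' := by
    intro a b ha hb x
    have h : mat (a * b) *ᵥ x = mat a *ᵥ (mat b *ᵥ x) := by simp [mat, Matrix.mulVec_mulVec]
    rw [h]
    exact (ha _).trans (hb _)
  inv_mem' := by
    intro a ha x
    have h : mat a *ᵥ (mat a⁻¹ *ᵥ x) = x := by simp [mat, Matrix.mulVec_mulVec]
    rw [← ha (mat a⁻¹ *ᵥ x), h]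

/-- The standard Cartan involution `θ(g) = (\bar g^t)⁻¹`. -/
def theta [Ring F] [StarRing F] (g : GLin ι F) : GLin ι F := (star g)⁻¹

/-- The maximal compact subgroup `𝕂 = 𝔾^θ`. -/
def maxCompact [Ring F] [StarRing F] (G : Subgroup (GLin ι F)) : Subgroup G where
  carrier := {g | theta (g : GLin ι F) = g}
  one_mem' := by simp [theta]
  mul_mem' := by
    intro a b ha hb
    simp only [Set.mem_ofPred_eq, theta, Subgroup.coe_mul, star_mul, mul_inv_rev] at *
    rw [ha, hb]
  inv_mem' := by
    intro a ha
    simp only [Set.mem_ofPred_eq, theta, Subgroup.coe_inv, star_inv] at *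
    rw [ha]

/-- The group of invertible matrices `g` with `g^t S g = S`. -/
def bilinGroup [CommRing F] (S : Matrix ι ι F) : Subgroup (GLin ι F) where
  carrier := {g | (g : Matrix ι ι F)ᵀ * S * (g : Matrix ι ι F) = S}
  one_mem' := by simp
  mul_mem' := by
    intro a b ha hb
    simp only [Set.mem_ofPred_eq, Units.val_mul, Matrix.transpose_mul] at *
    calc (b : Matrix ι ι F)ᵀ * (a : Matrix ι ι F)ᵀ * S * (a * b : Matrix ι ι F)
        = (b : Matrix ι ι F)ᵀ * ((a : Matrix ι ι F)ᵀ * S * a) * b := by simp only [mul_assoc]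
      _ = S := by rw [ha, hb]
  inv_mem' := by
    intro a ha
    simp only [Set.mem_ofPred_eq] at *
    have h1 : (a : Matrix ι ι F) * (a⁻¹ : GLin ι F) = 1 := a.mul_inv
    have h2 : ((a⁻¹ : GLin ι F) : Matrix ι ι F)ᵀ * (a : Matrix ι ι F)ᵀ = 1 := by
      rw [← Matrix.transpose_mul, h1, Matrix.transpose_one]
    calc ((a⁻¹ : GLin ι F) : Matrix ι ι F)ᵀ * S * (a⁻¹ : GLin ι F)
        = ((a⁻¹ : GLin ι F) : Matrix ι ι F)ᵀ * ((a : Matrix ι ι F)ᵀ * S * a) *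
            (a⁻¹ : GLin ι F) := by rw [ha]
      _ = (((a⁻¹ : GLin ι F) : Matrix ι ι F)ᵀ * (a : Matrix ι ι F)ᵀ) * S *
            (a * (a⁻¹ : GLin ι F)) := by simp only [mul_assoc]
      _ = S := by rw [h1, h2]; simp

/-- The group of invertible matrices `g` with `\bar g^t S g = S`. -/
def sesqGroup [Ring F] [StarRing F] (S : Matrix ι ι F) : Subgroup (GLin ι F) where
  carrier := {g | (g : Matrix ι ι F)ᴴ * S * (g : Matrix ι ι F) = S}
  one_mem' := by simp
  mul_mem' := by
    intro a b ha hb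
    simp only [Set.mem_ofPred_eq, Units.val_mul, Matrix.conjTranspose_mul] at *
    calc (b : Matrix ι ι F)ᴴ * (a : Matrix ι ι F)ᴴ * S * (a * b : Matrix ι ι F)
        = (b : Matrix ι ι F)ᴴ * ((a : Matrix ι ι F)ᴴ * S * a) * b := by simp only [mul_assoc]
      _ = S := by rw [ha, hb]
  inv_mem' := by
    intro a ha
    simp only [Set.mem_ofPred_eq] at *
    have h1 : (a : Matrix ι ι F) * (a⁻¹ : GLin ι F) = 1 := a.mul_inv
    have h2 : ((a⁻¹ : GLin ι F) : Matrix ι ι F)ᴴ * (a : Matrix ι ι F)ᴴ = 1 := by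
      rw [← Matrix.conjTranspose_mul, h1, Matrix.conjTranspose_one]
    calc ((a⁻¹ : GLin ι F) : Matrix ι ι F)ᴴ * S * (a⁻¹ : GLin ι F)
        = ((a⁻¹ : GLin ι F) : Matrix ι ι F)ᴴ * ((a : Matrix ι ι F)ᴴ * S * a) *
            (a⁻¹ : GLin ι F) := by rw [ha]
      _ = (((a⁻¹ : GLin ι F) : Matrix ι ι F)ᴴ * (a : Matrix ι ι F)ᴴ) * S *
            (a * (a⁻¹ : GLin ι F)) := by simp only [mul_assoc]
      _ = S := by rw [h1, h2]; simp

/-- The matrices of determinant one. -/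
def detOne (ι F : Type*) [Fintype ι] [DecidableEq ι] [CommRing F] : Subgroup (GLin ι F) where
  carrier := {g | (g : Matrix ι ι F).det = 1}
  one_mem' := by simp
  mul_mem' := by
    intro a b ha hb
    simp only [Set.mem_ofPred_eq, Units.val_mul, Matrix.det_mul] at *
    rw [ha, hb, one_mul]
  inv_mem' := by
    intro a ha
    simp only [Set.mem_ofPred_eq] at *
    have h : ((a : Matrix ι ι F) * (a⁻¹ : GLin ι F)).det = 1 := by
      rw [a.mul_inv, Matrix.det_one]
    rwa [Matrix.det_mul, ha, one_mul] at h

end Groups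

section Pairs

/-- `J_n`, with `n × n` blocks `0, I, -I, 0`. -/
def formJ (n : ℕ) (F : Type*) [Ring F] : Matrix (Fin n ⊕ Fin n) (Fin n ⊕ Fin n) F :=
  Matrix.fromBlocks 0 1 (-1) 0

/-- `D_n`, with `n × n` blocks `0, I, I, 0`. -/
def formD (n : ℕ) (F : Type*) [Ring F] : Matrix (Fin n ⊕ Fin n) (Fin n ⊕ Fin n) F :=
  Matrix.fromBlocks 0 1 1 0

/-- `I_{p,q}`. -/
def formI (p q : ℕ) (F : Type*) [Ring F] : Matrix (Fin p ⊕ Fin q) (Fin p ⊕ Fin q) F :=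
  Matrix.fromBlocks 1 0 0 (-1)

/-- The span of the first `p` standard basis vectors. -/
def stdFirst (p q : ℕ) (F : Type*) [Ring F] : Set (Fin p ⊕ Fin q → F) :=
  {x | ∀ j, x (Sum.inr j) = 0}

/-- The span of the last `q` standard basis vectors. -/
def stdLast (p q : ℕ) (F : Type*) [Ring F] : Set (Fin p ⊕ Fin q → F) :=
  {x | ∀ i, x (Sum.inl i) = 0}

/-- The block upper triangular elements of `G`, that is, the stabilizer of the standard subspace. -/
def blockParabolic {p q : ℕ} {F : Type*} [Ring F] (G : Subgroup (GLin (Fin p ⊕ Fin q) F)) :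
    Subgroup G :=
  stab G (stdFirst p q F)

/-- The block diagonal elements of `G`. -/
def blockLevi {p q : ℕ} {F : Type*} [Ring F] (G : Subgroup (GLin (Fin p ⊕ Fin q) F)) :
    Subgroup G :=
  stab G (stdFirst p q F) ⊓ stab G (stdLast p q F)

/-- The line spanned by a vector. -/
def line {ι F : Type*} [Ring F] (v : ι → F) : Set (ι → F) := {x | ∃ c : F, x = c • v}

/-- The identity component `SO(p,q)_e` of the group of real matrices of determinant one that
preserve the form `I_{p,q}`. -/
noncomputable def SOIdComponent (p q : ℕ) : Subgroup (GLin (Fin p ⊕ Fin q) ℝ) :=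
  (Subgroup.connectedComponentOfOne
    (bilinGroup (formI p q ℝ) ⊓ detOne (Fin p ⊕ Fin q) ℝ : Subgroup _)).map (Subgroup.subtype _)

/-- The complex special orthogonal group `SO(n+2, ℂ)`, of the form `x₁² + ⋯ + x_{n+2}²`. -/
noncomputable def SOComplex (n : ℕ) : Subgroup (GLin (Fin 2 ⊕ Fin n) ℂ) :=
  bilinGroup 1 ⊓ detOne (Fin 2 ⊕ Fin n) ℂ

/-- The vector `(1, 0, …, 0, c, 0, …, 0)`, with the entries `1` and `c` at the first place of
either block. -/
noncomputable def realIsotropic (p q : ℕ) (c : ℝ) : Fin (p + 1) ⊕ Fin (q + 1) → ℝ :=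
  Sum.elim (Pi.single 0 1) (Pi.single 0 c)

/-- The vector `(1, c, 0, …, 0)`. -/
noncomputable def complexIsotropic (n : ℕ) (c : ℂ) : Fin 2 ⊕ Fin n → ℂ :=
  Sum.elim ![1, c] 0

/-- The stabilizer of the point `(1:0:…:1:0:…:0)` of the real quadric. -/
noncomputable def realQuadricParabolic (p q : ℕ) : Subgroup (SOIdComponent (p + 1) (q + 1)) :=
  stab _ (line (realIsotropic p q 1))

/-- The Levi subgroup: the stabilizer of two opposite isotropic lines. -/
noncomputable def realQuadricLevi (p q : ℕ) : Subgroup (SOIdComponent (p + 1) (q + 1)) :=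
  stab _ (line (realIsotropic p q 1)) ⊓ stab _ (line (realIsotropic p q (-1)))

/-- The stabilizer of the point `(1:i:0:…:0)` of the complex quadric. -/
noncomputable def complexQuadricParabolic (n : ℕ) : Subgroup (SOComplex n) :=
  stab _ (line (complexIsotropic n Complex.I))

/-- The Levi subgroup: the stabilizer of two opposite isotropic lines. -/
noncomputable def complexQuadricLevi (n : ℕ) : Subgroup (SOComplex n) :=
  stab _ (line (complexIsotropic n Complex.I)) ⊓ stab _ (line (complexIsotropic n (-Complex.I)))

end Pairs

section Claims

attribute [local instance] Matrix.normedAddCommGroup Matrix.normedSpace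

variable {ι F : Type*} [Fintype ι] [DecidableEq ι] [NormedRing F] [NormedAlgebra ℝ F]

/-- The smooth structure of `𝔾/H`, with `𝔾` a matrix group. -/
def smoothQuot (G : Subgroup (GLin ι F)) (H : Subgroup G) : SmoothFunctions (G ⧸ H) :=
  quotientSmooth (fun g : G => mat g) (fun g : G => (g : G ⧸ H))

/-- The smooth structure of `K/H`, with `K` a subgroup of a matrix group. -/
def smoothSubQuot {G : Subgroup (GLin ι F)} (K : Subgroup G) (H : Subgroup K) :
    SmoothFunctions (K ⧸ H) :=
  quotientSmooth (fun k : K => mat (k : G)) (fun k : K => (k : K ⧸ H))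

/-- The claim for one pair `(𝔾, ℙ)` with Levi subgroup `𝕃` of `ℙ` and with `𝕂 = 𝔾^θ`:
`𝕂` is compact and transitive on `𝔾/ℙ`, `ℙ ∩ 𝕂 = 𝕃 ∩ 𝕂` is a symmetric subgroup of `𝕂`, and
`k(ℙ ∩ 𝕂) ↦ kℙ` is a diffeomorphism from `𝕂/(ℙ ∩ 𝕂)` to `𝔾/ℙ`. -/
def IsCompactSymmetricRealization [StarRing F] (G : Subgroup (GLin ι F)) (P L : Subgroup G) :
    Prop :=
  IsCompact (maxCompact G : Set G) ∧
  MulAction.IsPretransitive (maxCompact G) (G ⧸ P) ∧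
  P ⊓ maxCompact G = L ⊓ maxCompact G ∧
  IsSymmetricSubgroup (P.subgroupOf (maxCompact G)) ∧
  ∃ φ : (maxCompact G ⧸ P.subgroupOf (maxCompact G)) ≃ₜ (G ⧸ P),
    (∀ k : maxCompact G, φ (k : maxCompact G ⧸ P.subgroupOf (maxCompact G)) = ((k : G) : G ⧸ P)) ∧
    IsDiffeo (smoothSubQuot (maxCompact G) (P.subgroupOf (maxCompact G))) (smoothQuot G P) φ

/-- The claim for a matrix group `𝔾` in two-by-two blocks, with `ℙ` its subgroup of block upper
triangular matrices and `𝕃` its subgroup of block diagonal matrices. -/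
def IsBlockRealization {p q : ℕ} {F : Type*} [NormedRing F] [NormedAlgebra ℝ F] [StarRing F]
    (G : Subgroup (GLin (Fin p ⊕ Fin q) F)) : Prop :=
  IsCompactSymmetricRealization G (blockParabolic G) (blockLevi G)

/-- The unitary group `U(ι, F)`, for `F = ℝ, ℂ, ℍ` the groups `O`, `U`, `Sp`. -/
def unitaryGL (ι F : Type*) [Fintype ι] [DecidableEq ι] [Ring F] [StarRing F] :
    Subgroup (GLin ι F) :=
  sesqGroup 1

/-- `U(p, F) × U(q, F)`, embedded block diagonally in `U(p+q, F)`. -/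
def blockUnitary (p q : ℕ) (F : Type*) [Ring F] [StarRing F] :
    Subgroup (unitaryGL (Fin p ⊕ Fin q) F) where
  carrier := {g | ∃ (a : unitaryGL (Fin p) F) (d : unitaryGL (Fin q) F),
    mat g = Matrix.fromBlocks (mat a) 0 0 (mat d)}
  one_mem' := ⟨1, 1, by simp [mat]⟩
  mul_mem' := by
    rintro g h ⟨a, d, hg⟩ ⟨b, e, hh⟩
    refine ⟨a * b, d * e, ?_⟩
    simp only [mat, Subgroup.coe_mul, Units.val_mul] at *
    rw [hg, hh, Matrix.fromBlocks_multiply]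
    simp
  inv_mem' := by
    rintro g ⟨a, d, hg⟩
    refine ⟨a⁻¹, d⁻¹, ?_⟩
    simp only [mat, Subgroup.coe_inv] at *
    apply Units.inv_eq_of_mul_eq_one_right
    rw [hg, Matrix.fromBlocks_multiply]
    simp

/-- The right `F`-subspaces of dimension `p` of the space `F^{p+q}` of column vectors. -/
def Gr (p q : ℕ) (F : Type*) [Ring F] : Type _ :=
  {W : Submodule Fᵐᵒᵖ (Fin p ⊕ Fin q → F) // Module.finrank Fᵐᵒᵖ W = p}

/-- The `p`-frames in `F^{p+q}`, an open subset of the space of `p`-tuples of vectors. -/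
def Frames (p q : ℕ) (F : Type*) [Ring F] : Type _ :=
  {v : Fin p → (Fin p ⊕ Fin q → F) // LinearIndependent Fᵐᵒᵖ v}

/-- The subspace spanned by a frame. -/
def frameSpan (p q : ℕ) (F : Type*) [Ring F] [Nontrivial F] [StrongRankCondition Fᵐᵒᵖ] (v : Frames p q F) :
    Gr p q F :=
  ⟨Submodule.span Fᵐᵒᵖ (Set.range v.1), by
    rw [finrank_span_eq_card v.2, Fintype.card_fin]⟩

/-- The topology of the Grassmannian, as the quotient of the space of frames. -/
instance (p q : ℕ) (F : Type*) [NormedRing F] [Nontrivial F] [StrongRankCondition Fᵐᵒᵖ] :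
    TopologicalSpace (Gr p q F) :=
  TopologicalSpace.coinduced (frameSpan p q F)
    (TopologicalSpace.induced Subtype.val inferInstance)

/-- The smooth structure of the Grassmannian, as the quotient of the space of frames. -/
def smoothGr (p q : ℕ) (F : Type*) [NormedRing F] [NormedAlgebra ℝ F] [Nontrivial F] [StrongRankCondition Fᵐᵒᵖ] :
    SmoothFunctions (Gr p q F) :=
  quotientSmooth (fun v : Frames p q F => v.1) (frameSpan p q F)

/-- `U(p+q, F)/(U(p, F) × U(q, F))` with its smooth structure is diffeomorphic to `Gr_p(F^{p+q})`,
by the orbit map of the standard subspace. -/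
def IsGrassmannRealization (p q : ℕ) (F : Type*) [NormedRing F] [NormedAlgebra ℝ F] [StarRing F]
    [Nontrivial F] [StrongRankCondition Fᵐᵒᵖ] : Prop :=
  ∃ φ : (unitaryGL (Fin p ⊕ Fin q) F ⧸ blockUnitary p q F) ≃ₜ Gr p q F,
    (∀ k : unitaryGL (Fin p ⊕ Fin q) F,
      ((φ (k : unitaryGL (Fin p ⊕ Fin q) F ⧸ blockUnitary p q F)).1 : Set (Fin p ⊕ Fin q → F)) =
        (fun x => mat k *ᵥ x) '' stdFirst p q F) ∧
    IsDiffeo (smoothQuot (unitaryGL (Fin p ⊕ Fin q) F) (blockUnitary p q F)) (smoothGr p q F) φ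

end Claims

end Grassmann

set_option linter.unusedSectionVars false

/-! For each pair two facts suffice: every `g` in `G` is `k * p` with `k` in the maximal compact
subgroup `K` and `p` in `P`, and for `g` near `1` such a `k` can be given by a smooth function of
the matrix `g`. Translating on the left by `K` and on the right by `P` turns this one local section
into smooth local sections through every point, and a bijection of quotients with smooth local
sections is a diffeomorphism (`exists_isDiffeo_of_local_sections`, `exists_homeomorph_quotient`).
The symmetric structure is conjugation by an orthogonal involution `s`. Unitary elements of `P`
commute with `s`; conversely, among the unitary elements commuting with `s`, those in the identity
component are recognized as elements of `P` by a continuous function with values `±1`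
(`isSymmetricSubgroup_of_conj`).

In the block cases `P` is the stabilizer of the image of the projection `e = blockProj`. Householder
triangularization gives `g = k * t` for the general linear group. For the isometry group of a form
`S`, the unitary `k` has to be replaced by an isometry with the same effect on the standard
Lagrangian: since `S` exchanges this Lagrangian with its orthogonal complement, `k` on the
Lagrangian together with its transport by `S` on the complement does it (`exists_unitary_isometry`).

For the local section, the orthogonal projection `Q = k * e * star k` onto the moved subspace is a
smooth expression in `M = k * p` alone. The product of the reflections `2Q - 1` and `s = 2e - 1` is
near `1`, and its square root is unitary and carries the image of `e` to that of `Q`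
(`exists_smooth_unitary`). The square is `k * (s * k⁻¹ * s)`, which lies in `G`; the groups
considered contain the square roots near `1` of their elements, because such roots are locally
unique. The same section, applied to the matrix of a frame, gives the statement on `Gr`.

For the quadrics, an isotropic vector splits into two orthogonal real vectors of equal length: its
real and imaginary parts, or its components in the positive and negative definite subspaces. Two
plane rotations, each a product of two explicit reflections, carry the standard isotropic line to
the given one; the formulas are smooth near the identity (`transitive_SOComplex`,
`transitive_SOIdComponent`). For the real quadric the rotations stay in the identity component
because their reflecting vectors can be moved along segments to the trivial ones. -/

namespace Grassmann

open Filter Topology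

/-! ### Diffeomorphisms of quotients from smooth local sections. -/

section SmoothQuotients

variable {S₁ S₂ X Y E₁ E₂ : Type*} [NormedAddCommGroup E₁] [NormedSpace ℝ E₁]
  [NormedAddCommGroup E₂] [NormedSpace ℝ E₂] [TopologicalSpace S₁] [TopologicalSpace S₂]
  [TopologicalSpace X] [TopologicalSpace Y]

/-- A smooth map between total spaces with smooth local sections, which matches the fibers of two
smooth quotients, induces a diffeomorphism of the quotients. -/
theorem exists_isDiffeo_of_local_sections (emb₁ : S₁ → E₁) (emb₂ : S₂ → E₂) (π₁ : S₁ → X)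
    (π₂ : S₂ → Y) (h₁ : IsInducing emb₁) (h₂ : Continuous emb₂) (h₂inj : Function.Injective emb₂)
    (hπ₁ : IsQuotientMap π₁) (hπ₂ : IsQuotientMap π₂) (j : S₁ → S₂) (hj : Continuous j)
    (J : E₁ → E₂) (hJ : ContDiff ℝ ∞ J) (hjJ : ∀ s, emb₂ (j s) = J (emb₁ s))
    (hfib : ∀ s s', π₁ s = π₁ s' ↔ π₂ (j s) = π₂ (j s'))
    (hsec : ∀ t₀, ∃ κ : E₂ → E₁, ContDiffAt ℝ ∞ κ (emb₂ t₀) ∧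
      ∀ᶠ M in 𝓝 (emb₂ t₀), ∀ t, emb₂ t = M → ∃ s, emb₁ s = κ M ∧ π₂ (j s) = π₂ t) :
    ∃ φ : X ≃ₜ Y, (∀ s, φ (π₁ s) = π₂ (j s)) ∧
      IsDiffeo (quotientSmooth emb₁ π₁) (quotientSmooth emb₂ π₂) φ := by
  set f : X → Y := fun x => π₂ (j (Function.surjInv hπ₁.surjective x)) with hfdef
  have hf : ∀ s, f (π₁ s) = π₂ (j s) := fun s =>
    (hfib _ _).1 (Function.surjInv_eq hπ₁.surjective (π₁ s))
  have hfinj : Function.Injective f := by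
    intro x y hxy
    obtain ⟨s, rfl⟩ := hπ₁.surjective x
    obtain ⟨s', rfl⟩ := hπ₁.surjective y
    rw [hf, hf] at hxy
    exact (hfib _ _).2 hxy
  have hfsurj : Function.Surjective f := by
    intro y
    obtain ⟨t, rfl⟩ := hπ₂.surjective y
    obtain ⟨κ, -, hκ⟩ := hsec t
    obtain ⟨s, -, hs⟩ := hκ.self_of_nhds t rfl
    exact ⟨π₁ s, (hf s).trans hs⟩
  let e : X ≃ Y := Equiv.ofBijective f ⟨hfinj, hfsurj⟩
  have he : ∀ s, e (π₁ s) = π₂ (j s) := hf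
  have hcont : Continuous e := by
    rw [hπ₁.continuous_iff]
    have : e ∘ π₁ = π₂ ∘ j := funext he
    rw [this]
    exact hπ₂.continuous.comp hj
  have hcont' : Continuous e.symm := by
    rw [hπ₂.continuous_iff, continuous_iff_continuousAt]
    intro t₀
    obtain ⟨κ, hκs, hκ⟩ := hsec t₀
    have hev : ∀ᶠ t in 𝓝 t₀, ∃ s, emb₁ s = κ (emb₂ t) ∧ π₂ (j s) = π₂ t :=
      (h₂.continuousAt.eventually hκ).mono fun t ht => ht t rfl
    obtain ⟨s₀, -⟩ := hev.self_of_nhds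
    classical
    -- Choosing lifts pointwise does no harm to continuity at `t₀`: near `t₀` one has `emb₁ ∘ σ = κ
    -- ∘ emb₂`, and `emb₁` is inducing. The value `s₀` is only a default away from `t₀`.
    let σ : S₂ → S₁ := fun t =>
      if h : ∃ s, emb₁ s = κ (emb₂ t) ∧ π₂ (j s) = π₂ t then h.choose else s₀
    have hσ : ∀ᶠ t in 𝓝 t₀, emb₁ (σ t) = κ (emb₂ t) ∧ π₂ (j (σ t)) = π₂ t := by
      filter_upwards [hev] with t ht
      simp only [σ, dif_pos ht]
      exact ht.choose_spec
    have hσc : ContinuousAt σ t₀ := by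
      rw [h₁.continuousAt_iff]
      have : ContinuousAt (fun t => κ (emb₂ t)) t₀ :=
        ContinuousAt.comp (g := κ) (f := emb₂) hκs.continuousAt h₂.continuousAt
      exact this.congr (hσ.mono fun t ht => ht.1.symm)
    have : ContinuousAt (π₁ ∘ σ) t₀ := hπ₁.continuous.continuousAt.comp hσc
    refine this.congr (hσ.mono fun t ht => ?_)
    rw [Function.comp_apply, Function.comp_apply, Equiv.eq_symm_apply, he, ht.2]
  refine ⟨⟨e, hcont, hcont'⟩, he, ?_⟩
  intro V _ g
  constructor
  · rintro ⟨F, hF, hFs⟩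
    refine ⟨F ∘ J, ?_, ?_⟩
    · intro s hs
      have hs' : π₂ (j s) ∈ V := by rw [← he]; exact hs
      change F (J (emb₁ s)) = g (e (π₁ s))
      rw [← hjJ, hF _ hs', he]
    · refine hFs.comp hJ.contDiffOn ?_
      rintro _ ⟨s, hs, rfl⟩
      have hs' : π₂ (j s) ∈ V := by rw [← he]; exact hs
      exact ⟨j s, hs', hjJ s⟩
  · rintro ⟨F, hF, hFs⟩
    classical
    -- The value `0` off the submanifold is immaterial, since smoothness is only asked within the
    -- image of `emb₂`. There `G` agrees near each point with the smooth function `F ∘ κ`.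
    let G : E₂ → ℝ := fun M => if h : ∃ t, emb₂ t = M then g (π₂ h.choose) else 0
    have hG : ∀ t, G (emb₂ t) = g (π₂ t) := by
      intro t
      have h : ∃ t', emb₂ t' = emb₂ t := ⟨t, rfl⟩
      simp only [G, dif_pos h]
      rw [h₂inj h.choose_spec]
    refine ⟨G, fun t _ => hG t, ?_⟩
    rintro _ ⟨t₀, ht₀, rfl⟩
    obtain ⟨κ, hκs, hκ⟩ := hsec t₀
    have key : ∀ᶠ M in 𝓝[emb₂ '' (π₂ ⁻¹' V)] (emb₂ t₀),
        κ M ∈ emb₁ '' (π₁ ⁻¹' (e ⁻¹' V)) ∧ G M = F (κ M) := by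
      filter_upwards [nhdsWithin_le_nhds hκ, self_mem_nhdsWithin] with M hM hMV
      obtain ⟨t, ht, rfl⟩ := hMV
      obtain ⟨s, hs, hst⟩ := hM t rfl
      have hs' : π₁ s ∈ e ⁻¹' V := by
        change e (π₁ s) ∈ V
        rw [he, hst]; exact ht
      refine ⟨⟨s, hs', hs⟩, ?_⟩
      rw [hG, ← hs, hF s hs']
      change _ = g (e (π₁ s))
      rw [he, hst]
    have hmem : emb₂ t₀ ∈ emb₂ '' (π₂ ⁻¹' V) := ⟨t₀, ht₀, rfl⟩
    have h0 := key.self_of_nhdsWithin hmem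
    have hcomp : ContDiffWithinAt ℝ ∞ (F ∘ κ) (emb₂ '' (π₂ ⁻¹' V)) (emb₂ t₀) :=
      (hFs _ h0.1).comp_of_preimage_mem_nhdsWithin _ hκs.contDiffWithinAt
        (key.mono fun M hM => hM.1)
    exact hcomp.congr_of_eventuallyEq (key.mono fun M hM => hM.2) h0.2

end SmoothQuotients

/-! ### Topology and compactness of the unitary elements of a matrix group. -/

section MatrixGroups

variable {ι F : Type*} [Fintype ι] [DecidableEq ι]

theorem mat_injective [Ring F] {G : Subgroup (GLin ι F)} :
    Function.Injective (mat : G → Matrix ι ι F) := fun _ _ h => Subtype.ext (Units.ext h)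

@[simp] theorem mat_mul [Ring F] {G : Subgroup (GLin ι F)} (g h : G) :
    mat (g * h) = mat g * mat h := rfl

@[simp] theorem mat_one [Ring F] {G : Subgroup (GLin ι F)} : mat (1 : G) = 1 := rfl

@[simp] theorem mat_mul_mat_inv [Ring F] {G : Subgroup (GLin ι F)} (g : G) :
    mat g * mat g⁻¹ = 1 := by rw [← mat_mul, mul_inv_cancel, mat_one]

@[simp] theorem mat_inv_mul_mat [Ring F] {G : Subgroup (GLin ι F)} (g : G) :
    mat g⁻¹ * mat g = 1 := by rw [← mat_mul, inv_mul_cancel, mat_one]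

theorem theta_eq_iff [Ring F] [StarRing F] (g : GLin ι F) :
    theta g = g ↔ star (g : Matrix ι ι F) * g = 1 := by
  rw [theta, inv_eq_iff_mul_eq_one, Units.ext_iff]
  simp

theorem mem_maxCompact [Ring F] [StarRing F] {G : Subgroup (GLin ι F)} {g : G} :
    g ∈ maxCompact G ↔ star (mat g) * mat g = 1 := theta_eq_iff (g : GLin ι F)

theorem mat_inv_of_mem_maxCompact [Ring F] [StarRing F] {G : Subgroup (GLin ι F)} {g : G}
    (hg : g ∈ maxCompact G) : mat g⁻¹ = star (mat g) := by
  rw [mem_maxCompact] at hg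
  exact (left_inv_eq_right_inv hg (mat_mul_mat_inv g)).symm

theorem mat_mul_star_of_mem_maxCompact [Ring F] [StarRing F] {G : Subgroup (GLin ι F)} {g : G}
    (hg : g ∈ maxCompact G) : mat g * star (mat g) = 1 := by
  rw [← mat_inv_of_mem_maxCompact hg, mat_mul_mat_inv]

theorem continuous_mat [NormedRing F] {G : Subgroup (GLin ι F)} :
    Continuous (mat : G → Matrix ι ι F) :=
  Units.continuous_val.comp continuous_subtype_val

/-- The topology of the unit group records `g` and `g⁻¹`. For unitary `g` the inverse is `star g`, a
continuous function of the matrix, so the matrix alone determines the topology. -/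
theorem isInducing_units_val_of_unitary [NormedRing F] [StarRing F] [ContinuousStar F]
    {S : Type*} [TopologicalSpace S] (f : S → GLin ι F) (hf : IsInducing f)
    (hu : ∀ x, star (f x : Matrix ι ι F) * f x = 1) :
    IsInducing (fun x => (f x : Matrix ι ι F)) := by
  have hc : Continuous fun M : Matrix ι ι F => (M, MulOpposite.op (star M)) := by fun_prop
  refine IsInducing.of_comp (Units.continuous_val.comp hf.continuous) hc ?_
  have : ((fun M : Matrix ι ι F => (M, MulOpposite.op (star M))) ∘
      fun x => (f x : Matrix ι ι F)) = Units.embedProduct _ ∘ f := by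
    funext x
    have : star (f x : Matrix ι ι F) = ((f x)⁻¹ : GLin ι F) := by
      rw [eq_comm]; exact Units.inv_eq_of_mul_eq_one_left (hu x)
    exact Prod.ext rfl (congrArg MulOpposite.op this)
  rw [this]
  exact Units.isInducing_embedProduct.comp hf

theorem isInducing_mat_maxCompact [NormedRing F] [StarRing F] [ContinuousStar F]
    {G : Subgroup (GLin ι F)} : IsInducing (fun k : maxCompact G => mat (k : G)) :=
  isInducing_units_val_of_unitary (fun k : maxCompact G => ((k : G) : GLin ι F))
    (IsInducing.subtypeVal.comp IsInducing.subtypeVal) fun k => mem_maxCompact.1 k.2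

/-- The set of unitary matrices. -/
def unitarySet (ι F : Type*) [Fintype ι] [DecidableEq ι] [Ring F] [StarRing F] :
    Set (Matrix ι ι F) := {M | star M * M = 1 ∧ M * star M = 1}

/-- The unitary matrices map continuously to `GLin` with inverse `star`, so they form a compact set
there, and `K` is its preimage under a closed embedding. -/
theorem isCompact_maxCompact [NormedRing F] [StarRing F] [ContinuousStar F]
    (hU : IsCompact (unitarySet ι F)) {G : Subgroup (GLin ι F)} (hG : IsClosed (G : Set (GLin ι F))) :
    IsCompact (maxCompact G : Set G) := by
  let u : unitarySet ι F → GLin ι F := fun M => ⟨M, star M.1, M.2.2, M.2.1⟩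
  have hu : Continuous u := by
    refine Units.continuous_iff.2 ⟨continuous_subtype_val, ?_⟩
    exact continuous_star.comp continuous_subtype_val
  have : CompactSpace (unitarySet ι F) := isCompact_iff_compactSpace.1 hU
  have h1 : IsCompact (Set.range u) := isCompact_range hu
  have h2 := (hG.isClosedEmbedding_subtypeVal).isCompact_preimage h1
  refine (congrArg IsCompact (Set.ext fun g => ?_)).mpr h2
  constructor
  · intro hg
    exact ⟨⟨mat g, mem_maxCompact.1 hg, mat_mul_star_of_mem_maxCompact hg⟩, Units.ext rfl⟩
  · rintro ⟨M, hM⟩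
    refine mem_maxCompact.2 ?_
    have : mat g = M := by rw [mat, ← hM]
    rw [this]; exact M.2.1

end MatrixGroups

/-! ### From transitivity and a section at `1` to the diffeomorphism; symmetric subgroups from
involutions. -/

section Realization

attribute [local instance] Matrix.normedAddCommGroup Matrix.normedSpace

variable {ι F : Type*} [Fintype ι] [DecidableEq ι] [NormedRing F] [NormedAlgebra ℝ F]

theorem _root_.ContDiffAt.matrix_mul {E : Type*} [NormedAddCommGroup E] [NormedSpace ℝ E]
    {f g : E → Matrix ι ι F} {x : E} (hf : ContDiffAt ℝ ∞ f x) (hg : ContDiffAt ℝ ∞ g x) :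
    ContDiffAt ℝ ∞ (fun y => f y * g y) x := by
  refine contDiffAt_pi.2 fun i => contDiffAt_pi.2 fun j => ?_
  simp only [Matrix.mul_apply]
  refine ContDiffAt.sum fun k _ => ?_
  exact (contDiffAt_pi.1 (contDiffAt_pi.1 hf i) k).mul (contDiffAt_pi.1 (contDiffAt_pi.1 hg k) j)

/-- `κ` is a smooth local section near the identity of the orbit map of the maximal compact subgroup
on `G / P`. -/
def IsLocalSection [StarRing F] (G : Subgroup (GLin ι F)) (P : Subgroup G)
    (κ : Matrix ι ι F → Matrix ι ι F) : Prop :=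
  ContDiffAt ℝ ∞ κ 1 ∧ ∀ᶠ M in 𝓝 (1 : Matrix ι ι F), ∀ g : G, mat g = M →
    ∃ k ∈ maxCompact G, mat k = κ M ∧ k⁻¹ * g ∈ P

/-- Writing `g₀ = k₀ * p₀`, the section at `1` is carried to `g₀` as `M ↦ k₀ * κ (k₀⁻¹ * M * p₀⁻¹)`;
the right translation by `p₀` does not affect cosets of `P`. -/
theorem exists_homeomorph_quotient [StarRing F] [ContinuousStar F] (G : Subgroup (GLin ι F))
    (P : Subgroup G) (hT : ∀ g : G, ∃ k ∈ maxCompact G, k⁻¹ * g ∈ P)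
    {κ : Matrix ι ι F → Matrix ι ι F} (hκ : IsLocalSection G P κ) :
    ∃ φ : (maxCompact G ⧸ P.subgroupOf (maxCompact G)) ≃ₜ (G ⧸ P),
      (∀ k : maxCompact G,
        φ (k : maxCompact G ⧸ P.subgroupOf (maxCompact G)) = ((k : G) : G ⧸ P)) ∧
      IsDiffeo (smoothSubQuot (maxCompact G) (P.subgroupOf (maxCompact G))) (smoothQuot G P) φ := by
  refine exists_isDiffeo_of_local_sections _ _ _ _ isInducing_mat_maxCompact continuous_mat
    mat_injective isQuotientMap_quotient_mk' isQuotientMap_quotient_mk' (fun k : maxCompact G => (k : G))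
    continuous_subtype_val id contDiff_id (fun _ => rfl) ?_ ?_
  · intro s s'
    change ((s : maxCompact G ⧸ P.subgroupOf (maxCompact G)) = s') ↔ (((s : G) : G ⧸ P) = (s' : G))
    rw [QuotientGroup.eq, QuotientGroup.eq, Subgroup.mem_subgroupOf]
    rfl
  · intro g₀
    obtain ⟨k₀, hk₀, hp₀⟩ := hT g₀
    set p₀ : G := k₀⁻¹ * g₀ with hp₀def
    obtain ⟨hs, hκ⟩ := hκ
    have h1 : mat k₀⁻¹ * mat g₀ * mat p₀⁻¹ = 1 := by
      rw [← mat_mul, ← mat_mul, ← hp₀def, mul_inv_cancel, mat_one]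
    have hL : ContDiffAt ℝ ∞ (fun M : Matrix ι ι F => mat k₀⁻¹ * M * mat p₀⁻¹) (mat g₀) :=
      (contDiffAt_const.matrix_mul contDiffAt_id).matrix_mul contDiffAt_const
    refine ⟨fun M => mat k₀ * κ (mat k₀⁻¹ * M * mat p₀⁻¹), ?_, ?_⟩
    · refine contDiffAt_const.matrix_mul ?_
      refine ContDiffAt.comp (g := κ) (f := fun M : Matrix ι ι F => mat k₀⁻¹ * M * mat p₀⁻¹)
        _ ?_ hL
      rw [h1]; exact hs
    · have hc := hL.continuousAt
      rw [ContinuousAt, h1] at hc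
      filter_upwards [hc.eventually hκ] with M hM t ht
      obtain ⟨k, hk, hkκ, hkP⟩ := hM (k₀⁻¹ * t * p₀⁻¹) (by rw [← ht]; rfl)
      refine ⟨⟨k₀ * k, mul_mem hk₀ hk⟩, ?_, ?_⟩
      · change mat (k₀ * k) = _
        rw [mat_mul, hkκ]
      · change ((k₀ * k : G) : G ⧸ P) = t
        rw [QuotientGroup.eq]
        have := mul_mem hkP hp₀
        convert this using 1
        group

theorem isPretransitive_maxCompact [StarRing F] (G : Subgroup (GLin ι F)) (P : Subgroup G)
    (hT : ∀ g : G, ∃ k ∈ maxCompact G, k⁻¹ * g ∈ P) :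
    MulAction.IsPretransitive (maxCompact G) (G ⧸ P) := by
  have key : ∀ x : G ⧸ P, ∃ k : maxCompact G, k • ((1 : G) : G ⧸ P) = x := by
    intro x
    obtain ⟨g, rfl⟩ := QuotientGroup.mk_surjective x
    obtain ⟨k, hk, hp⟩ := hT g
    refine ⟨⟨k, hk⟩, ?_⟩
    change (((k * 1 : G)) : G ⧸ P) = g
    rw [mul_one, QuotientGroup.eq]; exact hp
  refine ⟨fun x y => ?_⟩
  obtain ⟨k, rfl⟩ := key x
  obtain ⟨k', rfl⟩ := key y
  exact ⟨k' * k⁻¹, by simp [mul_smul]⟩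

/-- Conjugation by an orthogonal involution `s` which normalizes `G`, as an automorphism of the
maximal compact subgroup of `G`. -/
def conjEquiv [StarRing F] (G : Subgroup (GLin ι F)) (s : GLin ι F) (hs : s * s = 1)
    (hss : star (s : Matrix ι ι F) = s) (hG : ∀ g ∈ G, s * g * s ∈ G) :
    maxCompact G ≃* maxCompact G :=
  have h : ∀ k : maxCompact G, (⟨s * (k : G) * s, hG _ k.1.2⟩ : G) ∈ maxCompact G := by
    intro k
    have h1 := mem_maxCompact.1 k.2
    have h2 : (s : Matrix ι ι F) * s = 1 := by rw [← Units.val_mul, hs, Units.val_one]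
    rw [mem_maxCompact]
    change star ((s : Matrix ι ι F) * mat (k : G) * s) * ((s : Matrix ι ι F) * mat (k : G) * s) = 1
    rw [star_mul, star_mul, hss]
    calc (s : Matrix ι ι F) * (star (mat (k : G)) * s) * (s * mat (k : G) * s)
        = s * (star (mat (k : G)) * (s * s) * mat (k : G)) * s := by simp only [mul_assoc]
      _ = 1 := by rw [h2, mul_one, h1, mul_one, h2]
  have hinv : ∀ k : maxCompact G, (⟨⟨s * (⟨⟨s * (k : G) * s, hG _ k.1.2⟩, h k⟩ : maxCompact G).1 * s,
      hG _ (hG _ k.1.2)⟩, h ⟨⟨s * (k : G) * s, hG _ k.1.2⟩, h k⟩⟩ : maxCompact G) = k := by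
    intro k
    apply Subtype.ext; apply Subtype.ext
    change s * (s * ((k : G) : GLin ι F) * s) * s = _
    calc s * (s * ((k : G) : GLin ι F) * s) * s = (s * s) * ((k : G) : GLin ι F) * (s * s) := by
          simp only [mul_assoc]
      _ = _ := by rw [hs, one_mul, mul_one]
  { toFun := fun k => ⟨⟨s * (k : G) * s, hG _ k.1.2⟩, h k⟩
    invFun := fun k => ⟨⟨s * (k : G) * s, hG _ k.1.2⟩, h k⟩
    left_inv := hinv
    right_inv := hinv
    map_mul' := by
      intro a b
      apply Subtype.ext; apply Subtype.ext
      change s * (((a : G) : GLin ι F) * ((b : G) : GLin ι F)) * s =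
        s * ((a : G) : GLin ι F) * s * (s * ((b : G) : GLin ι F) * s)
      calc s * (((a : G) : GLin ι F) * ((b : G) : GLin ι F)) * s
          = s * ((a : G) : GLin ι F) * 1 * ((b : G) : GLin ι F) * s := by
            simp only [mul_assoc, one_mul]
        _ = _ := by rw [← hs]; simp only [mul_assoc] }

theorem conjEquiv_eq_iff [StarRing F] (G : Subgroup (GLin ι F)) (s : GLin ι F) (hs : s * s = 1)
    (hss : star (s : Matrix ι ι F) = s) (hG : ∀ g ∈ G, s * g * s ∈ G) (k : maxCompact G) :
    conjEquiv G s hs hss hG k = k ↔ (s : Matrix ι ι F) * mat (k : G) = mat (k : G) * s := by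
  have h2 : (s : Matrix ι ι F) * s = 1 := by rw [← Units.val_mul, hs, Units.val_one]
  have h3 : conjEquiv G s hs hss hG k = k ↔ (s : Matrix ι ι F) * mat (k : G) * s = mat (k : G) := by
    rw [Subtype.ext_iff, Subtype.ext_iff, Units.ext_iff]
    rfl
  rw [h3]
  constructor
  · intro h
    have h4 := congrArg (· * (s : Matrix ι ι F)) h
    simpa only [mul_assoc, h2, mul_one] using h4
  · intro h
    rw [h, mul_assoc, h2, mul_one]

/-- The fixed group of conjugation by `s`, together with a continuous function with values `±1`
on it that detects membership in `P`, shows that `P ∩ K` is a symmetric subgroup. -/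
theorem isSymmetricSubgroup_of_conj [StarRing F] (G : Subgroup (GLin ι F))
    (P : Subgroup G) (s : GLin ι F) (hs : s * s = 1) (hss : star (s : Matrix ι ι F) = s)
    (hG : ∀ g ∈ G, s * g * s ∈ G)
    (hP : ∀ k ∈ maxCompact G, k ∈ P → (s : Matrix ι ι F) * mat k = mat k * s)
    (f : Matrix ι ι F → ℂ) (hf : Continuous f) (hf1 : f 1 = 1)
    (hfs : ∀ k ∈ maxCompact G, (s : Matrix ι ι F) * mat k = mat k * s →
      f (mat k) = 1 ∨ f (mat k) = -1)
    (hfP : ∀ k ∈ maxCompact G, (s : Matrix ι ι F) * mat k = mat k * s → f (mat k) = 1 → k ∈ P) :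
    IsSymmetricSubgroup (P.subgroupOf (maxCompact G)) := by
  refine ⟨conjEquiv G s hs hss hG, ?_, ?_, ?_, ?_⟩
  · refine Continuous.subtype_mk (Continuous.subtype_mk ?_ _) _
    exact (continuous_const.mul (continuous_subtype_val.comp continuous_subtype_val)).mul
      continuous_const
  · exact fun k => (conjEquiv G s hs hss hG).left_inv k
  · intro k hk
    exact (conjEquiv_eq_iff G s hs hss hG k).2 (hP _ k.2 hk)
  · rintro _ ⟨k, hk, rfl⟩
    have hfix : ∀ x : MonoidHom.eqLocus (conjEquiv G s hs hss hG).toMonoidHom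
        (MonoidHom.id (maxCompact G)), (s : Matrix ι ι F) * mat (x.1 : G) = mat (x.1 : G) * s :=
      fun x => (conjEquiv_eq_iff G s hs hss hG x.1).1 x.2
    have hc : Continuous fun x : MonoidHom.eqLocus (conjEquiv G s hs hss hG).toMonoidHom
        (MonoidHom.id (maxCompact G)) => f (mat (x.1 : G)) :=
      hf.comp (continuous_mat.comp (continuous_subtype_val.comp continuous_subtype_val))
    -- On the fixed group `f` takes values in a discrete set, so on its identity component it keeps
    -- the value `f 1`.
    have hdisc : IsDiscrete ({1, -1} : Set ℂ) := Set.Finite.isDiscrete (by simp)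
    have hpre : f (mat (k.1 : G)) = f 1 := isPreconnected_connectedComponent.constant_of_mapsTo hdisc
      hc.continuousOn (fun x _ => by simpa using hfs _ x.1.2 (hfix x)) hk
      mem_connectedComponent
    refine hfP _ k.1.2 (hfix k) (hpre.trans hf1)

end Realization

/-! ### Square roots and rotations between projections in a Banach algebra with involution. -/

section StarAlgebra

variable {A : Type*} [NormedRing A]

/-- The difference of the squares is `2(x - y) + y(x - y) + (x - y)x`, and the last two terms
together have norm at most `(‖x‖ + ‖y‖)‖x - y‖`, with factor below `2`. -/
theorem eq_of_mul_self_eq_of_norm_lt {x y : A} (hx : ‖x‖ < 1 / 2) (hy : ‖y‖ < 1 / 2)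
    [NormedAlgebra ℝ A] (h : (1 + x) * (1 + x) = (1 + y) * (1 + y)) : x = y := by
  have h1 : (2 : ℝ) • (x - y) = -(y * (x - y) + (x - y) * x) := by
    have : (1 + x) * (1 + x) - (1 + y) * (1 + y) = 0 := sub_eq_zero.2 h
    have h2 : (1 + x) * (1 + x) - (1 + y) * (1 + y) =
        (2 : ℝ) • (x - y) + (y * (x - y) + (x - y) * x) := by
      rw [two_smul]; noncomm_ring
    rw [h2] at this
    exact eq_neg_of_add_eq_zero_left this
  have h2 : 2 * ‖x - y‖ ≤ ‖y‖ * ‖x - y‖ + ‖x - y‖ * ‖x‖ := by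
    calc 2 * ‖x - y‖ = ‖(2 : ℝ) • (x - y)‖ := by rw [norm_smul]; simp
      _ = ‖y * (x - y) + (x - y) * x‖ := by rw [h1, norm_neg]
      _ ≤ ‖y * (x - y)‖ + ‖(x - y) * x‖ := norm_add_le _ _
      _ ≤ _ := add_le_add (norm_mul_le _ _) (norm_mul_le _ _)
  have h3 : ‖x - y‖ ≤ 0 := by nlinarith [norm_nonneg (x - y)]
  exact sub_eq_zero.1 (norm_le_zero_iff.1 h3)

variable [NormedAlgebra ℝ A] [CompleteSpace A]

/-- If `a² b² = 1`, then `a` and `b⁻¹` are square roots of the same element, and square roots near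
`1` are unique. This is how a relation `ab = 1` is inherited by square roots: unitarity, inversion
by a reflection, invariance of a form. -/
theorem eventually_mul_eq_one_of_sq : ∀ᶠ p : A × A in 𝓝 (1, 1),
    p.1 * p.1 * (p.2 * p.2) = 1 → p.1 * p.2 = 1 ∧ p.2 * p.1 = 1 := by
  have hball : ∀ᶠ a : A in 𝓝 1, ‖a - 1‖ < 1 / 2 := by
    have : Tendsto (fun a : A => ‖a - 1‖) (𝓝 1) (𝓝 0) := by
      have h : Continuous fun a : A => ‖a - 1‖ := by fun_prop
      simpa using h.tendsto 1
    exact this.eventually_lt_const (by norm_num)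
  have hinv : ∀ᶠ a : A in 𝓝 1, ‖Ring.inverse a - 1‖ < 1 / 2 := by
    have : Tendsto (Ring.inverse : A → A) (𝓝 1) (𝓝 1) := by
      simpa [ContinuousAt] using NormedRing.inverse_continuousAt (1 : Aˣ)
    exact this.eventually hball
  have hunit : ∀ᶠ a : A in 𝓝 1, IsUnit a := Units.isOpen.mem_nhds isUnit_one
  have h1 : Tendsto (Prod.fst : A × A → A) (𝓝 (1, 1)) (𝓝 1) := continuous_fst.tendsto (1, 1)
  have h2 : Tendsto (Prod.snd : A × A → A) (𝓝 (1, 1)) (𝓝 1) := continuous_snd.tendsto (1, 1)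
  filter_upwards [h1.eventually hball, h2.eventually hinv, h2.eventually hunit] with p hp1 hp2 hu hp
  obtain ⟨u, hu⟩ := hu
  rw [← hu, Ring.inverse_unit] at hp2
  rw [← hu] at hp ⊢
  have h3 : p.1 * p.1 = (u⁻¹ : Aˣ) * (u⁻¹ : Aˣ) := by
    calc p.1 * p.1 = p.1 * p.1 * ((u : A) * u) * ((u⁻¹ : Aˣ) * (u⁻¹ : Aˣ)) := by
          simp [mul_assoc]
      _ = _ := by rw [hp, one_mul]
  have h4 : p.1 - 1 = (u⁻¹ : Aˣ) - 1 := eq_of_mul_self_eq_of_norm_lt hp1 hp2 (by simpa using h3)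
  have h5 : p.1 = (u⁻¹ : Aˣ) := sub_left_injective h4
  rw [h5]; simp

/-- The inverse function theorem for `x ↦ x * x`, whose derivative at `1` is multiplication by `2`.
-/
theorem exists_contDiffAt_sqrt : ∃ r : A → A, ContDiffAt ℝ ∞ r 1 ∧ r 1 = 1 ∧
    ∀ᶠ h in 𝓝 (1 : A), r h * r h = h := by
  let f : A → A := fun x => x * x
  have hf : ContDiffAt ℝ ∞ f 1 := contDiffAt_id.mul contDiffAt_id
  let f' : A ≃L[ℝ] A := ContinuousLinearEquiv.smulLeft (Units.mk0 (2 : ℝ) two_ne_zero)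
  have hf' : HasFDerivAt f (f' : A →L[ℝ] A) 1 := by
    have := (hasFDerivAt_id (𝕜 := ℝ) (1 : A)).mul' (hasFDerivAt_id (𝕜 := ℝ) (1 : A))
    convert! this using 1
    ext x
    simp [f', two_smul, Units.smul_def]
  have h1 : f 1 = 1 := mul_one 1
  refine ⟨hf.localInverse hf' (by simp), ?_, ?_, ?_⟩
  · have := hf.to_localInverse hf' (by simp)
    rwa [h1] at this
  · have := hf.localInverse_apply_image hf' (by simp)
    rwa [h1] at this
  · have := (hf.hasStrictFDerivAt' hf' (by simp)).eventually_right_inverse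
    rw [h1] at this
    exact this

variable [StarRing A] [ContinuousStar A] [StarModule ℝ A]

/-- Both sides are self-adjoint and act as the identity on the common image of `k * p * e` and `k *
e`, so `R * Q = Q` and `Q * R = R`; taking adjoints gives `R = Q`. The summand `1 - e` in `N` makes
the Gram element of the corner `e A e` invertible in the whole algebra. The left side involves `k`
and `p` only through their product. -/
theorem orthogonal_projection_eq {e k p p' : A} (hee : e * e = e) (hes : star e = e)
    (hk1 : star k * k = 1) (hpp : p * p' = 1) (hp : p * e = e * p * e)
    (hp' : p' * e = e * p' * e) {N n : A}
    (hN : N = e * star (k * p) * (k * p) * e + (1 - e)) (hNn : N * n = 1) (hnN : n * N = 1) :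
    (k * p) * e * n * e * star (k * p) = k * e * star k := by
  set M := k * p with hM
  have hsN : star N = N := by
    rw [hN]; simp only [star_add, star_mul, star_sub, star_one, star_star, hes, mul_assoc]
  have hsn : star n = n := by
    have h := congrArg star hNn
    rw [star_mul, hsN, star_one] at h
    exact left_inv_eq_right_inv h hNn
  have hNe : N * e = e * star M * M * e := by
    rw [hN, add_mul, sub_mul, one_mul, hee, sub_self, add_zero, mul_assoc _ e e, hee]
  set Q := k * e * star k with hQ
  set R := M * e * n * e * star M with hR
  have hRM : R * (M * e) = M * e := by
    calc R * (M * e) = M * e * n * (e * star M * M * e) := by simp only [hR, mul_assoc]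
      _ = M * e * (n * N) * e := by rw [← hNe]; simp only [mul_assoc]
      _ = M * e := by rw [hnN, mul_one, mul_assoc, hee]
  have hQM : Q * (M * e) = M * e := by
    calc Q * (M * e) = k * e * (star k * k) * p * e := by simp only [hQ, hM, mul_assoc]
      _ = k * (e * p * e) := by rw [hk1, mul_one]; simp only [mul_assoc]
      _ = M * e := by rw [← hp, hM, mul_assoc]
  have hke : Q = M * e * (p' * e * star k) := by
    calc Q = k * (p * p') * e * star k := by rw [hpp, mul_one]
      _ = k * p * (p' * e) * star k := by simp only [mul_assoc]
      _ = k * p * (e * p' * e) * star k := by rw [← hp']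
      _ = M * e * (p' * e * star k) := by simp only [hM, mul_assoc]
  have h1 : R * Q = Q := by rw [hke, ← mul_assoc, hRM]
  have h2 : Q * R = R := by
    have : R = M * e * (n * e * star M) := by simp only [hR, mul_assoc]
    rw [this, ← mul_assoc, hQM]
  have hsR : star R = R := by
    simp only [hR, star_mul, star_star, hes, hsn, mul_assoc]
  have hsQ : star Q = Q := by
    simp only [hQ, star_mul, star_star, hes, mul_assoc]
  have h3 := congrArg star h1
  rw [star_mul, hsQ, hsR, h2] at h3
  exact h3

/-- The orthogonal projections `k e k*`, for `k` unitary, are conjugate to `e` by a unitary element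
which near `1` is a smooth function of any `k p` with `p` in the parabolic subgroup of `e`. -/
theorem exists_smooth_unitary (e : A) (hee : e * e = e) (hes : star e = e) :
    ∃ κ : A → A, ContDiffAt ℝ ∞ κ 1 ∧ κ 1 = 1 ∧ ∀ᶠ M in 𝓝 (1 : A), ∀ k p p' : A,
      star k * k = 1 → k * star k = 1 → p * p' = 1 → p * e = e * p * e → p' * e = e * p' * e →
      k * p = M → star (κ M) * κ M = 1 ∧ κ M * star (κ M) = 1 ∧
        κ M * κ M = k * (2 * e - 1) * star k * (2 * e - 1) ∧
        κ M * e * star (κ M) = k * e * star k := by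
  obtain ⟨r, hr, hr1, hrr⟩ := exists_contDiffAt_sqrt (A := A)
  set s : A := 2 * e - 1 with hs
  have hss : s * s = 1 := by
    have : s * s = 4 * (e * e) - 4 * e + 1 := by rw [hs]; noncomm_ring
    rw [this, hee, sub_self, zero_add]
  have hsstar : star s = s := by
    rw [hs, two_mul, star_sub, star_add, star_one, hes]
  let N : A → A := fun M => e * star M * M * e + (1 - e)
  -- This is `(2Q - 1) * s` with `Q = k * e * star k` expressed through `M = k * p`. Geometrically
  -- it is twice the rotation from the image of `e` to that of `Q`, whence the square root.
  let h : A → A := fun M => (2 * (M * e * Ring.inverse (N M) * e * star M) - 1) * s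
  have hN1 : N 1 = 1 := by
    change e * star (1 : A) * 1 * e + (1 - e) = 1
    rw [star_one, mul_one, mul_one, hee]; abel
  have hh1 : h 1 = 1 := by
    change (2 * (1 * e * Ring.inverse (N 1) * e * star (1 : A)) - 1) * s = 1
    rw [hN1, Ring.inverse_one, star_one, mul_one, mul_one, one_mul, hee, ← hs, hss]
  have hstar : ContDiffAt ℝ ∞ (fun M : A => star M) 1 :=
    (starL' ℝ : A ≃L[ℝ] A).contDiff.contDiffAt
  have hNs : ContDiffAt ℝ ∞ N 1 :=
    (((contDiffAt_const.mul hstar).mul contDiffAt_id).mul contDiffAt_const).add contDiffAt_const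
  have hinv : ContDiffAt ℝ ∞ (fun M => Ring.inverse (N M)) 1 := by
    refine ContDiffAt.comp (g := Ring.inverse) (f := N) _ ?_ hNs
    rw [hN1]; exact contDiffAt_ringInverse ℝ (1 : Aˣ)
  have hhs : ContDiffAt ℝ ∞ h 1 :=
    ((contDiffAt_const.mul ((((contDiffAt_id.mul contDiffAt_const).mul hinv).mul
      contDiffAt_const).mul hstar)).sub contDiffAt_const).mul contDiffAt_const
  have hκs : ContDiffAt ℝ ∞ (fun M => r (h M)) 1 := by
    refine ContDiffAt.comp (g := r) (f := h) _ ?_ hhs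
    rw [hh1]; exact hr
  have hκ1 : r (h 1) = 1 := by rw [hh1, hr1]
  refine ⟨fun M => r (h M), hκs, hκ1, ?_⟩
  have hκt : Tendsto (fun M => r (h M)) (𝓝 1) (𝓝 1) := by
    have := hκs.continuousAt.tendsto
    rwa [hκ1] at this
  have hht : Tendsto h (𝓝 1) (𝓝 1) := by
    have := hhs.continuousAt.tendsto
    rwa [hh1] at this
  have hNt : Tendsto N (𝓝 1) (𝓝 1) := by
    have := hNs.continuousAt.tendsto
    rwa [hN1] at this
  have hst : Tendsto (fun M => star (r (h M))) (𝓝 1) (𝓝 1) := by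
    have := (continuous_star (R := A)).tendsto 1
    rw [star_one] at this
    exact this.comp hκt
  have hct : Tendsto (fun M => s * r (h M) * s) (𝓝 1) (𝓝 1) := by
    have := (hκt.const_mul s).mul_const s
    rwa [mul_one, hss] at this
  have hunit : ∀ᶠ a : A in 𝓝 1, IsUnit a := Units.isOpen.mem_nhds isUnit_one
  filter_upwards [hht.eventually hrr, hNt.eventually hunit,
    (hst.prodMk_nhds hκt).eventually eventually_mul_eq_one_of_sq,
    (hct.prodMk_nhds hκt).eventually eventually_mul_eq_one_of_sq] with M h1 h2 h3 h4 k p p' hk1 hk2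
    hpp hp hp' hM
  have hproj := orthogonal_projection_eq hee hes hk1 hpp hp hp' rfl
    (N := e * star (k * p) * (k * p) * e + (1 - e)) (n := Ring.inverse (N M))
    (by rw [hM]; exact Ring.mul_inverse_cancel _ h2) (by rw [hM]; exact Ring.inverse_mul_cancel _ h2)
  rw [hM] at hproj
  have hhM : h M = k * s * star k * s := by
    change (2 * (M * e * Ring.inverse (N M) * e * star M) - 1) * s = _
    rw [hproj]
    congr 1
    have : k * s * star k = 2 * (k * e * star k) - k * star k := by rw [hs]; noncomm_ring
    rw [this, hk2]
  set c := r (h M) with hc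
  have hsq : c * c = k * s * star k * s := h1.trans hhM
  -- `c * c` is unitary, so `(star c)² c² = 1`, and uniqueness of square roots near `1` gives `star
  -- c * c = 1`.
  have hu := h3 (by
    rw [← star_mul, hsq]
    simp only [star_mul, hsstar, star_star]
    calc s * (k * (s * star k)) * (k * s * star k * s)
        = s * (k * (s * (star k * k) * s) * star k) * s := by simp only [mul_assoc]
      _ = 1 := by rw [hk1, mul_one, hss, mul_one, hk2, mul_one, hss])
  -- Conjugation by `s` inverts `c * c`, a product of an involution with `s`; hence it inverts `c`.
  have hv := h4 (by
    calc s * c * s * (s * c * s) * (c * c) = s * (c * (s * s) * c) * s * (c * c) := by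
          simp only [mul_assoc]
      _ = s * (k * s * star k * s) * s * (k * s * star k * s) := by rw [hss, mul_one, hsq]
      _ = s * (k * s * star k * (s * s) * k * s * star k) * s := by simp only [mul_assoc]
      _ = s * (k * s * (star k * k) * s * star k) * s := by rw [hss]; simp only [mul_assoc, one_mul]
      _ = s * (k * (s * s) * star k) * s := by rw [hk1]; simp only [mul_assoc, one_mul]
      _ = 1 := by rw [hss, mul_one, hk2, mul_one, hss])
  refine ⟨hu.1, hu.2, hsq, ?_⟩
  have hcs : s * c * s = star c := left_inv_eq_right_inv hv.1 hu.2
  -- Since `star c = s * c * s`, the conjugate of `s` by `c` is `c² * s`, which is `k * s * star k`.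
  -- Replacing `s` by `2 * e - 1` and halving gives the claim on projections.
  have h5 : c * s * star c = k * s * star k := by
    calc c * s * star c = c * (s * s) * c * s := by rw [← hcs]; simp only [mul_assoc]
      _ = k * s * star k * (s * s) := by rw [hss, mul_one, hsq, mul_assoc, hss]
      _ = _ := by rw [hss, mul_one]
  have h6 : (2 : ℝ) • (c * e * star c) = (2 : ℝ) • (k * e * star k) := by
    have e1 : c * s * star c = (2 : ℝ) • (c * e * star c) - c * star c := by
      rw [hs, two_smul]; noncomm_ring
    have e2 : k * s * star k = (2 : ℝ) • (k * e * star k) - k * star k := by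
      rw [hs, two_smul]; noncomm_ring
    rw [e1, e2, hu.2, hk2] at h5
    exact sub_left_injective h5
  exact smul_right_injective A (two_ne_zero (α := ℝ)) h6

end StarAlgebra

/-- A real normed division algebra with a conjugation such that `x̄ x = ‖x‖²`. -/
class ConjugationAlgebra (F : Type*) [NormedDivisionRing F] [NormedAlgebra ℝ F] [StarRing F] :
    Prop where
  star_mul_self (x : F) : star x * x = algebraMap ℝ F (‖x‖ ^ 2)

instance : ConjugationAlgebra ℝ where
  star_mul_self x := by simp [sq]

instance : ConjugationAlgebra ℂ where
  star_mul_self x := by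
    have := Complex.conj_mul' x
    simpa using this

instance : ConjugationAlgebra ℍ[ℝ] where
  star_mul_self x := by
    rw [Quaternion.star_mul_self, Quaternion.normSq_eq_norm_mul_self, sq]
    rfl

instance : StarModule ℝ ℍ[ℝ] where
  star_smul r x := by
    rw [star_trivial r, Algebra.smul_def, star_mul, Algebra.smul_def, Algebra.commutes]
    exact congrArg _ (Quaternion.star_coe r)

/-! ### Transfer to matrices, compactness of the unitary set, and Householder triangularization. -/

section Transfer

attribute [local instance] Matrix.normedAddCommGroup Matrix.normedSpace

variable {ι F : Type*} [Fintype ι] [DecidableEq ι] [NormedDivisionRing F] [NormedAlgebra ℝ F]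
  [StarRing F] [StarModule ℝ F] [ContinuousStar F] [FiniteDimensional ℝ F]

/-- The algebra of square matrices, with a norm that makes it a normed algebra. -/
def OpMatrix (ι F : Type*) := Matrix ι ι F

noncomputable instance : NormedRing (OpMatrix ι F) := Matrix.linftyOpNormedRing

noncomputable instance : NormedAlgebra ℝ (OpMatrix ι F) := Matrix.linftyOpNormedAlgebra

instance : StarRing (OpMatrix ι F) := inferInstanceAs (StarRing (Matrix ι ι F))

instance : FiniteDimensional ℝ (OpMatrix ι F) :=
  inferInstanceAs (FiniteDimensional ℝ (Matrix ι ι F))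

instance : StarModule ℝ (OpMatrix ι F) := inferInstanceAs (StarModule ℝ (Matrix ι ι F))

instance : CompleteSpace (OpMatrix ι F) := FiniteDimensional.complete ℝ _

instance : ContinuousStar (OpMatrix ι F) where
  continuous_star :=
    LinearMap.continuous_of_finiteDimensional
      ({ toFun := star, map_add' := star_add, map_smul' := by simp } :
        OpMatrix ι F →ₗ[ℝ] OpMatrix ι F)

/-- The identity map between the two normed spaces of matrices. -/
noncomputable def toOpMatrix (ι F : Type*) [Fintype ι] [DecidableEq ι] [NormedDivisionRing F]
    [NormedAlgebra ℝ F] [FiniteDimensional ℝ F] : Matrix ι ι F ≃L[ℝ] OpMatrix ι F :=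
  LinearEquiv.toContinuousLinearEquiv
    ({ Equiv.refl _ with map_add' := fun _ _ => rfl, map_smul' := fun _ _ => rfl } :
      Matrix ι ι F ≃ₗ[ℝ] OpMatrix ι F)

theorem matrix_eventually_mul_eq_one_of_sq :
    ∀ᶠ p : Matrix ι ι F × Matrix ι ι F in 𝓝 (1, 1),
      p.1 * p.1 * (p.2 * p.2) = 1 → p.1 * p.2 = 1 ∧ p.2 * p.1 = 1 := by
  have h : Tendsto (fun p : Matrix ι ι F × Matrix ι ι F => (toOpMatrix ι F p.1, toOpMatrix ι F p.2))
      (𝓝 (1, 1)) (𝓝 ((1, 1) : OpMatrix ι F × OpMatrix ι F)) :=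
    (((toOpMatrix ι F).continuous.comp continuous_fst).prodMk
      ((toOpMatrix ι F).continuous.comp continuous_snd)).tendsto (1, 1)
  exact h.eventually eventually_mul_eq_one_of_sq

theorem matrix_eventually_isUnit : ∀ᶠ M in 𝓝 (1 : Matrix ι ι F), IsUnit M := by
  have h : ∀ᶠ a in 𝓝 (1 : OpMatrix ι F), IsUnit a := Units.isOpen.mem_nhds isUnit_one
  exact ((toOpMatrix ι F).continuous.tendsto 1).eventually h

theorem matrix_exists_smooth_unitary (e : Matrix ι ι F) (hee : e * e = e) (hes : star e = e) :
    ∃ κ : Matrix ι ι F → Matrix ι ι F, ContDiffAt ℝ ∞ κ 1 ∧ κ 1 = 1 ∧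
      ∀ᶠ M in 𝓝 (1 : Matrix ι ι F), ∀ k p p' : Matrix ι ι F,
      star k * k = 1 → k * star k = 1 → p * p' = 1 → p * e = e * p * e → p' * e = e * p' * e →
      k * p = M → star (κ M) * κ M = 1 ∧ κ M * star (κ M) = 1 ∧
        κ M * κ M = k * (2 * e - 1) * star k * (2 * e - 1) ∧
        κ M * e * star (κ M) = k * e * star k := by
  obtain ⟨κ, h1, h2, h3⟩ := exists_smooth_unitary (A := OpMatrix ι F) e hee hes
  refine ⟨fun M => (toOpMatrix ι F).symm (κ (toOpMatrix ι F M)), ?_, h2, ?_⟩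
  · refine (toOpMatrix ι F).symm.contDiff.contDiffAt.comp _ ?_
    exact ContDiffAt.comp (g := κ) (f := toOpMatrix ι F) _ h1 (toOpMatrix ι F).contDiff.contDiffAt
  · exact ((toOpMatrix ι F).continuous.tendsto 1).eventually h3

variable [ConjugationAlgebra F]

theorem star_dotProduct_self (v : ι → F) :
    star v ⬝ᵥ v = algebraMap ℝ F (∑ i, ‖v i‖ ^ 2) := by
  simp [dotProduct, ConjugationAlgebra.star_mul_self]

/-- The columns of a unitary matrix have length one, which bounds every entry by `1`. -/
theorem isCompact_unitarySet : IsCompact (unitarySet ι F) := by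
  have : ProperSpace (Matrix ι ι F) := FiniteDimensional.proper_real _
  refine Metric.isCompact_of_isClosed_isBounded ?_ ?_
  · exact (isClosed_eq (by fun_prop) continuous_const).inter
      (isClosed_eq (by fun_prop) continuous_const)
  · refine (Metric.isBounded_closedBall (x := (0 : Matrix ι ι F)) (r := 1)).subset ?_
    rintro M ⟨hM, -⟩
    rw [mem_closedBall_zero_iff, Matrix.norm_le_iff zero_le_one]
    intro i j
    have h1 : (star M * M) j j = algebraMap ℝ F (∑ i, ‖M i j‖ ^ 2) :=
      star_dotProduct_self (fun i => M i j)
    rw [hM, Matrix.one_apply_eq, ← map_one (algebraMap ℝ F)] at h1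
    have h2 := (algebraMap ℝ F).injective h1
    have h3 : ‖M i j‖ ^ 2 ≤ ∑ i, ‖M i j‖ ^ 2 :=
      Finset.single_le_sum (f := fun i => ‖M i j‖ ^ 2) (fun i _ => sq_nonneg _) (Finset.mem_univ i)
    rw [← h2] at h3
    exact (sq_le_one_iff₀ (norm_nonneg _)).1 h3

theorem sum_norm_sq_pos {v : ι → F} (hv : v ≠ 0) : 0 < ∑ i, ‖v i‖ ^ 2 := by
  obtain ⟨i, hi⟩ := Function.ne_iff.1 hv
  exact Finset.sum_pos' (fun i _ => sq_nonneg _) ⟨i, Finset.mem_univ i, by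
    have := norm_pos_iff.2 hi
    positivity⟩

/-- The reflection in the orthogonal complement of a nonzero vector is unitary. -/
theorem exists_reflection (u : ι → F) (hu : u ≠ 0) : ∃ U : Matrix ι ι F,
    star U * U = 1 ∧ U * star U = 1 ∧
    ∀ w : ι → F, U *ᵥ w =
      w - MulOpposite.op ((algebraMap ℝ F (2 / ∑ i, ‖u i‖ ^ 2)) * (star u ⬝ᵥ w)) • u := by
  set d := ∑ i, ‖u i‖ ^ 2 with hd
  have hd0 : d ≠ 0 := (sum_norm_sq_pos hu).ne'
  have huu : star u ⬝ᵥ u = algebraMap ℝ F d := star_dotProduct_self u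
  set B := Matrix.vecMulVec u (star u) with hB
  have hBB : B * B = d • B := by
    rw [hB, Matrix.vecMulVec_mul_vecMulVec, huu]
    ext i j
    simp [Matrix.vecMulVec_apply, Algebra.smul_def, ← mul_assoc, Algebra.commutes]
    rw [mul_assoc, ← Algebra.commutes, mul_assoc]
  have hsB : star B = B := by
    ext i j
    simp [hB, Matrix.star_apply, Matrix.vecMulVec_apply]
  have hs : star (1 - (2 / d) • B) = 1 - (2 / d) • B := by
    rw [star_sub, star_one, star_smul, hsB, star_trivial]
  have hsq : (1 - (2 / d) • B) * (1 - (2 / d) • B) = 1 := by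
    rw [mul_sub, sub_mul, sub_mul, smul_mul_smul_comm, hBB, smul_smul, mul_one, mul_one, one_mul]
    have : 2 / d * (2 / d) * d = 2 / d + 2 / d := by field_simp; ring
    rw [this, add_smul]; abel
  refine ⟨1 - (2 / d) • B, by rw [hs, hsq], by rw [hs, hsq], fun w => ?_⟩
  rw [Matrix.sub_mulVec, Matrix.one_mulVec, Matrix.smul_mulVec]
  congr 1
  ext i
  simp only [hB, Matrix.mulVec, Matrix.vecMulVec_apply, dotProduct, Pi.smul_apply,
    MulOpposite.smul_eq_mul_unop, MulOpposite.unop_op, mul_assoc, ← Finset.mul_sum]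
  rw [Algebra.smul_def, ← mul_assoc, Algebra.commutes, mul_assoc]

/-- The reflection along `u = v - c e_i` with `‖c‖ = ‖v‖` exchanges `v` and `c e_i` once `star u ⬝ᵥ
v` is half the squared length of `u`; it fixes everything orthogonal to both `v` and `e_i`. -/
theorem exists_householder (v : ι → F) (i : ι) : ∃ U : Matrix ι ι F,
    star U * U = 1 ∧ U * star U = 1 ∧
    (∀ w : ι → F, w i = 0 → star v ⬝ᵥ w = 0 → U *ᵥ w = w) ∧ ∃ c : F, U *ᵥ v = Pi.single i c := by
  by_cases hv : v = 0
  · subst hv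
    exact ⟨1, by simp, by simp, by simp, 0, by simp⟩
  set m := ∑ i, ‖v i‖ ^ 2 with hm
  have hm0 : 0 < m := sum_norm_sq_pos hv
  set n := Real.sqrt m with hn
  have hn0 : 0 < n := Real.sqrt_pos.2 hm0
  have hnm : n ^ 2 = m := Real.sq_sqrt hm0.le
  -- The direction of `c` is opposite to that of `v i`. Then `star c * v i` is real and nonpositive,
  -- so `star u ⬝ᵥ v = m + n * ‖v i‖` is real and positive, and in particular `u` does not vanish.
  obtain ⟨c, hcn, hcv⟩ : ∃ c : F, ‖c‖ = n ∧ star c * v i = algebraMap ℝ F (-(n * ‖v i‖)) := by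
    by_cases h0 : v i = 0
    · exact ⟨algebraMap ℝ F n, by simp [abs_of_pos hn0], by simp [h0]⟩
    · have h1 : ‖v i‖ ≠ 0 := norm_ne_zero_iff.2 h0
      refine ⟨(-(n / ‖v i‖)) • v i, ?_, ?_⟩
      · rw [norm_smul, norm_neg, norm_div, norm_norm, Real.norm_of_nonneg hn0.le,
          div_mul_cancel₀ _ h1]
      · rw [star_smul, star_trivial, smul_mul_assoc, ConjugationAlgebra.star_mul_self,
          Algebra.smul_def, ← map_mul]
        congr 1
        field_simp
  have hvv : star v ⬝ᵥ v = algebraMap ℝ F m := star_dotProduct_self v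
  have hsi : star (Pi.single i c : ι → F) = Pi.single i (star c) := by
    ext j; by_cases h : j = i
    · subst h; simp
    · simp [h]
  set u : ι → F := v - Pi.single i c with hu
  have huw : ∀ w, star u ⬝ᵥ w = star v ⬝ᵥ w - star c * w i := by
    intro w
    rw [hu, star_sub, sub_dotProduct, hsi, single_dotProduct]
  have huv : star u ⬝ᵥ v = algebraMap ℝ F (m + n * ‖v i‖) := by
    rw [huw, hvv, hcv, ← map_sub]; congr 1; ring
  have hu0 : u ≠ 0 := by
    intro h
    rw [h, star_zero, zero_dotProduct, ← map_zero (algebraMap ℝ F)] at huv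
    have := (algebraMap ℝ F).injective huv
    have h1 := mul_nonneg hn0.le (norm_nonneg (v i))
    linarith
  have hvc : star (v i) * c = algebraMap ℝ F (-(n * ‖v i‖)) := by
    have := congrArg star hcv
    rw [star_mul, star_star] at this
    rw [this, ← algebraMap_star_comm, star_trivial]
  have hd : ∑ j, ‖u j‖ ^ 2 = 2 * (m + n * ‖v i‖) := by
    apply (algebraMap ℝ F).injective
    rw [← star_dotProduct_self, huw]
    have h1 : star v ⬝ᵥ u = algebraMap ℝ F m - star (v i) * c := by
      rw [hu, dotProduct_sub, hvv, dotProduct_single]; rfl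
    have h2 : star c * u i = algebraMap ℝ F (-(n * ‖v i‖)) - algebraMap ℝ F (n ^ 2) := by
      rw [hu, Pi.sub_apply, Pi.single_eq_same, mul_sub, hcv, ConjugationAlgebra.star_mul_self, hcn]
    rw [h1, h2, hvc, ← map_sub, ← map_sub, ← map_sub, hnm]
    congr 1; ring
  obtain ⟨U, h1, h2, hU⟩ := exists_reflection u hu0
  refine ⟨U, h1, h2, ?_, c, ?_⟩
  · intro w hw hvw
    rw [hU, huw, hw, hvw, mul_zero, sub_zero, mul_zero, MulOpposite.op_zero, zero_smul, sub_zero]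
  · rw [hU, huv, ← map_mul, hd]
    have h3 : 2 / (2 * (m + n * ‖v i‖)) * (m + n * ‖v i‖) = 1 := by
      have h1 := mul_nonneg hn0.le (norm_nonneg (v i))
      have : m + n * ‖v i‖ ≠ 0 := by positivity
      field_simp
    rw [h3, map_one, MulOpposite.op_one, one_smul, hu, sub_sub_cancel]

/-- Induction on the number of cleared columns, ordered by `r`: each step applies one Householder
reflection. Invertibility of `M` plays no role, so frame matrices padded with zeros are covered too.
-/
theorem exists_unitary_mul_triangular (r : ι → ℕ) (hr : Function.Injective r) (M : Matrix ι ι F)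
    (j : ℕ) : ∃ U : Matrix ι ι F, star U * U = 1 ∧ U * star U = 1 ∧
      ∀ a b, r b < j → r b < r a → (U * M) a b = 0 := by
  induction j with
  | zero => exact ⟨1, by simp, by simp, fun a b h => absurd h (Nat.not_lt_zero _)⟩
  | succ j ih =>
    obtain ⟨U, h1, h2, h3⟩ := ih
    by_cases hj : ∃ i, r i = j
    · obtain ⟨i, hi⟩ := hj
      -- Only the part of column `i` in rows of rank at least `j` is reflected. The cleared columns
      -- vanish in those rows, so they are orthogonal to `v` and to `e_i` and stay fixed; so does
      -- the upper part of column `i`.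
      set v : ι → F := fun a => if j ≤ r a then (U * M) a i else 0 with hv
      obtain ⟨H, hH1, hH2, hHw, c, hHv⟩ := exists_householder v i
      refine ⟨H * U, ?_, ?_, ?_⟩
      · rw [star_mul]
        calc star U * star H * (H * U) = star U * (star H * H) * U := by simp only [mul_assoc]
          _ = 1 := by rw [hH1, mul_one, h1]
      · rw [star_mul]
        calc H * U * (star U * star H) = H * (U * star U) * star H := by simp only [mul_assoc]
          _ = 1 := by rw [h2, mul_one, hH2]
      · intro a b hb hab
        have hcol : ∀ b, (H * U * M) a b = (H *ᵥ fun a => (U * M) a b) a := by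
          intro b; rw [mul_assoc]; rfl
        rw [hcol]
        rcases Nat.lt_succ_iff_lt_or_eq.1 hb with hb | hb
        · rw [hHw]
          · exact h3 a b hb hab
          · exact h3 i b hb (by omega)
          · refine Finset.sum_eq_zero fun x _ => ?_
            by_cases hx : j ≤ r x
            · have h0 : (U * M) x b = 0 := h3 x b hb (by omega)
              simp [h0]
            · simp [hv, hx]
        · have hbi : b = i := hr (by rw [hb, hi])
          subst hbi
          have hsplit : (fun a => (U * M) a b) =
              v + fun a => if j ≤ r a then 0 else (U * M) a b := by
            ext a
            by_cases h : j ≤ r a <;> simp [hv, h]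
          rw [hsplit, Matrix.mulVec_add, hHv, hHw]
          · have hne : a ≠ b := by rintro rfl; omega
            have hle : j ≤ r a := by omega
            simp [hne, hle]
          · simp [hi]
          · refine Finset.sum_eq_zero fun x _ => ?_
            by_cases hx : j ≤ r x <;> simp [hv, hx]
    · refine ⟨U, h1, h2, fun a b hb hab => h3 a b ?_ hab⟩
      rcases Nat.lt_succ_iff_lt_or_eq.1 hb with hb | hb
      · exact hb
      · exact absurd ⟨b, hb⟩ hj

end Transfer

/-! ### Block triangular parabolic subgroups and the general linear group. -/

section Blocks

attribute [local instance] Matrix.normedAddCommGroup Matrix.normedSpace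

/-- The orthogonal projection onto the span of the first `p` standard basis vectors. -/
def blockProj (p q : ℕ) (F : Type*) [Ring F] : Matrix (Fin p ⊕ Fin q) (Fin p ⊕ Fin q) F :=
  Matrix.fromBlocks 1 0 0 0

variable {p q : ℕ} {F : Type*}

section Ring

variable [Ring F]

theorem blockProj_mul_self : blockProj p q F * blockProj p q F = blockProj p q F := by
  simp [blockProj, Matrix.fromBlocks_multiply]

theorem star_blockProj [StarRing F] : star (blockProj p q F) = blockProj p q F := by
  simp [blockProj, Matrix.star_eq_conjTranspose, Matrix.fromBlocks_conjTranspose]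

theorem mul_blockProj_eq_iff (M : Matrix (Fin p ⊕ Fin q) (Fin p ⊕ Fin q) F) :
    M * blockProj p q F = blockProj p q F * M * blockProj p q F ↔ M.toBlocks₂₁ = 0 := by
  obtain ⟨A, B, C, D, rfl⟩ : ∃ A B C D, M = Matrix.fromBlocks A B C D :=
    ⟨_, _, _, _, (Matrix.fromBlocks_toBlocks M).symm⟩
  simp [blockProj, Matrix.fromBlocks_multiply, Matrix.fromBlocks_inj]

theorem toBlocks₂₁_eq_zero_iff (M : Matrix (Fin p ⊕ Fin q) (Fin p ⊕ Fin q) F) :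
    M.toBlocks₂₁ = 0 ↔ ∀ x ∈ stdFirst p q F, M *ᵥ x ∈ stdFirst p q F := by
  constructor
  · intro h x hx j
    simp only [Matrix.mulVec, dotProduct, Fintype.sum_sum_type]
    have h1 : ∀ i, M (Sum.inr j) (Sum.inl i) = 0 := fun i => congrFun (congrFun h j) i
    have h2 : ∀ i, x (Sum.inr i) = 0 := hx
    simp [h1, h2]
  · intro h
    ext j i
    have := h (Pi.single (Sum.inl i) 1) (by intro j; simp) j
    rw [Matrix.mulVec_single_one] at this
    exact this

/-- Expresses the stabilizer by identities with the projection, the form needed in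
`exists_smooth_unitary`. The condition on the inverse accounts for equality, rather than inclusion,
of the moved subspace. -/
theorem mem_blockParabolic_iff {G : Subgroup (GLin (Fin p ⊕ Fin q) F)} {g : G} :
    g ∈ blockParabolic G ↔ mat g * blockProj p q F = blockProj p q F * mat g * blockProj p q F ∧
      mat g⁻¹ * blockProj p q F = blockProj p q F * mat g⁻¹ * blockProj p q F := by
  rw [mul_blockProj_eq_iff, mul_blockProj_eq_iff, toBlocks₂₁_eq_zero_iff, toBlocks₂₁_eq_zero_iff]
  constructor
  · intro h
    exact ⟨fun x hx => (h x).2 hx, fun x hx => ((blockParabolic G).inv_mem h x).2 hx⟩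
  · rintro ⟨h1, h2⟩ x
    refine ⟨fun h => ?_, h1 x⟩
    have := h2 _ h
    rwa [Matrix.mulVec_mulVec, mat_inv_mul_mat, Matrix.one_mulVec] at this

theorem mem_blockLevi_of_commute {G : Subgroup (GLin (Fin p ⊕ Fin q) F)} {g : G}
    (hg : g ∈ blockParabolic G) (h1 : mat g * blockProj p q F = blockProj p q F * mat g) :
    g ∈ blockLevi G := by
  refine ⟨hg, ?_⟩
  have hlast : ∀ x : Fin p ⊕ Fin q → F, x ∈ stdLast p q F ↔ blockProj p q F *ᵥ x = 0 := by
    intro x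
    have : blockProj p q F *ᵥ x = Sum.elim (x ∘ Sum.inl) 0 := by
      rw [blockProj, Matrix.fromBlocks_mulVec]; simp
    rw [this]
    constructor
    · intro h
      ext i
      rcases i with i | i
      · exact h i
      · rfl
    · intro h i
      exact congrFun h (Sum.inl i)
  intro x
  rw [hlast, hlast, Matrix.mulVec_mulVec, ← h1, ← Matrix.mulVec_mulVec]
  constructor
  · intro h
    have := congrArg (fun y => mat g⁻¹ *ᵥ y) h
    simpa [Matrix.mulVec_mulVec, ← mul_assoc] using this
  · intro h
    rw [h, Matrix.mulVec_zero]

theorem mul_blockProj_of_commute {M : Matrix (Fin p ⊕ Fin q) (Fin p ⊕ Fin q) F}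
    (h : M * blockProj p q F = blockProj p q F * M) :
    M * blockProj p q F = blockProj p q F * M * blockProj p q F := by
  rw [← h, mul_assoc, blockProj_mul_self]

/-- If `star k` preserves the image of the projection, `k` preserves its orthogonal complement;
preserving both summands means commuting with the projection. -/
theorem blockProj_mul_of_star_mul_self [StarRing F] {k : Matrix (Fin p ⊕ Fin q) (Fin p ⊕ Fin q) F}
    (h1 : k * blockProj p q F = blockProj p q F * k * blockProj p q F)
    (h2 : star k * blockProj p q F = blockProj p q F * star k * blockProj p q F) :
    k * blockProj p q F = blockProj p q F * k := by
  have h3 := congrArg star h2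
  simp only [star_mul, star_star, star_blockProj] at h3
  rw [h1, h3, mul_assoc, mul_assoc, blockProj_mul_self]

end Ring

/-- The block reflection `diag(1, -1)`. -/
def blockRefl (p q : ℕ) (F : Type*) [Ring F] : GLin (Fin p ⊕ Fin q) F :=
  have h : (2 * blockProj p q F - 1) * (2 * blockProj p q F - 1) = 1 := by
    have : (2 * blockProj p q F - 1) * (2 * blockProj p q F - 1) =
      4 * (blockProj p q F * blockProj p q F) - 4 * blockProj p q F + 1 := by noncomm_ring
    rw [this, blockProj_mul_self, sub_self, zero_add]
  ⟨2 * blockProj p q F - 1, 2 * blockProj p q F - 1, h, h⟩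

theorem val_blockRefl [Ring F] :
    (blockRefl p q F : Matrix (Fin p ⊕ Fin q) (Fin p ⊕ Fin q) F) = 2 * blockProj p q F - 1 := rfl

theorem blockRefl_mul_self [Ring F] : blockRefl p q F * blockRefl p q F = 1 :=
  mul_inv_cancel (blockRefl p q F)

theorem star_blockRefl [Ring F] [StarRing F] :
    star (blockRefl p q F : Matrix (Fin p ⊕ Fin q) (Fin p ⊕ Fin q) F) = blockRefl p q F := by
  rw [val_blockRefl, two_mul, star_sub, star_add, star_one, star_blockProj]

variable [NormedDivisionRing F] [NormedAlgebra ℝ F] [StarRing F] [StarModule ℝ F]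
  [ContinuousStar F] [FiniteDimensional ℝ F] [ConjugationAlgebra F]

theorem exists_unitary_mul_parabolic (M M' : Matrix (Fin p ⊕ Fin q) (Fin p ⊕ Fin q) F)
    (hM : M * M' = 1) : ∃ k t t' : Matrix (Fin p ⊕ Fin q) (Fin p ⊕ Fin q) F,
      star k * k = 1 ∧ k * star k = 1 ∧ M = k * t ∧ t * t' = 1 ∧ t' * t = 1 ∧
      t * blockProj p q F = blockProj p q F * t * blockProj p q F ∧
      t' * blockProj p q F = blockProj p q F * t' * blockProj p q F := by
  obtain ⟨U, hU1, hU2, hU⟩ := exists_unitary_mul_triangular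
    (fun a : Fin p ⊕ Fin q => (finSumFinEquiv a : ℕ))
    (fun a b h => finSumFinEquiv.injective (Fin.ext h)) M (p + q)
  have ht : U * M * (M' * star U) = 1 := by
    calc U * M * (M' * star U) = U * (M * M') * star U := by simp only [mul_assoc]
      _ = 1 := by rw [hM, mul_one, hU2]
  have h21 : (U * M).toBlocks₂₁ = 0 := by
    ext a b
    refine hU (Sum.inr a) (Sum.inl b) ?_ ?_
    · exact (finSumFinEquiv (Sum.inl b)).2
    · have := b.2
      simp only [finSumFinEquiv_apply_left, finSumFinEquiv_apply_right, Fin.val_castAdd,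
        Fin.val_natAdd]
      omega
  refine ⟨star U, U * M, M' * star U, by rw [star_star, hU2], by rw [star_star, hU1], ?_, ht,
    mul_eq_one_comm.1 ht, (mul_blockProj_eq_iff _).2 h21, (mul_blockProj_eq_iff _).2 ?_⟩
  · rw [← mul_assoc, hU1, one_mul]
  -- The lower blocks of `t * t' = 1` say that the lower right block of `t` is invertible and
  -- annihilates the lower left block of `t'`.
  · have h1 := ht
    rw [← Matrix.fromBlocks_toBlocks (U * M), ← Matrix.fromBlocks_toBlocks (M' * star U), h21,
      Matrix.fromBlocks_multiply, ← Matrix.fromBlocks_one, Matrix.fromBlocks_inj] at h1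
    obtain ⟨-, -, h3, h4⟩ := h1
    rw [Matrix.zero_mul, zero_add] at h3 h4
    have h5 := mul_eq_one_comm.1 h4
    calc (M' * star U).toBlocks₂₁ = 1 * (M' * star U).toBlocks₂₁ := (Matrix.one_mul _).symm
      _ = 0 := by rw [← h5, Matrix.mul_assoc, h3, Matrix.mul_zero]

theorem commute_blockProj_of_mem {G : Subgroup (GLin (Fin p ⊕ Fin q) F)} {k : G}
    (hk : k ∈ maxCompact G) (hkP : k ∈ blockParabolic G) :
    mat k * blockProj p q F = blockProj p q F * mat k := by
  obtain ⟨h1, h2⟩ := mem_blockParabolic_iff.1 hkP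
  rw [mat_inv_of_mem_maxCompact hk] at h2
  exact blockProj_mul_of_star_mul_self h1 h2

theorem blockRefl_commute_iff (M : Matrix (Fin p ⊕ Fin q) (Fin p ⊕ Fin q) F) :
    (blockRefl p q F).val * M = M * (blockRefl p q F).val ↔
      M * blockProj p q F = blockProj p q F * M := by
  rw [val_blockRefl]
  have h1 : (2 * blockProj p q F - 1) * M = (2 : ℝ) • (blockProj p q F * M) - M := by
    rw [two_smul]; noncomm_ring
  have h2 : M * (2 * blockProj p q F - 1) = (2 : ℝ) • (M * blockProj p q F) - M := by
    rw [two_smul]; noncomm_ring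
  rw [h1, h2, sub_left_inj]
  exact ⟨fun h => (smul_right_injective _ (two_ne_zero (α := ℝ)) h).symm, fun h => by rw [h]⟩

theorem isSymmetricSubgroup_blockParabolic (G : Subgroup (GLin (Fin p ⊕ Fin q) F))
    (hnorm : ∀ g ∈ G, blockRefl p q F * g * blockRefl p q F ∈ G) :
    IsSymmetricSubgroup ((blockParabolic G).subgroupOf (maxCompact G)) := by
  refine isSymmetricSubgroup_of_conj G _ (blockRefl p q F) blockRefl_mul_self star_blockRefl hnorm
    (fun k hk hkP => (blockRefl_commute_iff _).2 (commute_blockProj_of_mem hk hkP))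
    -- Every unitary element commuting with the reflection already lies in the parabolic subgroup,
    -- so the trivial sign suffices.
    (fun _ => 1) continuous_const rfl
    (fun _ _ _ => Or.inl rfl) ?_
  intro k hk h _
  have h1 := (blockRefl_commute_iff _).1 h
  have h2 := congrArg star h1
  simp only [star_mul, star_blockProj] at h2
  rw [mem_blockParabolic_iff, mat_inv_of_mem_maxCompact hk]
  exact ⟨mul_blockProj_of_commute h1, mul_blockProj_of_commute h2.symm⟩

/-- The square root furnished by `matrix_exists_smooth_unitary` is unitary; what has to be seen is
that it lies in `G`. Its square does, because the reflection normalizes `G`, and `hsq` passes this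
to the root. -/
theorem exists_isLocalSection_blockParabolic (G : Subgroup (GLin (Fin p ⊕ Fin q) F))
    (hnorm : ∀ g ∈ G, blockRefl p q F * g * blockRefl p q F ∈ G)
    (hsq : ∀ᶠ M in 𝓝 (1 : Matrix (Fin p ⊕ Fin q) (Fin p ⊕ Fin q) F),
      ∀ g : GLin (Fin p ⊕ Fin q) F, (g : Matrix _ _ F) = M → g * g ∈ G → g ∈ G)
    (hT : ∀ g : G, ∃ k ∈ maxCompact G, k⁻¹ * g ∈ blockParabolic G) :
    ∃ κ, IsLocalSection G (blockParabolic G) κ := by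
  obtain ⟨κ, hκs, hκ1, hκ⟩ := matrix_exists_smooth_unitary (blockProj p q F) blockProj_mul_self
    star_blockProj
  refine ⟨κ, hκs, ?_⟩
  have hκt : Tendsto κ (𝓝 1) (𝓝 1) := by
    have := hκs.continuousAt.tendsto
    rwa [hκ1] at this
  filter_upwards [hκ, hκt.eventually hsq] with M hM hMsq g hg
  obtain ⟨k, hk, hp⟩ := hT g
  obtain ⟨hp1, hp2⟩ := mem_blockParabolic_iff.1 hp
  have hk1 := mem_maxCompact.1 hk
  have hk2 := mat_mul_star_of_mem_maxCompact hk
  obtain ⟨hc1, hc2, hcc, hce⟩ := hM (mat k) (mat (k⁻¹ * g)) (mat (k⁻¹ * g)⁻¹) hk1 hk2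
    (mat_mul_mat_inv _) hp1 hp2 (by rw [← mat_mul, mul_inv_cancel_left, hg])
  let c : GLin (Fin p ⊕ Fin q) F := ⟨κ M, star (κ M), hc2, hc1⟩
  have hcG : c ∈ G := by
    refine hMsq c rfl ?_
    have : c * c = (k : GLin (Fin p ⊕ Fin q) F) *
        (blockRefl p q F * (k⁻¹ : G) * blockRefl p q F) := by
      apply Units.ext
      change κ M * κ M = mat k * ((2 * blockProj p q F - 1) * mat k⁻¹ * (2 * blockProj p q F - 1))
      rw [hcc, mat_inv_of_mem_maxCompact hk]
      simp only [mul_assoc]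
    rw [this]
    exact mul_mem k.2 (hnorm _ (k⁻¹ : G).2)
  refine ⟨⟨c, hcG⟩, mem_maxCompact.2 hc1, rfl, ?_⟩
  -- Both `c` and `k` conjugate the projection to the same one, so `c⁻¹ * k` commutes with it;
  -- multiplying by `k⁻¹ * g` then gives `c⁻¹ * g` in the parabolic subgroup.
  have hck : (⟨c, hcG⟩ : G)⁻¹ * k ∈ blockParabolic G := by
    have h1 : star (κ M) * mat k * blockProj p q F = blockProj p q F * (star (κ M) * mat k) := by
      calc star (κ M) * mat k * blockProj p q F
          = star (κ M) * (mat k * blockProj p q F * star (mat k)) * mat k := by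
            simp only [mul_assoc, hk1, mul_one]
        _ = (star (κ M) * κ M) * blockProj p q F * (star (κ M) * mat k) := by
            rw [← hce]; simp only [mul_assoc]
        _ = _ := by rw [hc1, one_mul]
    have h2 := congrArg star h1
    simp only [star_mul, star_blockProj, star_star] at h2
    have e1 : mat ((⟨c, hcG⟩ : G)⁻¹ * k) = star (κ M) * mat k := rfl
    have e2 : mat ((⟨c, hcG⟩ : G)⁻¹ * k)⁻¹ = star (mat k) * κ M := by
      rw [mul_inv_rev, inv_inv, mat_mul, mat_inv_of_mem_maxCompact hk]; rfl
    rw [mem_blockParabolic_iff, e1, e2]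
    exact ⟨mul_blockProj_of_commute h1, mul_blockProj_of_commute h2.symm⟩
  have := mul_mem hck hp
  rwa [mul_assoc, mul_inv_cancel_left] at this

/-- A closed matrix group which is normalized by the block reflection and contains the square roots
near `1` of its elements is a compact symmetric realization, as soon as its maximal compact
subgroup is transitive. -/
theorem isBlockRealization_of_transitive (G : Subgroup (GLin (Fin p ⊕ Fin q) F))
    (hcl : IsClosed (G : Set (GLin (Fin p ⊕ Fin q) F)))
    (hnorm : ∀ g ∈ G, blockRefl p q F * g * blockRefl p q F ∈ G)
    (hsq : ∀ᶠ M in 𝓝 (1 : Matrix (Fin p ⊕ Fin q) (Fin p ⊕ Fin q) F),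
      ∀ g : GLin (Fin p ⊕ Fin q) F, (g : Matrix _ _ F) = M → g * g ∈ G → g ∈ G)
    (hT : ∀ g : G, ∃ k ∈ maxCompact G, k⁻¹ * g ∈ blockParabolic G) : IsBlockRealization G := by
  obtain ⟨κ, hκ⟩ := exists_isLocalSection_blockParabolic G hnorm hsq hT
  have hU : IsCompact (unitarySet (Fin p ⊕ Fin q) F) := isCompact_unitarySet
  refine ⟨isCompact_maxCompact hU hcl, isPretransitive_maxCompact G _ hT, ?_,
    isSymmetricSubgroup_blockParabolic G hnorm, exists_homeomorph_quotient G _ hT hκ⟩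
  ext k
  constructor
  · rintro ⟨h1, h2⟩
    exact ⟨mem_blockLevi_of_commute h1 (commute_blockProj_of_mem h2 h1), h2⟩
  · rintro ⟨h1, h2⟩
    exact ⟨h1.1, h2⟩

theorem isBlockRealization_top (p q : ℕ) :
    IsBlockRealization (⊤ : Subgroup (GLin (Fin p ⊕ Fin q) F)) := by
  refine isBlockRealization_of_transitive _ isClosed_univ (fun _ _ => trivial)
    (Eventually.of_forall fun _ _ _ _ => trivial) ?_
  intro g
  obtain ⟨k, t, t', hk1, hk2, hg, ht1, ht2, hp1, hp2⟩ :=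
    exists_unitary_mul_parabolic (mat g) (mat g⁻¹) (mat_mul_mat_inv g)
  let c : GLin (Fin p ⊕ Fin q) F := ⟨k, star k, hk2, hk1⟩
  have h1 : mat ((⟨c, trivial⟩ : (⊤ : Subgroup (GLin (Fin p ⊕ Fin q) F)))⁻¹ * g) = t := by
    change star k * mat g = t
    rw [hg, ← mul_assoc, hk1, one_mul]
  have h2 : mat ((⟨c, trivial⟩ : (⊤ : Subgroup (GLin (Fin p ⊕ Fin q) F)))⁻¹ * g)⁻¹ = t' := by
    have := mat_inv_mul_mat ((⟨c, trivial⟩ : (⊤ : Subgroup (GLin (Fin p ⊕ Fin q) F)))⁻¹ * g)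
    rw [h1] at this
    exact left_inv_eq_right_inv this ht1
  refine ⟨⟨c, trivial⟩, mem_maxCompact.2 hk1, ?_⟩
  rw [mem_blockParabolic_iff, h1, h2]
  exact ⟨hp1, hp2⟩

end Blocks

/-! ### Isometry groups of sesquilinear and bilinear forms. -/

/-- If the image of the projection `e` is Lagrangian for the form `S`, and is mapped by the unitary
element `k` to another Lagrangian, then it is mapped to it by a unitary element which preserves `S`.
Here `c` is the identity for a sesquilinear form and the complex conjugation for a bilinear form. -/
theorem exists_unitary_isometry {A : Type*} [Ring A] [StarRing A] [IsDedekindFiniteMonoid A]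
    (c : A →+* A) (hcc : ∀ x, c (c x) = x) (hcs : ∀ x, c (star x) = star (c x)) {e S g k t t' : A}
    (hee : e * e = e) (hes : star e = e) (hce : c e = e) (hcS : c S = S) (hS : star S * S = 1)
    (hSS : star S = S ∨ star S = -S) (hSe : S * e = (1 - e) * S)
    (hg : c (star g) * S * g = S) (hk : star k * k = 1) (hkt : g = k * t) (htt : t * t' = 1)
    (ht' : t' * e = e * t' * e) :
    ∃ u : A, star u * u = 1 ∧ u * star u = 1 ∧ c (star u) * S * u = S ∧ u * e = k * e := by
  have heSe : e * S * e = 0 := by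
    rw [mul_assoc, hSe, ← mul_assoc, mul_sub, mul_one, hee, sub_self, zero_mul]
  -- The image of `k * e` lies in that of the isometry `g` restricted to the standard Lagrangian, so
  -- it is isotropic; this is `key0`, and its adjoint is `key1`.
  have hke : k * e = g * e * t' * e := by
    calc k * e = k * (t * t') * e := by rw [htt, mul_one]
      _ = g * (t' * e) := by rw [hkt]; simp only [mul_assoc]
      _ = _ := by rw [ht']; simp only [mul_assoc]
  have hcke : e * c (star k) = e * c (star t') * e * c (star g) := by
    have h := congrArg (fun x => c (star x)) hke
    simpa only [star_mul, map_mul, hes, hce, mul_assoc] using h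
  have hck : c (star k) * c k = 1 := by rw [← map_mul, hk, map_one]
  have key0 : e * c (star k) * S * k * e = 0 := by
    calc e * c (star k) * S * k * e = e * c (star k) * S * (k * e) := by rw [mul_assoc _ k]
      _ = e * c (star t') * e * (c (star g) * S * g) * e * t' * e := by
          rw [hcke, hke]; simp only [mul_assoc]
      _ = e * c (star t') * (e * S * e) * t' * e := by rw [hg]; simp only [mul_assoc]
      _ = 0 := by rw [heSe, mul_zero, zero_mul, zero_mul]
  have hcT : c (star S) = star S := by rw [hcs, hcS]
  have key1 : e * star k * star S * c k * e = 0 := by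
    have h := congrArg star key0
    have h2 : star (c (star k)) = c k := by rw [← hcs, star_star]
    simpa only [star_mul, hes, h2, star_zero, mul_assoc] using h
  have key2 : e * star k * S * c k * e = 0 := by
    rcases hSS with h | h
    · rwa [h] at key1
    · rw [h] at key1
      simpa only [mul_neg, neg_mul, neg_eq_zero] using key1
  have hS' : S * star S = 1 := mul_eq_one_comm.1 hS
  have heS : S * e + e * S = S := by rw [hSe, sub_mul, one_mul, sub_add_cancel]
  have hTeS : star S * e * S = 1 - e := by
    have h : star S * (S * e + e * S) = star S * S := by rw [heS]
    rw [mul_add, ← mul_assoc, hS, one_mul, ← mul_assoc] at h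
    exact eq_sub_of_add_eq' h
  set T := star S with hT
  have hTSS : T * e * star k * S * S * k * e = S * e := by
    have h : T * e * (star k * (S * S) * k) * e = S * e := by
      rcases hSS with h | h
      · have h1 : S * S = 1 := by rw [← hS, h]
        rw [h1, mul_one, hk, mul_one, mul_assoc, hee, h]
      · have h1 : S * S = -1 := by rw [← hS, h, neg_mul, neg_neg]
        rw [h1, mul_neg, neg_mul, mul_one, hk, mul_neg, mul_one, neg_mul, mul_assoc, hee, h,
          neg_mul, neg_neg]
    rw [← h]; simp only [mul_assoc]
  -- The element agrees with `k` on the image of `e` and with `star S * c k * S` on the complement,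
  -- which `S` maps to the image of `e`. The two pieces are isometric, and they are orthogonal to
  -- each other by `key0` and `key1`.
  have hu : star (k * e + T * c k * e * S) * (k * e + T * c k * e * S) = 1 := by
    have h1 : star (k * e + T * c k * e * S) = e * star k + T * e * c (star k) * S := by
      simp only [star_add, star_mul, hes, hT, star_star, hcs, mul_assoc]
    rw [h1]
    calc (e * star k + T * e * c (star k) * S) * (k * e + T * c k * e * S)
        = e * (star k * k) * e + (e * star k * T * c k * e) * S +
            T * (e * c (star k) * S * k * e) + T * e * (c (star k) * (S * T) * c k) * e * S := by
          simp only [mul_add, add_mul, mul_assoc]; abel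
      _ = e * e + T * (e * e) * S := by
          rw [hk, key1, key0, hS', mul_one, mul_one, hck, mul_one, zero_mul, mul_zero, add_zero,
            add_zero, ← mul_assoc T e e]
      _ = 1 := by rw [hee, hTeS, add_sub_cancel]
  refine ⟨k * e + T * c k * e * S, hu, mul_eq_one_comm.1 hu, ?_, ?_⟩
  · have h1 : c (star (k * e + T * c k * e * S)) = e * c (star k) + T * e * star k * S := by
      simp only [star_add, star_mul, hes, hT, star_star, hcs, mul_assoc, map_add, map_mul, hcc, hce,
        hcS]
    rw [h1]
    calc (e * c (star k) + T * e * star k * S) * S * (k * e + T * c k * e * S)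
        = e * c (star k) * S * k * e + e * (c (star k) * (S * T) * c k) * e * S +
            T * e * star k * S * S * k * e + T * (e * star k * S * (S * T) * c k * e) * S := by
          simp only [mul_add, add_mul, mul_assoc]; abel
      _ = S := by
          rw [key0, hS', mul_one, hck, mul_one, mul_one, key2, hTSS, hee, mul_zero, zero_mul,
            add_zero, zero_add, add_comm, heS]
  · rw [add_mul, mul_assoc k, hee, mul_assoc _ S e, hSe, ← mul_assoc, mul_assoc _ e (1 - e), mul_sub,
      mul_one, hee, sub_self, mul_zero, zero_mul, add_zero]

section FormGroups

attribute [local instance] Matrix.normedAddCommGroup Matrix.normedSpace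

variable {n : ℕ} {F : Type*} [NormedDivisionRing F] [NormedAlgebra ℝ F] [StarRing F]
  [StarModule ℝ F] [ContinuousStar F] [FiniteDimensional ℝ F] [ConjugationAlgebra F]

/-- The isometry group of a split form, intersected with an open and closed subgroup `D` which
contains its block triangular elements, is a compact symmetric realization. -/
theorem isBlockRealization_form (G D : Subgroup (GLin (Fin n ⊕ Fin n) F))
    (c : Matrix (Fin n ⊕ Fin n) (Fin n ⊕ Fin n) F →+* Matrix (Fin n ⊕ Fin n) (Fin n ⊕ Fin n) F)
    (hc : Continuous c) (hcc : ∀ x, c (c x) = x) (hcs : ∀ x, c (star x) = star (c x))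
    (hce : c (blockProj n n F) = blockProj n n F) (S : Matrix (Fin n ⊕ Fin n) (Fin n ⊕ Fin n) F)
    (hcS : c S = S) (hS : star S * S = 1) (hSS : star S = S ∨ star S = -S)
    (hSe : S * blockProj n n F = (1 - blockProj n n F) * S)
    (hG : ∀ g : GLin (Fin n ⊕ Fin n) F, g ∈ G ↔
      c (star (g : Matrix _ _ F)) * S * (g : Matrix _ _ F) = S ∧ g ∈ D)
    (hDcl : IsClosed (D : Set (GLin (Fin n ⊕ Fin n) F)))
    (hDnorm : ∀ g ∈ D, blockRefl n n F * g * blockRefl n n F ∈ D)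
    (hDsq : ∀ᶠ M in 𝓝 (1 : Matrix (Fin n ⊕ Fin n) (Fin n ⊕ Fin n) F),
      ∀ g : GLin (Fin n ⊕ Fin n) F, (g : Matrix _ _ F) = M → g * g ∈ D → g ∈ D)
    (hDP : ∀ g : GLin (Fin n ⊕ Fin n) F,
      c (star (g : Matrix _ _ F)) * S * (g : Matrix _ _ F) = S →
      g.val * blockProj n n F = blockProj n n F * g.val * blockProj n n F → g ∈ D) :
    IsBlockRealization G := by
  have hS' : S * star S = 1 := mul_eq_one_comm.1 hS
  have hcont : Continuous fun M : Matrix (Fin n ⊕ Fin n) (Fin n ⊕ Fin n) F => c (star M) * S * M :=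
    ((hc.comp continuous_star).mul continuous_const).mul continuous_id
  refine isBlockRealization_of_transitive G ?_ ?_ ?_ ?_
  · have h : (G : Set (GLin (Fin n ⊕ Fin n) F)) =
        {g : GLin (Fin n ⊕ Fin n) F | c (star (g : Matrix _ _ F)) * S * (g : Matrix _ _ F) = S} ∩ D :=
      Set.ext fun g => hG g
    rw [h]
    exact (isClosed_eq (hcont.comp Units.continuous_val) continuous_const).inter hDcl
  · intro g hg
    obtain ⟨hg1, hg2⟩ := (hG g).1 hg
    refine (hG _).2 ⟨?_, hDnorm g hg2⟩
    have h1 : c (star (blockRefl n n F).val) = (blockRefl n n F).val := by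
      rw [star_blockRefl, val_blockRefl, map_sub, map_mul, hce, map_one]
      congr 2
      exact map_ofNat c 2
    -- `S` exchanges the two eigenspaces of the reflection, so it anticommutes with it. The
    -- reflection turns `S` into `-S`, and conjugation uses it twice.
    have h2 : S * (blockRefl n n F).val = -((blockRefl n n F).val * S) := by
      rw [val_blockRefl, mul_sub, two_mul, mul_add, hSe]
      noncomm_ring
    have h3 : (blockRefl n n F).val * (blockRefl n n F).val = 1 := by
      rw [← Units.val_mul, blockRefl_mul_self, Units.val_one]
    rw [Units.val_mul, Units.val_mul, star_mul, star_mul, map_mul, map_mul, h1]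
    set s := (blockRefl n n F).val
    calc s * (c (star g.val) * s) * S * (s * g.val * s)
        = s * c (star g.val) * s * (S * s) * g.val * s := by simp only [mul_assoc]
      _ = -(s * c (star g.val) * (s * s) * S * g.val * s) := by
          rw [h2]; simp only [mul_assoc, mul_neg, neg_mul]
      _ = -(s * (c (star g.val) * S * g.val) * s) := by
          rw [h3, mul_one]; simp only [mul_assoc]
      _ = S := by rw [hg1, mul_assoc, h2, mul_neg, neg_neg, ← mul_assoc, h3, one_mul]
  -- Preserving `S` means that `star S * c (star g) * S` is inverse to `g`. If `g * g` preserves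
  -- `S`, the squares of these two elements are inverse to each other, hence near `1` so are the
  -- elements.
  · have ht : Tendsto (fun M : Matrix (Fin n ⊕ Fin n) (Fin n ⊕ Fin n) F =>
        (star S * c (star M) * S, M)) (𝓝 1) (𝓝 (1, 1)) := by
      have h : Continuous fun M : Matrix (Fin n ⊕ Fin n) (Fin n ⊕ Fin n) F =>
          (star S * c (star M) * S, M) :=
        ((continuous_const.mul (hc.comp continuous_star)).mul continuous_const).prodMk continuous_id
      have h1 := h.tendsto 1
      simp only [star_one, map_one, mul_one, hS] at h1
      exact h1
    have h := ht.eventually (matrix_eventually_mul_eq_one_of_sq (ι := Fin n ⊕ Fin n) (F := F))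
    filter_upwards [h, hDsq] with M hM hMD g hg hgg
    obtain ⟨hg1, hg2⟩ := (hG _).1 hgg
    refine (hG _).2 ⟨?_, hMD g hg hg2⟩
    rw [Units.val_mul, star_mul, map_mul] at hg1
    have h2 := (hM (by
      rw [← hg]
      calc star S * c (star g.val) * S * (star S * c (star g.val) * S) * (g.val * g.val)
          = star S * (c (star g.val) * (S * star S) * c (star g.val) * S * (g.val * g.val)) := by
            simp only [mul_assoc]
        _ = 1 := by rw [hS', mul_one, hg1, hS])).1
    rw [← hg] at h2
    calc c (star g.val) * S * g.val = S * star S * (c (star g.val) * S * g.val) := by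
          rw [hS', one_mul]
      _ = S * (star S * c (star g.val) * S * g.val) := by simp only [mul_assoc]
      _ = S := by rw [h2, mul_one]
  · intro g
    obtain ⟨hg1, hg2⟩ := (hG _).1 g.2
    obtain ⟨k, t, t', hk1, hk2, hkt, ht1, ht2, hp1, hp2⟩ :=
      exists_unitary_mul_parabolic (mat g) (mat g⁻¹) (mat_mul_mat_inv g)
    obtain ⟨u, hu1, hu2, hu3, hu4⟩ := exists_unitary_isometry c hcc hcs blockProj_mul_self
      star_blockProj hce hcS hS hSS hSe hg1 hk1 hkt ht1 hp2
    let U : GLin (Fin n ⊕ Fin n) F := ⟨u, star u, hu2, hu1⟩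
    have hku : star k * u * blockProj n n F = blockProj n n F := by
      rw [mul_assoc, hu4, ← mul_assoc, hk1, one_mul]
    have huk : star u * k * blockProj n n F = blockProj n n F := by
      rw [mul_assoc, ← hu4, ← mul_assoc, hu1, one_mul]
    have h1 : star u * mat g * blockProj n n F =
        blockProj n n F * (star u * mat g) * blockProj n n F := by
      have h : star u * mat g * blockProj n n F = blockProj n n F * t * blockProj n n F := by
        calc star u * mat g * blockProj n n F = star u * k * (t * blockProj n n F) := by
              rw [hkt]; simp only [mul_assoc]
          _ = (star u * k * blockProj n n F) * t * blockProj n n F := by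
              rw [hp1]; simp only [mul_assoc]
          _ = _ := by rw [huk]
      rw [mul_assoc (blockProj n n F), h, ← mul_assoc, ← mul_assoc, blockProj_mul_self]
    have hginv : mat g⁻¹ = t' * star k := by
      have h : t' * star k * mat g = 1 := by
        rw [hkt]
        calc t' * star k * (k * t) = t' * (star k * k) * t := by simp only [mul_assoc]
          _ = 1 := by rw [hk1, mul_one, ht2]
      exact (left_inv_eq_right_inv h (mat_mul_mat_inv g)).symm
    have h2 : mat g⁻¹ * u * blockProj n n F =
        blockProj n n F * (mat g⁻¹ * u) * blockProj n n F := by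
      have h : mat g⁻¹ * u * blockProj n n F = t' * blockProj n n F := by
        rw [hginv]
        calc t' * star k * u * blockProj n n F = t' * (star k * u * blockProj n n F) := by
              simp only [mul_assoc]
          _ = _ := by rw [hku]
      rw [mul_assoc (blockProj n n F), h, hp2, ← mul_assoc, ← mul_assoc, blockProj_mul_self]
    -- `U⁻¹ * g` is an isometry and block triangular, hence in `D` by `hDP`; since `g` is in `D`, so
    -- is `U`.
    have hUD : U ∈ D := by
      have hform : c (star (U⁻¹ * g : GLin (Fin n ⊕ Fin n) F).val) * S *
          (U⁻¹ * g : GLin (Fin n ⊕ Fin n) F).val = S := by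
        have e1 : (U⁻¹ * g : GLin (Fin n ⊕ Fin n) F).val = star u * mat g := rfl
        have hcu : c u * c (star u) = 1 := by rw [← map_mul, hu2, map_one]
        rw [e1, star_mul, star_star, map_mul]
        calc c (star (mat g)) * c u * S * (star u * mat g)
            = c (star (mat g)) * c u * (c (star u) * S * u) * (star u * mat g) := by rw [hu3]
          _ = c (star (mat g)) * (c u * c (star u)) * S * (u * star u) * mat g := by
              simp only [mul_assoc]
          _ = S := by rw [hcu, hu2, mul_one, mul_one]; exact hg1
      have h := D.mul_mem hg2 (D.inv_mem (hDP _ hform h1))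
      simpa using h
    have hUG : U ∈ G := (hG U).2 ⟨hu3, hUD⟩
    refine ⟨⟨U, hUG⟩, mem_maxCompact.2 hu1, ?_⟩
    rw [mem_blockParabolic_iff]
    refine ⟨h1, ?_⟩
    rw [mul_inv_rev, inv_inv]
    exact h2

end FormGroups

/-! ### The standard forms and the resulting block realizations. -/

section Forms

variable {n : ℕ} {F : Type*} [Ring F]

theorem one_sub_blockProj :
    1 - blockProj n n F = Matrix.fromBlocks 0 0 0 1 := by
  rw [sub_eq_iff_eq_add, blockProj, Matrix.fromBlocks_add, ← Matrix.fromBlocks_one]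
  simp

theorem formJ_mul_blockProj :
    formJ n F * blockProj n n F = (1 - blockProj n n F) * formJ n F := by
  rw [one_sub_blockProj]
  simp [formJ, blockProj, Matrix.fromBlocks_multiply]

theorem formD_mul_blockProj :
    formD n F * blockProj n n F = (1 - blockProj n n F) * formD n F := by
  rw [one_sub_blockProj]
  simp [formD, blockProj, Matrix.fromBlocks_multiply]

variable [StarRing F]

theorem star_formJ : star (formJ n F) = -formJ n F := by
  simp [formJ, Matrix.star_eq_conjTranspose, Matrix.fromBlocks_conjTranspose, Matrix.fromBlocks_neg]

theorem star_formD : star (formD n F) = formD n F := by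
  simp [formD, Matrix.star_eq_conjTranspose, Matrix.fromBlocks_conjTranspose]

theorem star_formJ_mul_self : star (formJ n F) * formJ n F = 1 := by
  rw [star_formJ]
  simp [formJ, Matrix.fromBlocks_multiply, Matrix.fromBlocks_neg]

theorem star_formD_mul_self : star (formD n F) * formD n F = 1 := by
  rw [star_formD]
  simp [formD, Matrix.fromBlocks_multiply]

end Forms

section Sesquilinear

variable {n : ℕ} {F : Type*} [NormedDivisionRing F] [NormedAlgebra ℝ F] [StarRing F]
  [StarModule ℝ F] [ContinuousStar F] [FiniteDimensional ℝ F] [ConjugationAlgebra F]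

theorem isBlockRealization_sesqGroup (S : Matrix (Fin n ⊕ Fin n) (Fin n ⊕ Fin n) F)
    (hS : star S * S = 1) (hSS : star S = S ∨ star S = -S)
    (hSe : S * blockProj n n F = (1 - blockProj n n F) * S) : IsBlockRealization (sesqGroup S) :=
  isBlockRealization_form (sesqGroup S) ⊤ (RingHom.id _) continuous_id (fun _ => rfl)
    (fun _ => rfl) rfl S rfl hS hSS hSe (fun _ => (and_iff_left trivial).symm) isClosed_univ
    (fun _ _ => trivial) (Eventually.of_forall fun _ _ _ _ => trivial) (fun _ _ _ => trivial)

theorem isBlockRealization_sesqGroup_formD (n : ℕ) :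
    IsBlockRealization (sesqGroup (formD n F)) :=
  isBlockRealization_sesqGroup _ star_formD_mul_self (Or.inl star_formD) formD_mul_blockProj

theorem isBlockRealization_sesqGroup_formJ (n : ℕ) :
    IsBlockRealization (sesqGroup (formJ n F)) :=
  isBlockRealization_sesqGroup _ star_formJ_mul_self (Or.inr star_formJ) formJ_mul_blockProj

end Sesquilinear

section Bilinear

variable {ι : Type*} [Fintype ι] [DecidableEq ι] {n : ℕ} {F : Type*} [NormedField F]
  [NormedAlgebra ℝ F] [StarRing F]
  [StarModule ℝ F] [ContinuousStar F] [FiniteDimensional ℝ F] [ConjugationAlgebra F]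

/-- The entrywise conjugation of matrices. -/
noncomputable def conjMatrix (ι F : Type*) [Fintype ι] [DecidableEq ι] [CommRing F] [StarRing F] :
    Matrix ι ι F →+* Matrix ι ι F := (starRingEnd F).mapMatrix

theorem conjMatrix_star (M : Matrix ι ι F) : conjMatrix ι F (star M) = Mᵀ := by
  ext i j
  simp [conjMatrix, Matrix.star_apply, starRingEnd_apply]

theorem continuous_conjMatrix : Continuous (conjMatrix ι F) :=
  Continuous.matrix_map continuous_id continuous_star

theorem conjMatrix_conjMatrix (M : Matrix ι ι F) : conjMatrix ι F (conjMatrix ι F M) = M := by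
  ext i j
  simp [conjMatrix]

theorem conjMatrix_star_comm (M : Matrix ι ι F) :
    conjMatrix ι F (star M) = star (conjMatrix ι F M) := by
  ext i j
  simp [conjMatrix, Matrix.star_apply, starRingEnd_apply]

theorem conjMatrix_blockProj :
    conjMatrix (Fin n ⊕ Fin n) F (blockProj n n F) = blockProj n n F := by
  simp [conjMatrix, blockProj, Matrix.fromBlocks_map]

theorem conjMatrix_formD :
    conjMatrix (Fin n ⊕ Fin n) F (formD n F) = formD n F := by
  simp [conjMatrix, formD, Matrix.fromBlocks_map]

theorem conjMatrix_formJ :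
    conjMatrix (Fin n ⊕ Fin n) F (formJ n F) = formJ n F := by
  have h : (-1 : Matrix (Fin n) (Fin n) F).map (starRingEnd F) = -1 := by
    rw [Matrix.map_neg _ (map_neg _), Matrix.map_one _ (map_zero _) (map_one _)]
  simp [conjMatrix, formJ, Matrix.fromBlocks_map, h]

/-- With `c` the entrywise conjugation, `c (star M)` is the transpose, so bilinear forms are an
instance of `isBlockRealization_form`. -/
theorem isBlockRealization_bilinGroup (S : Matrix (Fin n ⊕ Fin n) (Fin n ⊕ Fin n) F)
    (hcS : conjMatrix (Fin n ⊕ Fin n) F S = S) (hS : star S * S = 1)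
    (hSS : star S = S ∨ star S = -S)
    (hSe : S * blockProj n n F = (1 - blockProj n n F) * S) :
    IsBlockRealization (bilinGroup S) := by
  refine isBlockRealization_form (n := n) (F := F) (bilinGroup S) ⊤ (conjMatrix (Fin n ⊕ Fin n) F)
    ?_ ?_ ?_ ?_ S ?_ ?_ ?_ ?_ ?_ ?_ ?_ ?_ ?_
  · exact continuous_conjMatrix
  · exact conjMatrix_conjMatrix
  · exact conjMatrix_star_comm
  · exact conjMatrix_blockProj
  · exact hcS
  · exact hS
  · exact hSS
  · exact hSe
  · intro g
    rw [conjMatrix_star]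
    exact (and_iff_left trivial).symm
  · exact isClosed_univ
  · exact fun _ _ => trivial
  · exact Eventually.of_forall fun _ _ _ _ => trivial
  · exact fun _ _ _ => trivial

theorem isBlockRealization_bilinGroup_formJ (n : ℕ) :
    IsBlockRealization (bilinGroup (formJ n F)) :=
  isBlockRealization_bilinGroup _ conjMatrix_formJ star_formJ_mul_self (Or.inr star_formJ)
    formJ_mul_blockProj

theorem isBlockRealization_bilinGroup_formD (n : ℕ) :
    IsBlockRealization (bilinGroup (formD n F)) :=
  isBlockRealization_bilinGroup _ conjMatrix_formD star_formD_mul_self (Or.inl star_formD)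
    formD_mul_blockProj

/-- The diagonal blocks `A`, `D` of a triangular isometry satisfy `Aᵀ * D = 1`. Thus the parabolic
subgroup of the orthogonal group already consists of matrices of determinant one. -/
theorem det_eq_one_of_formD {M : Matrix (Fin n ⊕ Fin n) (Fin n ⊕ Fin n) F}
    (hM : Mᵀ * formD n F * M = formD n F)
    (hP : M * blockProj n n F = blockProj n n F * M * blockProj n n F) : M.det = 1 := by
  rw [mul_blockProj_eq_iff] at hP
  rw [← Matrix.fromBlocks_toBlocks M, hP] at hM ⊢
  rw [Matrix.fromBlocks_transpose, formD, Matrix.fromBlocks_multiply, Matrix.fromBlocks_multiply,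
    Matrix.fromBlocks_inj] at hM
  obtain ⟨-, h, -, -⟩ := hM
  simp only [Matrix.mul_zero, Matrix.mul_one, Matrix.transpose_zero, zero_add, add_zero,
    Matrix.zero_mul] at h
  rw [Matrix.det_fromBlocks_zero₂₁, ← Matrix.det_transpose, ← Matrix.det_mul, h, Matrix.det_one]

theorem isClosed_detOne : IsClosed (detOne ι F : Set (GLin ι F)) :=
  isClosed_eq (Continuous.matrix_det Units.continuous_val) continuous_const

theorem isBlockRealization_specialOrthogonal (n : ℕ) :
    IsBlockRealization (bilinGroup (formD n F) ⊓ detOne (Fin n ⊕ Fin n) F) := by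
  refine isBlockRealization_form (n := n) (F := F) (bilinGroup (formD n F) ⊓ detOne (Fin n ⊕ Fin n) F)
    (detOne (Fin n ⊕ Fin n) F) (conjMatrix _ F) continuous_conjMatrix
    conjMatrix_conjMatrix conjMatrix_star_comm conjMatrix_blockProj _ conjMatrix_formD
    star_formD_mul_self (Or.inl star_formD) formD_mul_blockProj
    (fun g => by rw [conjMatrix_star]; exact Iff.rfl) isClosed_detOne ?_ ?_ ?_
  · intro g hg
    have h1 : (blockRefl n n F).val.det * (blockRefl n n F).val.det = 1 := by
      rw [← Matrix.det_mul, ← Units.val_mul, blockRefl_mul_self, Units.val_one, Matrix.det_one]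
    change ((blockRefl n n F).val * g.val * (blockRefl n n F).val).det = 1
    have hg' : g.val.det = 1 := hg
    rw [Matrix.det_mul, Matrix.det_mul, hg', mul_one, h1]
  · have hc : Continuous fun M : Matrix (Fin n ⊕ Fin n) (Fin n ⊕ Fin n) F => M.det :=
      Continuous.matrix_det continuous_id
    -- If `g * g` has determinant one, then `det g = ±1`; continuity excludes `-1` near the
    -- identity.
    have h1 : ∀ᶠ M in 𝓝 (1 : Matrix (Fin n ⊕ Fin n) (Fin n ⊕ Fin n) F), M.det ≠ -1 := by
      refine hc.continuousAt.eventually_ne ?_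
      rw [Matrix.det_one]
      intro h
      have h2 : (algebraMap ℝ F) 1 = (algebraMap ℝ F) (-1) := by
        rw [map_neg, map_one, h, neg_neg]
        exact h.symm
      have := (algebraMap ℝ F).injective h2
      norm_num at this
    filter_upwards [h1] with M hM g hg hgg
    have h2 : g.val.det * g.val.det = 1 := by
      rw [← Matrix.det_mul]; exact hgg
    rcases mul_self_eq_one_iff.1 h2 with h | h
    · exact h
    · exact absurd (hg ▸ h) hM
  · intro g hg hP
    rw [conjMatrix_star] at hg
    exact det_eq_one_of_formD hg hP

end Bilinear

/-! ### Frames, their spans, and the fibers of the map from unitary matrices to subspaces. -/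

section Frames

variable {p q : ℕ} {F : Type*} [DivisionRing F]

theorem finite_mulOpposite_self : Module.Finite Fᵐᵒᵖ F :=
  Module.Finite.of_surjective
    ({ toFun := MulOpposite.unop, map_add' := fun _ _ => rfl, map_smul' := fun _ _ => rfl } :
      Fᵐᵒᵖ →ₗ[Fᵐᵒᵖ] F) MulOpposite.unop_surjective

theorem finite_mulOpposite_pi {ι : Type*} [Finite ι] : Module.Finite Fᵐᵒᵖ (ι → F) :=
  have := finite_mulOpposite_self (F := F)
  Module.Finite.pi

theorem sum_op_smul {ι κ : Type*} [Fintype κ] (v : κ → ι → F) (c : κ → Fᵐᵒᵖ) :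
    ∑ i, c i • v i = (Matrix.of fun a i => v i a) *ᵥ fun i => MulOpposite.unop (c i) := by
  ext a
  simp [Matrix.mulVec, dotProduct, Finset.sum_apply]

theorem exists_right_inverse_of_mulVec_injective {ι : Type*} [Fintype ι] [DecidableEq ι]
    (R : Matrix ι ι F) (hR : ∀ x, R *ᵥ x = 0 → x = 0) : ∃ R' : Matrix ι ι F, R * R' = 1 := by
  have := finite_mulOpposite_pi (F := F) (ι := ι)
  let f : (ι → F) →ₗ[Fᵐᵒᵖ] (ι → F) :=
    { toFun := fun x => R *ᵥ x
      map_add' := Matrix.mulVec_add R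
      map_smul' := fun c x => Matrix.mulVec_smul R c x }
  have hinj : Function.Injective f := (injective_iff_map_eq_zero f).2 hR
  have hsurj : Function.Surjective f := LinearMap.surjective_of_injective hinj
  choose g hg using hsurj
  refine ⟨Matrix.of fun a b => g (Pi.single b 1) a, ?_⟩
  ext a b
  have h := congrFun (hg (Pi.single b 1)) a
  rw [Matrix.one_apply]
  rw [Pi.single_apply] at h
  exact h

/-- The square matrix whose first columns are the vectors of a frame, and whose other columns
vanish. -/
def frameMatrix (v : Fin p → (Fin p ⊕ Fin q → F)) : Matrix (Fin p ⊕ Fin q) (Fin p ⊕ Fin q) F :=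
  Matrix.of fun a b => Sum.elim (fun i => v i a) 0 b

theorem frameMatrix_mulVec (v : Fin p → (Fin p ⊕ Fin q → F)) (x : Fin p ⊕ Fin q → F) :
    frameMatrix v *ᵥ x = (Matrix.of fun a i => v i a) *ᵥ (x ∘ Sum.inl) := by
  ext a
  simp [Matrix.mulVec, dotProduct, frameMatrix]

theorem frameMatrix_mul_blockProj (v : Fin p → (Fin p ⊕ Fin q → F)) :
    frameMatrix v * blockProj p q F = frameMatrix v := by
  ext a b
  rcases b with b | b <;>
  simp [frameMatrix, blockProj, Matrix.mul_apply, Matrix.one_apply]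

theorem mul_blockProj_eq_frameMatrix (M : Matrix (Fin p ⊕ Fin q) (Fin p ⊕ Fin q) F) :
    M * blockProj p q F = frameMatrix fun i a => M a (Sum.inl i) := by
  ext a b
  rcases b with b | b <;>
  simp [frameMatrix, blockProj, Matrix.mul_apply, Matrix.one_apply]

/-- Describing the span as the range of a square matrix lets subspaces be compared by matrix
identities with `blockProj`; the entries of `y` in the last block meet zero columns. -/
theorem mem_frameSpan_iff (v : Frames p q F) (x : Fin p ⊕ Fin q → F) :
    x ∈ (frameSpan p q F v).1 ↔ ∃ y, frameMatrix v.1 *ᵥ y = x := by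
  change x ∈ Submodule.span Fᵐᵒᵖ (Set.range v.1) ↔ _
  rw [Submodule.mem_span_range_iff_exists_fun]
  constructor
  · rintro ⟨c, rfl⟩
    refine ⟨Sum.elim (fun i => MulOpposite.unop (c i)) 0, ?_⟩
    rw [frameMatrix_mulVec, sum_op_smul, Sum.elim_comp_inl]
  · rintro ⟨y, rfl⟩
    refine ⟨fun i => MulOpposite.op (y (Sum.inl i)), ?_⟩
    rw [frameMatrix_mulVec, sum_op_smul]
    rfl

theorem frameSpan_eq_iff (v w : Frames p q F) : frameSpan p q F v = frameSpan p q F w ↔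
    ∀ x, (∃ y, frameMatrix v.1 *ᵥ y = x) ↔ ∃ y, frameMatrix w.1 *ᵥ y = x := by
  constructor
  · intro h x
    rw [← mem_frameSpan_iff, ← mem_frameSpan_iff, h]
  · intro h
    exact Subtype.ext (SetLike.ext fun x => by rw [mem_frameSpan_iff, mem_frameSpan_iff, h])

theorem frameSpan_surjective : Function.Surjective (frameSpan p q F) := by
  rintro ⟨W, hW⟩
  have := finite_mulOpposite_pi (F := F) (ι := Fin p ⊕ Fin q)
  let b := Module.finBasisOfFinrankEq Fᵐᵒᵖ W hW
  refine ⟨⟨fun i => (b i : Fin p ⊕ Fin q → F),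
    b.linearIndependent.map' W.subtype (Submodule.ker_subtype W)⟩, Subtype.ext ?_⟩
  change Submodule.span Fᵐᵒᵖ (Set.range (W.subtype ∘ b)) = W
  rw [Set.range_comp, Submodule.span_image, b.span_eq, Submodule.map_top, Submodule.range_subtype]

/-- The frame of the first columns of an invertible matrix. -/
def columnFrame (M M' : Matrix (Fin p ⊕ Fin q) (Fin p ⊕ Fin q) F) (hM : M' * M = 1) :
    Frames p q F :=
  ⟨fun i a => M a (Sum.inl i), by
    rw [Fintype.linearIndependent_iff]
    intro c hc i
    have h1 : M *ᵥ Sum.elim (fun i => MulOpposite.unop (c i)) 0 = 0 := by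
      rw [← hc, sum_op_smul]
      ext a
      simp [Matrix.mulVec, dotProduct]
    have h2 : M' *ᵥ (M *ᵥ Sum.elim (fun i => MulOpposite.unop (c i)) 0) = 0 := by
      rw [h1, Matrix.mulVec_zero]
    rw [Matrix.mulVec_mulVec, hM, Matrix.one_mulVec] at h2
    exact MulOpposite.unop_injective (congrFun h2 (Sum.inl i))⟩

theorem frameMatrix_columnFrame (M M' : Matrix (Fin p ⊕ Fin q) (Fin p ⊕ Fin q) F)
    (hM : M' * M = 1) : frameMatrix (columnFrame M M' hM).1 = M * blockProj p q F :=
  (mul_blockProj_eq_frameMatrix M).symm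

theorem matrix_eq_of_mulVec_eq {ι : Type*} [Fintype ι] [DecidableEq ι] {A B : Matrix ι ι F}
    (h : ∀ x, A *ᵥ x = B *ᵥ x) : A = B := by
  ext i j
  have := congrFun (h (Pi.single j 1)) i
  rwa [Matrix.mulVec_single_one, Matrix.mulVec_single_one] at this

variable [StarRing F]

theorem mem_blockUnitary_iff (g : unitaryGL (Fin p ⊕ Fin q) F) :
    g ∈ blockUnitary p q F ↔ mat g * blockProj p q F = blockProj p q F * mat g := by
  constructor
  · rintro ⟨a, d, h⟩
    rw [h]
    simp [blockProj, Matrix.fromBlocks_multiply]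
  · intro h
    have hg : (mat g)ᴴ * 1 * mat g = 1 := g.2
    obtain ⟨A, B, C, D, hM⟩ : ∃ A B C D, mat g = Matrix.fromBlocks A B C D :=
      ⟨_, _, _, _, (Matrix.fromBlocks_toBlocks (mat g)).symm⟩
    rw [hM] at h hg
    rw [blockProj, Matrix.fromBlocks_multiply, Matrix.fromBlocks_multiply, Matrix.fromBlocks_inj] at h
    simp only [Matrix.mul_one, Matrix.mul_zero, add_zero, Matrix.zero_mul,
      Matrix.one_mul, true_and, and_true] at h
    obtain ⟨h1, h2⟩ := h
    subst h2
    rw [← h1, Matrix.mul_one, Matrix.fromBlocks_conjTranspose, Matrix.fromBlocks_multiply,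
      ← Matrix.fromBlocks_one, Matrix.fromBlocks_inj] at hg
    simp only [Matrix.conjTranspose_zero, Matrix.mul_zero, Matrix.zero_mul, add_zero,
      zero_add, true_and] at hg
    refine ⟨⟨⟨A, Aᴴ, mul_eq_one_comm.1 hg.1, hg.1⟩, ?_⟩,
      ⟨⟨D, Dᴴ, mul_eq_one_comm.1 hg.2, hg.2⟩, ?_⟩, ?_⟩
    · change Aᴴ * 1 * A = 1
      rw [Matrix.mul_one, hg.1]
    · change Dᴴ * 1 * D = 1
      rw [Matrix.mul_one, hg.2]
    · rw [hM, ← h1]; rfl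

theorem star_mul_mat (g : unitaryGL (Fin p ⊕ Fin q) F) : star (mat g) * mat g = 1 := by
  have hg : (mat g)ᴴ * 1 * mat g = 1 := g.2
  rwa [mul_one] at hg

theorem mat_mul_star (g : unitaryGL (Fin p ⊕ Fin q) F) : mat g * star (mat g) = 1 :=
  mul_eq_one_comm.1 (star_mul_mat g)

theorem mat_inv_eq_star (g : unitaryGL (Fin p ⊕ Fin q) F) : mat g⁻¹ = star (mat g) :=
  (left_inv_eq_right_inv (star_mul_mat g) (mat_mul_mat_inv g)).symm

/-- The frame of the first columns of a unitary matrix. -/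
def unitaryFrame (k : unitaryGL (Fin p ⊕ Fin q) F) : Frames p q F :=
  columnFrame (mat k) (star (mat k)) (star_mul_mat k)

theorem frameMatrix_unitaryFrame (k : unitaryGL (Fin p ⊕ Fin q) F) :
    frameMatrix (unitaryFrame k).1 = mat k * blockProj p q F := frameMatrix_columnFrame _ _ _

theorem frameSpan_unitaryFrame_eq_iff (s s' : unitaryGL (Fin p ⊕ Fin q) F) :
    (s : unitaryGL (Fin p ⊕ Fin q) F ⧸ blockUnitary p q F) = s' ↔
      frameSpan p q F (unitaryFrame s) = frameSpan p q F (unitaryFrame s') := by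
  rw [QuotientGroup.eq, mem_blockUnitary_iff, frameSpan_eq_iff, frameMatrix_unitaryFrame,
    frameMatrix_unitaryFrame, mat_mul, mat_inv_eq_star]
  have hs1 := star_mul_mat s
  have hs2 := mat_mul_star s
  have hs1' := star_mul_mat s'
  have hs2' := mat_mul_star s'
  set M := mat s
  set M' := mat s'
  set e := blockProj p q F with he
  constructor
  · intro h x
    have h' := congrArg star h
    simp only [star_mul, star_star, he, star_blockProj] at h'
    rw [← he] at h'
    have e1 : M * e = M' * e * (star M' * M) := by
      rw [mul_assoc M', h', ← mul_assoc, ← mul_assoc, hs2', one_mul]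
    have e2 : M' * e = M * e * (star M * M') := by
      rw [mul_assoc M, ← h, ← mul_assoc, ← mul_assoc, hs2, one_mul]
    constructor
    · rintro ⟨y, rfl⟩
      exact ⟨(star M' * M) *ᵥ y, by rw [Matrix.mulVec_mulVec, ← e1]⟩
    · rintro ⟨y, rfl⟩
      exact ⟨(star M * M') *ᵥ y, by rw [Matrix.mulVec_mulVec, ← e2]⟩
  · intro h
    -- An inclusion of the range of `B * e` in that of `A * e` says that `star A * B` preserves the
    -- image of `e`. Using it in both directions gives commutation with `e`.
    have key : ∀ A B : Matrix (Fin p ⊕ Fin q) (Fin p ⊕ Fin q) F, star A * A = 1 →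
        (∀ y, ∃ z, (A * e) *ᵥ z = (B * e) *ᵥ y) → star A * B * e = e * (star A * B) * e := by
      intro A B hA hAB
      refine matrix_eq_of_mulVec_eq fun y => ?_
      obtain ⟨z, hz⟩ := hAB y
      have h1 : (star A * B * e) *ᵥ y = e *ᵥ z := by
        rw [mul_assoc, ← Matrix.mulVec_mulVec, ← hz, Matrix.mulVec_mulVec, ← mul_assoc, hA, one_mul]
      rw [h1, mul_assoc e, ← Matrix.mulVec_mulVec, h1, Matrix.mulVec_mulVec, he, blockProj_mul_self]
    have k1 := key M M' hs1 fun y => (h _).2 ⟨y, rfl⟩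
    have k2 := key M' M hs1' fun y => (h _).1 ⟨y, rfl⟩
    refine blockProj_mul_of_star_mul_self k1 ?_
    rw [star_mul, star_star]
    exact k2

end Frames

/-! ### The diffeomorphism of the unitary quotient with the Grassmannian. -/

section Grassmannian

attribute [local instance] Matrix.normedAddCommGroup Matrix.normedSpace

variable {p q : ℕ} {F : Type*} [NormedDivisionRing F] [NormedAlgebra ℝ F] [StarRing F]
  [StarModule ℝ F] [ContinuousStar F] [FiniteDimensional ℝ F] [ConjugationAlgebra F]

/-- Triangularization leaves only the upper left block of the padded frame matrix, and linear
independence makes this block invertible; `R'` is its inverse in the corner. -/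
theorem exists_frameMatrix_eq (v : Frames p q F) :
    ∃ k R R' : Matrix (Fin p ⊕ Fin q) (Fin p ⊕ Fin q) F, star k * k = 1 ∧ k * star k = 1 ∧
      frameMatrix v.1 = k * R ∧ R * R' = blockProj p q F ∧ R' * R = blockProj p q F := by
  obtain ⟨U, hU1, hU2, hU⟩ := exists_unitary_mul_triangular
    (fun a : Fin p ⊕ Fin q => (finSumFinEquiv a : ℕ))
    (fun a b h => finSumFinEquiv.injective (Fin.ext h)) (frameMatrix v.1) (p + q)
  set R := U * frameMatrix v.1 with hR
  have h21 : R.toBlocks₂₁ = 0 := by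
    ext a b
    refine hU (Sum.inr a) (Sum.inl b) ?_ ?_
    · exact (finSumFinEquiv (Sum.inl b)).2
    · have := b.2
      simp only [finSumFinEquiv_apply_left, finSumFinEquiv_apply_right, Fin.val_castAdd,
        Fin.val_natAdd]
      omega
  have hRe : R * blockProj p q F = R := by rw [hR, mul_assoc, frameMatrix_mul_blockProj]
  have hRb : R = Matrix.fromBlocks R.toBlocks₁₁ 0 0 0 := by
    have h := hRe
    rw [← Matrix.fromBlocks_toBlocks R, h21, blockProj, Matrix.fromBlocks_multiply,
      Matrix.fromBlocks_inj] at h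
    simp only [Matrix.mul_zero, add_zero, Matrix.mul_one] at h
    conv_lhs => rw [← Matrix.fromBlocks_toBlocks R, h21, ← h.2.1, ← h.2.2.2]
  have hinj : ∀ x, R.toBlocks₁₁ *ᵥ x = 0 → x = 0 := by
    intro x hx
    have h1 : R *ᵥ Sum.elim x 0 = 0 := by
      rw [hRb, Matrix.fromBlocks_mulVec]
      simp only [Sum.elim_comp_inl, hx, Matrix.zero_mulVec, add_zero]
      ext i; rcases i with i | i <;> rfl
    have h2 : frameMatrix v.1 *ᵥ Sum.elim x 0 = 0 := by
      have := congrArg (fun y => star U *ᵥ y) h1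
      simpa only [hR, Matrix.mulVec_mulVec, ← mul_assoc, hU1, one_mul, Matrix.mulVec_zero] using this
    have h3 := Fintype.linearIndependent_iff.1 v.2 (fun i => MulOpposite.op (x i)) (by
      rw [sum_op_smul]
      rw [frameMatrix_mulVec, Sum.elim_comp_inl] at h2
      exact h2)
    exact funext fun i => MulOpposite.op_injective (h3 i)
  obtain ⟨R', hR'⟩ := exists_right_inverse_of_mulVec_injective _ hinj
  have hR'' := mul_eq_one_comm.1 hR'
  refine ⟨star U, R, Matrix.fromBlocks R' 0 0 0, by rw [star_star, hU2], by rw [star_star, hU1],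
    ?_, ?_, ?_⟩
  · rw [hR, ← mul_assoc, hU1, one_mul]
  · rw [hRb, Matrix.fromBlocks_multiply, hR']
    simp [blockProj]
  · rw [hRb, Matrix.fromBlocks_multiply, hR'']
    simp [blockProj]

theorem contDiff_frameMatrix :
    ContDiff ℝ ∞ (frameMatrix : (Fin p → (Fin p ⊕ Fin q → F)) → _) := by
  refine contDiff_pi.2 fun a => contDiff_pi.2 fun b => ?_
  rcases b with b | b
  · exact contDiff_apply_apply ℝ F b a
  · exact contDiff_const

theorem exists_section_frames (v₀ : Frames p q F) :
    ∃ κ : (Fin p → (Fin p ⊕ Fin q → F)) → Matrix (Fin p ⊕ Fin q) (Fin p ⊕ Fin q) F,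
      ContDiffAt ℝ ∞ κ v₀.1 ∧ ∀ᶠ w in 𝓝 v₀.1, ∀ v : Frames p q F, v.1 = w →
        ∃ s : unitaryGL (Fin p ⊕ Fin q) F, mat s = κ w ∧
          frameSpan p q F (unitaryFrame s) = frameSpan p q F v := by
  obtain ⟨k₀, R, R', hk1, hk2, hv, hR1, hR2⟩ := exists_frameMatrix_eq v₀
  obtain ⟨κ, hκs, -, hκ⟩ := matrix_exists_smooth_unitary (blockProj p q F) blockProj_mul_self
    star_blockProj
  set e := blockProj p q F with he
  have hee : e * e = e := blockProj_mul_self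
  -- Multiplying by `star k₀` and `R'` normalizes the frame `v₀` to the standard one, and `1 - e`
  -- completes it to a square matrix. Thus `μ v₀.1 = 1`, and the section `κ` near `1` applies.
  let μ : (Fin p → (Fin p ⊕ Fin q → F)) → Matrix (Fin p ⊕ Fin q) (Fin p ⊕ Fin q) F :=
    fun w => star k₀ * frameMatrix w * (R' * e) + (1 - e)
  have hμ0 : μ v₀.1 = 1 := by
    change star k₀ * frameMatrix v₀.1 * (R' * e) + (1 - e) = 1
    rw [hv, ← mul_assoc (star k₀), hk1, one_mul, ← mul_assoc, hR1, hee, add_sub_cancel]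
  have hμs : ContDiffAt ℝ ∞ μ v₀.1 :=
    ((contDiffAt_const.matrix_mul contDiff_frameMatrix.contDiffAt).matrix_mul
      contDiffAt_const).add contDiffAt_const
  have hμt : Tendsto μ (𝓝 v₀.1) (𝓝 1) := by
    have := hμs.continuousAt.tendsto
    rwa [hμ0] at this
  have hunit : ∀ᶠ M in 𝓝 (1 : Matrix (Fin p ⊕ Fin q) (Fin p ⊕ Fin q) F), IsUnit M :=
    matrix_eventually_isUnit
  refine ⟨fun w => k₀ * κ (μ w), ?_, ?_⟩
  · refine contDiffAt_const.matrix_mul ?_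
    refine ContDiffAt.comp (g := κ) (f := μ) _ ?_ hμs
    rw [hμ0]; exact hκs
  · filter_upwards [hμt.eventually hκ, hμt.eventually hunit] with w hw hu v hvw
    obtain ⟨m, hm⟩ := hu
    obtain ⟨k, t, t', hk1', hk2', hkt, ht1, ht2, hp1, hp2⟩ := exists_unitary_mul_parabolic (μ w)
      (m⁻¹ : _ˣ).val (by rw [← hm]; exact m.mul_inv)
    obtain ⟨hc1, hc2, -, hce⟩ := hw k t t' hk1' hk2' ht1 hp1 hp2 hkt.symm
    rw [← he] at hp1 hp2
    set c := κ (μ w)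
    have hs1 : star (k₀ * c) * (k₀ * c) = 1 := by
      rw [star_mul]
      calc star c * star k₀ * (k₀ * c) = star c * (star k₀ * k₀) * c := by simp only [mul_assoc]
        _ = 1 := by rw [hk1, mul_one, hc1]
    have hs2 := mul_eq_one_comm.1 hs1
    let s : unitaryGL (Fin p ⊕ Fin q) F := ⟨⟨k₀ * c, star (k₀ * c), hs2, hs1⟩, by
      change star (k₀ * c) * 1 * (k₀ * c) = 1
      rw [mul_one, hs1]⟩
    refine ⟨s, rfl, ?_⟩
    rw [frameSpan_eq_iff, frameMatrix_unitaryFrame, hvw]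
    have hms : mat s = k₀ * c := rfl
    have e1 : k * t * e = star k₀ * frameMatrix w * R' * e := by
      rw [← hkt]
      change (star k₀ * frameMatrix w * (R' * e) + (1 - e)) * e = _
      rw [add_mul, sub_mul, one_mul, hee, sub_self, add_zero, mul_assoc, mul_assoc R', hee]
      simp only [mul_assoc]
    -- Here and in `e3` each of the matrices `mat s * e` and `frameMatrix w` is written as the other
    -- times a matrix, so their ranges coincide.
    have e2 : mat s * e = frameMatrix w * (R' * e * t' * e * star k * c) := by
      calc mat s * e = k₀ * (c * e * star c) * c := by
            rw [hms]; simp only [mul_assoc, hc1, mul_one]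
        _ = k₀ * (k * (t * t') * e) * star k * c := by
            rw [hce, ht1, mul_one]; simp only [mul_assoc]
        _ = k₀ * (k * t * (t' * e)) * star k * c := by simp only [mul_assoc]
        _ = k₀ * (k * t * e) * t' * e * star k * c := by rw [hp2]; simp only [mul_assoc]
        _ = (k₀ * star k₀) * frameMatrix w * (R' * e * t' * e * star k * c) := by
            rw [e1]; simp only [mul_assoc]
        _ = _ := by rw [hk2, one_mul]
    have hR'e : R' * e * R = e := by
      calc R' * e * R = R' * R * (R' * R) := by rw [← hR1]; simp only [mul_assoc]
        _ = e := by rw [hR2, hee]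
    have e3 : frameMatrix w = mat s * e * (star c * k * t * e * R) := by
      calc frameMatrix w = k₀ * star k₀ * (frameMatrix w * (R' * e * R)) := by
            rw [hR'e, frameMatrix_mul_blockProj, hk2, one_mul]
        _ = k₀ * (star k₀ * frameMatrix w * R' * e) * R := by
            simp only [mul_assoc]
        _ = k₀ * k * (t * e) * R := by rw [← e1]; simp only [mul_assoc]
        _ = k₀ * (k * e * (star k * k)) * t * e * R := by
            rw [hp1, hk1', mul_one]; simp only [mul_assoc]
        _ = k₀ * (k * e * star k) * k * t * e * R := by simp only [mul_assoc]
        _ = _ := by rw [← hce, hms]; simp only [mul_assoc]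
    intro x
    constructor
    · rintro ⟨y, rfl⟩
      exact ⟨(R' * e * t' * e * star k * c) *ᵥ y, by rw [Matrix.mulVec_mulVec, ← e2]⟩
    · rintro ⟨y, rfl⟩
      exact ⟨(star c * k * t * e * R) *ᵥ y, by rw [Matrix.mulVec_mulVec, ← e3]⟩

theorem isGrassmannRealization (p q : ℕ) : IsGrassmannRealization p q F := by
  let _ : TopologicalSpace (Frames p q F) := TopologicalSpace.induced Subtype.val inferInstance
  have hcont : Continuous (Subtype.val : Frames p q F → _) := continuous_induced_dom
  have hJ : ContDiff ℝ ∞ fun (M : Matrix (Fin p ⊕ Fin q) (Fin p ⊕ Fin q) F) (i : Fin p)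
      (a : Fin p ⊕ Fin q) => M a (Sum.inl i) :=
    contDiff_pi.2 fun i => contDiff_pi.2 fun a => contDiff_apply_apply ℝ F a (Sum.inl i)
  obtain ⟨φ, hφ, hd⟩ := exists_isDiffeo_of_local_sections
    (fun g : unitaryGL (Fin p ⊕ Fin q) F => mat g) (fun v : Frames p q F => v.1)
    (fun g => (g : unitaryGL (Fin p ⊕ Fin q) F ⧸ blockUnitary p q F)) (frameSpan p q F)
    (isInducing_units_val_of_unitary (fun k : unitaryGL (Fin p ⊕ Fin q) F => k.1)
      IsInducing.subtypeVal star_mul_mat)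
    hcont Subtype.val_injective isQuotientMap_quotient_mk' ⟨⟨rfl⟩, frameSpan_surjective⟩
    unitaryFrame (continuous_induced_rng.2 (hJ.continuous.comp continuous_mat))
    (fun M i a => M a (Sum.inl i)) hJ (fun _ => rfl) frameSpan_unitaryFrame_eq_iff
    exists_section_frames
  refine ⟨φ, fun k => ?_, hd⟩
  refine (congrArg (fun W : Gr p q F => (W.1 : Set (Fin p ⊕ Fin q → F))) (hφ k)).trans ?_
  ext x
  rw [SetLike.mem_coe, mem_frameSpan_iff, frameMatrix_unitaryFrame]
  constructor
  · rintro ⟨y, rfl⟩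
    refine ⟨blockProj p q F *ᵥ y, ?_, Matrix.mulVec_mulVec _ _ _⟩
    intro j
    rw [blockProj, Matrix.fromBlocks_mulVec]
    simp
  · rintro ⟨y, hy, rfl⟩
    refine ⟨y, ?_⟩
    have h : blockProj p q F *ᵥ y = y := by
      rw [blockProj, Matrix.fromBlocks_mulVec]
      ext i
      rcases i with i | i
      · simp
      · simpa using (hy i).symm
    rw [← Matrix.mulVec_mulVec, h]

end Grassmannian

/-! ### Reflections, rotations as products of two reflections, and stabilizers of lines. -/

section Reflections

variable {ι : Type*} [Fintype ι] [DecidableEq ι] {F : Type*} [Field F]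

/-- The reflection in the hyperplane orthogonal to `u`. -/
def refl (u : ι → F) : Matrix ι ι F := 1 - (2 / (u ⬝ᵥ u)) • Matrix.vecMulVec u u

theorem refl_mulVec (u x : ι → F) : refl u *ᵥ x = x - (2 / (u ⬝ᵥ u) * (u ⬝ᵥ x)) • u := by
  rw [refl, Matrix.sub_mulVec, Matrix.one_mulVec, Matrix.smul_mulVec, Matrix.vecMulVec_mulVec]
  ext i
  simp [mul_comm, mul_assoc]

theorem refl_mulVec_of_orthogonal {u x : ι → F} (h : u ⬝ᵥ x = 0) : refl u *ᵥ x = x := by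
  rw [refl_mulVec, h, mul_zero, zero_smul, sub_zero]

theorem refl_mulVec_self {u : ι → F} (h : u ⬝ᵥ u ≠ 0) : refl u *ᵥ u = -u := by
  rw [refl_mulVec, div_mul_cancel₀ _ h, two_smul, sub_add_cancel_left]

theorem refl_transpose (u : ι → F) : (refl u)ᵀ = refl u := by
  rw [refl, Matrix.transpose_sub, Matrix.transpose_one, Matrix.transpose_smul,
    Matrix.transpose_vecMulVec]

theorem refl_neg (u : ι → F) : refl (-u) = refl u := by
  simp [refl]

theorem refl_mul_self {u : ι → F} (h : u ⬝ᵥ u ≠ 0) : refl u * refl u = 1 := by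
  refine matrix_eq_of_mulVec_eq fun x => ?_
  rw [← Matrix.mulVec_mulVec, refl_mulVec u x, Matrix.mulVec_sub, Matrix.mulVec_smul,
    refl_mulVec_self h, refl_mulVec, Matrix.one_mulVec, smul_neg]
  abel

theorem star_refl [StarRing F] {u : ι → F} (h : star u = u) : star (refl u) = refl u := by
  have h1 : star (u ⬝ᵥ u) = u ⬝ᵥ u := by
    rw [← Matrix.star_dotProduct_star, h]
  have h2 : (Matrix.vecMulVec u u)ᴴ = Matrix.vecMulVec u u := by
    rw [Matrix.conjTranspose_vecMulVec, h]
  rw [refl, star_sub, star_one, star_smul, Matrix.star_eq_conjTranspose, h2, star_div₀, h1]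
  congr 3
  exact star_ofNat 2

theorem det_refl {u : ι → F} (h : u ⬝ᵥ u ≠ 0) : (refl u).det = -1 := by
  have h1 : refl u = 1 + Matrix.replicateCol Unit (-(2 / (u ⬝ᵥ u)) • u) *
      Matrix.replicateRow Unit u := by
    rw [refl, ← Matrix.vecMulVec_eq, Matrix.smul_vecMulVec, neg_smul, sub_eq_add_neg]
  rw [h1, Matrix.det_one_add_replicateCol_mul_replicateRow, dotProduct_smul, smul_eq_mul, neg_mul,
    div_mul_cancel₀ _ h]
  norm_num

/-- The first reflection sends `e` to `-e`. The second exchanges `-r • e` and `x`, which have equal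
square and difference `r • e + x`. -/
theorem refl_mulVec_refl_mulVec {e x : ι → F} {r : F} (he : e ⬝ᵥ e = 1) (hx : x ⬝ᵥ x = r * r)
    (hu : (r • e + x) ⬝ᵥ (r • e + x) ≠ 0) :
    refl (r • e + x) *ᵥ (refl e *ᵥ e) = r⁻¹ • x := by
  have h1 : (r • e + x) ⬝ᵥ (r • e + x) = 2 * r * ((r • e + x) ⬝ᵥ e) := by
    simp only [add_dotProduct, dotProduct_add, smul_dotProduct, dotProduct_smul, smul_eq_mul, he, hx,
      dotProduct_comm x e]
    ring
  have hr : r ≠ 0 := by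
    rintro rfl
    exact hu (by rw [h1, mul_zero, zero_mul])
  have h3 : (2 : F) ≠ 0 := by
    intro h; exact hu (by rw [h1, h, zero_mul, zero_mul])
  have h2 : (r • e + x) ⬝ᵥ e ≠ 0 := by
    intro h; exact hu (by rw [h1, h, mul_zero])
  have h4 : 2 / ((r • e + x) ⬝ᵥ (r • e + x)) * ((r • e + x) ⬝ᵥ e) = r⁻¹ := by
    rw [h1]; field_simp
  rw [refl_mulVec_self (by rw [he]; exact one_ne_zero), Matrix.mulVec_neg, refl_mulVec, h4, smul_add,
    smul_smul, inv_mul_cancel₀ hr, one_smul]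
  abel

/-- If `x = -(r • e)`, the vector `r • e + x` defines no reflection. The reflection in `e` alone is
then already right, and one in the orthogonal vector `g` is added to keep the number of reflections,
hence the determinant. -/
theorem exists_rotation {e g x : ι → F} {r : F} (he : e ⬝ᵥ e = 1) (hg : g ⬝ᵥ g = 1)
    (hge : g ⬝ᵥ e = 0) (hr : r ≠ 0) (hx : x ⬝ᵥ x = r * r)
    (h0 : (r • e + x) ⬝ᵥ (r • e + x) = 0 → r • e + x = 0) :
    ∃ u, (u = r • e + x ∨ u = g) ∧ u ⬝ᵥ u ≠ 0 ∧ refl u *ᵥ (refl e *ᵥ e) = r⁻¹ • x := by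
  by_cases h : (r • e + x) ⬝ᵥ (r • e + x) = 0
  · refine ⟨g, Or.inr rfl, by rw [hg]; exact one_ne_zero, ?_⟩
    have h1 : x = -(r • e) := (neg_eq_of_add_eq_zero_right (h0 h)).symm
    rw [refl_mulVec_self (by rw [he]; exact one_ne_zero), Matrix.mulVec_neg,
      refl_mulVec_of_orthogonal hge, h1, smul_neg, smul_smul, inv_mul_cancel₀ hr, one_smul]
  · exact ⟨_, Or.inl rfl, h, refl_mulVec_refl_mulVec he hx h⟩

theorem mem_stab_line {G : Subgroup (GLin ι F)} {g : G} {w : ι → F} (hw : w ≠ 0) {c : F}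
    (h : mat g *ᵥ w = c • w) : g ∈ stab G (line w) := by
  have hinv : ∀ x, mat g⁻¹ *ᵥ (mat g *ᵥ x) = x := fun x => by
    rw [Matrix.mulVec_mulVec, mat_inv_mul_mat, Matrix.one_mulVec]
  have hc : c ≠ 0 := by
    rintro rfl
    have h1 := hinv w
    rw [h, zero_smul, Matrix.mulVec_zero] at h1
    exact hw h1.symm
  intro x
  constructor
  · rintro ⟨a, ha⟩
    refine ⟨a * c⁻¹, ?_⟩
    have h1 : mat g *ᵥ ((a * c⁻¹) • w) = mat g *ᵥ x := by
      rw [ha, Matrix.mulVec_smul, h, smul_smul, mul_assoc, inv_mul_cancel₀ hc, mul_one]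
    rw [← hinv x, ← h1, hinv]
  · rintro ⟨a, rfl⟩
    exact ⟨a * c, by rw [Matrix.mulVec_smul, h, smul_smul]⟩

theorem exists_of_mem_stab_line {G : Subgroup (GLin ι F)} {g : G} {w : ι → F}
    (h : g ∈ stab G (line w)) : ∃ c : F, mat g *ᵥ w = c • w :=
  (h w).2 ⟨1, (one_smul F w).symm⟩

theorem inv_mul_mem_stab_line {G : Subgroup (GLin ι F)} {k g : G} {w : ι → F} (hw : w ≠ 0) {c : F}
    (h : mat g *ᵥ w = c • mat k *ᵥ w) : k⁻¹ * g ∈ stab G (line w) := by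
  refine mem_stab_line hw (c := c) ?_
  rw [mat_mul, ← Matrix.mulVec_mulVec, h, Matrix.mulVec_smul, Matrix.mulVec_mulVec,
    mat_inv_mul_mat, Matrix.one_mulVec]

theorem mat_mulVec_ne_zero {G : Subgroup (GLin ι F)} (g : G) {w : ι → F} (hw : w ≠ 0) :
    mat g *ᵥ w ≠ 0 := by
  intro h
  have h1 : mat g⁻¹ *ᵥ (mat g *ᵥ w) = 0 := by rw [h, Matrix.mulVec_zero]
  rw [Matrix.mulVec_mulVec, mat_inv_mul_mat, Matrix.one_mulVec] at h1
  exact hw h1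

end Reflections

section Smooth

attribute [local instance] Matrix.normedAddCommGroup Matrix.normedSpace

variable {ι : Type*} [Fintype ι] [DecidableEq ι] {F : Type*} [NormedField F] [NormedAlgebra ℝ F]
  {E : Type*} [NormedAddCommGroup E] [NormedSpace ℝ E]

theorem contDiffAt_dotProduct {u v : E → ι → F} {x : E} (hu : ContDiffAt ℝ ∞ u x)
    (hv : ContDiffAt ℝ ∞ v x) : ContDiffAt ℝ ∞ (fun y => u y ⬝ᵥ v y) x :=
  ContDiffAt.sum fun i _ => (contDiffAt_pi.1 hu i).mul (contDiffAt_pi.1 hv i)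

theorem contDiffAt_mulVec {M : E → Matrix ι ι F} {v : E → ι → F} {x : E} (hM : ContDiffAt ℝ ∞ M x)
    (hv : ContDiffAt ℝ ∞ v x) : ContDiffAt ℝ ∞ (fun y => M y *ᵥ v y) x :=
  contDiffAt_pi.2 fun i => contDiffAt_dotProduct (contDiffAt_pi.1 hM i) hv

theorem contDiffAt_refl {u : E → ι → F} {x : E} (hu : ContDiffAt ℝ ∞ u x)
    (h : u x ⬝ᵥ u x ≠ 0) : ContDiffAt ℝ ∞ (fun y => refl (u y)) x := by
  refine contDiffAt_const.sub ?_
  refine contDiffAt_pi.2 fun i => contDiffAt_pi.2 fun j => ?_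
  have h1 : ContDiffAt ℝ ∞ (fun y => 2 * (u y ⬝ᵥ u y)⁻¹ * (u y i * u y j)) x :=
    (contDiffAt_const.mul ((contDiffAt_dotProduct hu hu).inv h)).mul
      ((contDiffAt_pi.1 hu i).mul (contDiffAt_pi.1 hu j))
  refine h1.congr_of_eventuallyEq (Eventually.of_forall fun y => ?_)
  change 2 / (u y ⬝ᵥ u y) * (u y i * u y j) = _
  rw [div_eq_mul_inv]

end Smooth

/-! ### Real and imaginary parts of isotropic vectors. -/

section RealParts

variable {ι : Type*} [Fintype ι] [DecidableEq ι]

/-- The real part of a complex vector, as a complex vector. -/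
noncomputable def rePart (w : ι → ℂ) : ι → ℂ := (2⁻¹ : ℂ) • (w + star w)

/-- The imaginary part of a complex vector, as a complex vector. -/
noncomputable def imPart (w : ι → ℂ) : ι → ℂ := (2⁻¹ * -Complex.I : ℂ) • (w - star w)

theorem star_rePart (w : ι → ℂ) : star (rePart w) = rePart w := by
  ext i
  simp [rePart]
  ring

theorem star_imPart (w : ι → ℂ) : star (imPart w) = imPart w := by
  ext i
  simp [imPart]
  ring

theorem rePart_add_imPart (w : ι → ℂ) : rePart w + Complex.I • imPart w = w := by
  ext i
  simp only [rePart, imPart, Pi.add_apply, Pi.smul_apply, Pi.sub_apply, smul_eq_mul]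
  linear_combination (-(w i - star w i) / 2) * Complex.I_mul_I

/-- For `w = x + iy` the square `w ⬝ᵥ w` is `x ⬝ᵥ x - y ⬝ᵥ y + 2i (x ⬝ᵥ y)`, and both its real and
its imaginary part vanish. -/
theorem isotropic_parts {w : ι → ℂ} (h : w ⬝ᵥ w = 0) :
    imPart w ⬝ᵥ imPart w = rePart w ⬝ᵥ rePart w ∧ imPart w ⬝ᵥ rePart w = 0 := by
  have h' : star w ⬝ᵥ star w = 0 := by rw [Matrix.star_dotProduct_star, h, star_zero]
  constructor
  · simp only [rePart, imPart, smul_dotProduct, dotProduct_smul, add_dotProduct, dotProduct_add,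
      sub_dotProduct, dotProduct_sub, h, h', smul_eq_mul, dotProduct_comm (star w) w]
    linear_combination (-(w ⬝ᵥ star w) / 2) * Complex.I_mul_I
  · simp only [rePart, imPart, smul_dotProduct, dotProduct_smul, dotProduct_add,
      sub_dotProduct, h, h', smul_eq_mul, dotProduct_comm (star w) w]
    ring

theorem eq_zero_of_star_eq {u : ι → ℂ} (hu : star u = u) (h : u ⬝ᵥ u = 0) : u = 0 := by
  by_contra h0
  have h1 := star_dotProduct_self u
  rw [hu, h, ← map_zero (algebraMap ℝ ℂ)] at h1
  exact (sum_norm_sq_pos h0).ne ((algebraMap ℝ ℂ).injective h1)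

/-- The length of a real vector. -/
noncomputable def realLength (x : ι → ℂ) : ℂ := (Real.sqrt (x ⬝ᵥ x).re : ℝ)

theorem realLength_mul_self {x : ι → ℂ} (hx : star x = x) :
    x ⬝ᵥ x = realLength x * realLength x := by
  have h1 := star_dotProduct_self x
  rw [hx] at h1
  have h2 : (x ⬝ᵥ x).re = ∑ i, ‖x i‖ ^ 2 := by rw [h1]; exact Complex.ofReal_re _
  rw [realLength, ← Complex.ofReal_mul, Real.mul_self_sqrt (by rw [h2]; positivity), h2, h1]
  rfl

theorem star_realLength (x : ι → ℂ) : star (realLength x) = realLength x := Complex.conj_ofReal _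

theorem refl_mulVec_dotProduct {F : Type*} [Field F] (u x y : ι → F) :
    (refl u *ᵥ x) ⬝ᵥ y = x ⬝ᵥ (refl u *ᵥ y) := by
  rw [Matrix.dotProduct_mulVec, ← Matrix.mulVec_transpose, refl_transpose]

theorem refl_mulVec_refl {F : Type*} [Field F] {u : ι → F} (h : u ⬝ᵥ u ≠ 0) (x : ι → F) :
    refl u *ᵥ (refl u *ᵥ x) = x := by
  rw [Matrix.mulVec_mulVec, refl_mul_self h, Matrix.one_mulVec]

end RealParts

/-! ### Products of two plane rotations. -/

section DoubleRotation

variable {ι F : Type*} [Fintype ι] [DecidableEq ι] [Field F]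

/-- The product of the rotation in the plane of `a` and `U` with the rotation in the plane of `b` and
`V`, each written as a product of two reflections. -/
def doubleRotation (a b U V : ι → F) : Matrix ι ι F := refl U * refl a * (refl V * refl b)

variable {a b U V x y : ι → F} {r : F}

theorem doubleRotation_transpose_mul_self (ha : a ⬝ᵥ a = 1) (hb : b ⬝ᵥ b = 1) (hU : U ⬝ᵥ U ≠ 0)
    (hV : V ⬝ᵥ V ≠ 0) : (doubleRotation a b U V)ᵀ * doubleRotation a b U V = 1 := by
  have e0 : a ⬝ᵥ a ≠ 0 := by rw [ha]; exact one_ne_zero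
  have e1 : b ⬝ᵥ b ≠ 0 := by rw [hb]; exact one_ne_zero
  calc (doubleRotation a b U V)ᵀ * doubleRotation a b U V
      = refl b * (refl V * (refl a * (refl U * refl U) * refl a) * refl V) * refl b := by
        simp only [doubleRotation, Matrix.transpose_mul, refl_transpose, mul_assoc]
    _ = 1 := by rw [refl_mul_self hU, mul_one, refl_mul_self e0, mul_one, refl_mul_self hV,
        mul_one, refl_mul_self e1]

theorem star_doubleRotation [StarRing F] (ha : star a = a) (hb : star b = b) (hU : star U = U)
    (hV : star V = V) : star (doubleRotation a b U V) = (doubleRotation a b U V)ᵀ := by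
  simp only [doubleRotation, star_mul, star_refl ha, star_refl hb, star_refl hU, star_refl hV,
    Matrix.transpose_mul, refl_transpose]

theorem det_doubleRotation (ha : a ⬝ᵥ a = 1) (hb : b ⬝ᵥ b = 1) (hU : U ⬝ᵥ U ≠ 0)
    (hV : V ⬝ᵥ V ≠ 0) : (doubleRotation a b U V).det = 1 := by
  have e0 : a ⬝ᵥ a ≠ 0 := by rw [ha]; exact one_ne_zero
  have e1 : b ⬝ᵥ b ≠ 0 := by rw [hb]; exact one_ne_zero
  simp only [doubleRotation, Matrix.det_mul, det_refl hU, det_refl hV, det_refl e0, det_refl e1]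
  norm_num

theorem doubleRotation_mulVec_left (hba : b ⬝ᵥ a = 0) (hVa : V ⬝ᵥ a = 0)
    (h : refl U *ᵥ (refl a *ᵥ a) = r⁻¹ • x) : doubleRotation a b U V *ᵥ a = r⁻¹ • x := by
  rw [doubleRotation, ← Matrix.mulVec_mulVec, ← Matrix.mulVec_mulVec, ← Matrix.mulVec_mulVec,
    refl_mulVec_of_orthogonal hba, refl_mulVec_of_orthogonal hVa, h]

/-- The second rotation aims at `y` pulled back by the first one, so that the first one then carries
it to `y`. -/
theorem doubleRotation_mulVec_right (ha : a ⬝ᵥ a = 1) (hU : U ⬝ᵥ U ≠ 0)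
    (h : refl V *ᵥ (refl b *ᵥ b) = r⁻¹ • (refl a *ᵥ (refl U *ᵥ y))) :
    doubleRotation a b U V *ᵥ b = r⁻¹ • y := by
  have e0 : a ⬝ᵥ a ≠ 0 := by rw [ha]; exact one_ne_zero
  rw [doubleRotation, ← Matrix.mulVec_mulVec, ← Matrix.mulVec_mulVec, ← Matrix.mulVec_mulVec,
    h, Matrix.mulVec_smul, Matrix.mulVec_smul, refl_mulVec_refl e0, refl_mulVec_refl hU]

end DoubleRotation

/-! ### Transitivity and a smooth section for the complex quadric. -/

section ComplexQuadric

variable {n : ℕ}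

/-- The first two vectors of the standard basis. -/
noncomputable def baseVec (n : ℕ) (i : Fin 2) : Fin 2 ⊕ Fin n → ℂ := Pi.single (Sum.inl i) 1

theorem star_baseVec (i : Fin 2) : star (baseVec n i) = baseVec n i := by
  ext j
  by_cases h : j = Sum.inl i
  · subst h; simp [baseVec]
  · simp [baseVec, h]

theorem baseVec_dotProduct_self (i : Fin 2) : baseVec n i ⬝ᵥ baseVec n i = 1 := by
  simp [baseVec]

theorem baseVec_one_zero : baseVec n 1 ⬝ᵥ baseVec n 0 = 0 := by
  simp [baseVec]

theorem complexIsotropic_eq (c : ℂ) :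
    complexIsotropic n c = baseVec n 0 + c • baseVec n 1 := by
  ext i
  rcases i with i | i
  · fin_cases i <;> simp [complexIsotropic, baseVec]
  · simp [complexIsotropic, baseVec]

theorem star_complexIsotropic :
    star (complexIsotropic n Complex.I) = complexIsotropic n (-Complex.I) := by
  rw [complexIsotropic_eq, complexIsotropic_eq, star_add, star_smul, star_baseVec, star_baseVec]
  congr 2
  exact Complex.conj_I

theorem complexIsotropic_ne_zero (c : ℂ) : complexIsotropic n c ≠ 0 := by
  intro h
  have := congrFun h (Sum.inl 0)
  simp [complexIsotropic] at this

theorem complexIsotropic_dotProduct_self :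
    complexIsotropic n Complex.I ⬝ᵥ complexIsotropic n Complex.I = 0 := by
  rw [complexIsotropic_eq]
  simp only [add_dotProduct, dotProduct_add, smul_dotProduct, dotProduct_smul, smul_eq_mul,
    baseVec_dotProduct_self, dotProduct_comm (baseVec n 0) (baseVec n 1), baseVec_one_zero]
  linear_combination Complex.I_mul_I

theorem rePart_complexIsotropic : rePart (complexIsotropic n Complex.I) = baseVec n 0 := by
  rw [rePart, star_complexIsotropic, complexIsotropic_eq, complexIsotropic_eq]
  ext i
  simp
  ring

theorem imPart_complexIsotropic : imPart (complexIsotropic n Complex.I) = baseVec n 1 := by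
  rw [imPart, star_complexIsotropic, complexIsotropic_eq, complexIsotropic_eq]
  ext i
  simp
  linear_combination (-(baseVec n 1 i)) * Complex.I_mul_I

theorem exists_mem_maxCompact_SOComplex {K : Matrix (Fin 2 ⊕ Fin n) (Fin 2 ⊕ Fin n) ℂ}
    (h1 : Kᵀ * K = 1) (h2 : star K * K = 1) (h3 : K.det = 1) :
    ∃ k ∈ maxCompact (SOComplex n), mat k = K := by
  let k : GLin (Fin 2 ⊕ Fin n) ℂ := ⟨K, star K, mul_eq_one_comm.1 h2, h2⟩
  have hk : k ∈ SOComplex n := ⟨by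
    change Kᵀ * 1 * K = 1
    rw [mul_one, h1], h3⟩
  exact ⟨⟨k, hk⟩, mem_maxCompact.2 h2, rfl⟩

theorem doubleRotation_baseVec {U V x y : Fin 2 ⊕ Fin n → ℂ} {r : ℂ} (hU : star U = U)
    (hV : star V = V) (hU0 : U ⬝ᵥ U ≠ 0) (hV0 : V ⬝ᵥ V ≠ 0) (hVe : V ⬝ᵥ baseVec n 0 = 0)
    (h1 : refl U *ᵥ (refl (baseVec n 0) *ᵥ baseVec n 0) = r⁻¹ • x)
    (h2 : refl V *ᵥ (refl (baseVec n 1) *ᵥ baseVec n 1) =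
      r⁻¹ • (refl (baseVec n 0) *ᵥ (refl U *ᵥ y))) :
    ∃ k ∈ maxCompact (SOComplex n), mat k = doubleRotation (baseVec n 0) (baseVec n 1) U V ∧
      mat k *ᵥ complexIsotropic n Complex.I = r⁻¹ • (x + Complex.I • y) := by
  have h3 := doubleRotation_transpose_mul_self (baseVec_dotProduct_self (n := n) 0)
    (baseVec_dotProduct_self 1) hU0 hV0
  have h4 := star_doubleRotation (star_baseVec (n := n) 0) (star_baseVec 1) hU hV
  obtain ⟨k, hk, hkm⟩ := exists_mem_maxCompact_SOComplex h3 (by rw [h4, h3])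
    (det_doubleRotation (baseVec_dotProduct_self 0) (baseVec_dotProduct_self 1) hU0 hV0)
  refine ⟨k, hk, hkm, ?_⟩
  rw [hkm, complexIsotropic_eq, Matrix.mulVec_add, Matrix.mulVec_smul,
    doubleRotation_mulVec_left baseVec_one_zero hVe h1,
    doubleRotation_mulVec_right (baseVec_dotProduct_self 0) hU0 h2, smul_add, smul_comm]

theorem SOComplex_isotropic (g : SOComplex n) :
    (mat g *ᵥ complexIsotropic n Complex.I) ⬝ᵥ (mat g *ᵥ complexIsotropic n Complex.I) = 0 := by
  have h : (mat g)ᵀ * 1 * mat g = 1 := g.2.1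
  rw [mul_one] at h
  rw [Matrix.dotProduct_mulVec, ← Matrix.mulVec_transpose, Matrix.mulVec_mulVec, h,
    Matrix.one_mulVec, complexIsotropic_dotProduct_self]

theorem realLength_ne_zero {w : Fin 2 ⊕ Fin n → ℂ} (hw : w ⬝ᵥ w = 0) (hw0 : w ≠ 0) :
    realLength (rePart w) ≠ 0 := by
  intro h
  have h1 := realLength_mul_self (star_rePart w)
  rw [h, mul_zero] at h1
  have h2 := eq_zero_of_star_eq (star_rePart w) h1
  have h3 := eq_zero_of_star_eq (star_imPart w) ((isotropic_parts hw).1.trans h1)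
  apply hw0
  rw [← rePart_add_imPart w, h2, h3, smul_zero, add_zero]

/-- If `w = x + iy` is the moved isotropic vector, `x` and `y` are orthogonal of the same length
`r`. A real orthogonal matrix of determinant one taking the first two basis vectors to `r⁻¹ • x` and
`r⁻¹ • y` maps the standard line to the line of `w`. -/
theorem transitive_SOComplex (hn : 0 < n) (g : SOComplex n) :
    ∃ k ∈ maxCompact (SOComplex n), k⁻¹ * g ∈ complexQuadricParabolic n := by
  set w := mat g *ᵥ complexIsotropic n Complex.I with hw
  have hiso : w ⬝ᵥ w = 0 := SOComplex_isotropic g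
  have hw0 : w ≠ 0 := mat_mulVec_ne_zero g (complexIsotropic_ne_zero _)
  obtain ⟨h1, h2⟩ := isotropic_parts hiso
  set x := rePart w with hx
  set y := imPart w with hy
  set r := realLength x with hr
  have hr0 : r ≠ 0 := realLength_ne_zero hiso hw0
  have hxx : x ⬝ᵥ x = r * r := realLength_mul_self (star_rePart w)
  have hsx : star x = x := star_rePart w
  have hsy : star y = y := star_imPart w
  have hsr : star r = r := star_realLength _
  -- A third basis vector, orthogonal to the first two, for the degenerate case of
  -- `exists_rotation`.
  set b : Fin 2 ⊕ Fin n → ℂ := Pi.single (Sum.inr ⟨0, hn⟩) 1 with hb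
  have hbb : b ⬝ᵥ b = 1 := by simp [hb]
  have hbi : ∀ i, b ⬝ᵥ baseVec n i = 0 := by intro i; simp [hb, baseVec]
  have hsb : star b = b := by
    ext j
    by_cases h : j = Sum.inr ⟨0, hn⟩
    · subst h; simp [hb]
    · simp [hb, h]
  have hs1 : ∀ i, ∀ z : Fin 2 ⊕ Fin n → ℂ, star z = z →
      star (r • baseVec n i + z) = r • baseVec n i + z := by
    intro i z hz
    rw [star_add, star_smul, star_baseVec, hz, hsr]
  obtain ⟨U, hU, hU0, hUx⟩ := exists_rotation (baseVec_dotProduct_self 0) hbb (hbi 0) hr0 hxx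
    (eq_zero_of_star_eq (hs1 0 x hsx))
  have hsU : star U = U := by
    rcases hU with rfl | rfl
    · exact hs1 0 x hsx
    · exact hsb
  have e0 : baseVec n 0 ⬝ᵥ baseVec n 0 ≠ 0 := by rw [baseVec_dotProduct_self]; exact one_ne_zero
  -- The pullback of `y` by the first rotation. It stays orthogonal to the first basis vector, so
  -- the second rotation can be taken to fix that vector.
  set y₁ := refl (baseVec n 0) *ᵥ (refl U *ᵥ y) with hy1
  have hyy : y₁ ⬝ᵥ y₁ = r * r := by
    rw [hy1, refl_mulVec_dotProduct, refl_mulVec_refl e0, refl_mulVec_dotProduct,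
      refl_mulVec_refl hU0, h1, hxx]
  have hye : y₁ ⬝ᵥ baseVec n 0 = 0 := by
    rw [hy1, refl_mulVec_dotProduct, refl_mulVec_dotProduct, hUx, dotProduct_smul, h2, smul_zero]
  have hsy1 : star y₁ = y₁ := by
    have hstar : ∀ u z : Fin 2 ⊕ Fin n → ℂ, star u = u → star z = z →
        star (refl u *ᵥ z) = refl u *ᵥ z := by
      intro u z hu hz
      rw [Matrix.star_mulVec, hz, ← Matrix.star_eq_conjTranspose, star_refl hu,
        ← Matrix.mulVec_transpose, refl_transpose]
    exact hstar _ _ (star_baseVec 0) (hstar _ _ hsU hsy)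
  obtain ⟨V, hV, hV0, hVx⟩ := exists_rotation (baseVec_dotProduct_self 1) hbb (hbi 1) hr0 hyy
    (eq_zero_of_star_eq (hs1 1 y₁ hsy1))
  have hsV : star V = V := by
    rcases hV with rfl | rfl
    · exact hs1 1 y₁ hsy1
    · exact hsb
  have hVe : V ⬝ᵥ baseVec n 0 = 0 := by
    rcases hV with rfl | rfl
    · rw [add_dotProduct, smul_dotProduct, baseVec_one_zero, hye, smul_zero, add_zero]
    · exact hbi 0
  obtain ⟨k, hk, -, hkw⟩ := doubleRotation_baseVec hsU hsV hU0 hV0 hVe hUx hVx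
  refine ⟨k, hk, inv_mul_mem_stab_line (complexIsotropic_ne_zero _) (c := r) ?_⟩
  rw [hkw, rePart_add_imPart, smul_smul, mul_inv_cancel₀ hr0, one_smul]

end ComplexQuadric

section LocalSection

attribute [local instance] Matrix.normedAddCommGroup Matrix.normedSpace

variable {n : ℕ}

theorem contDiffAt_star_vec {ι E : Type*} [Fintype ι] [NormedAddCommGroup E] [NormedSpace ℝ E]
    {f : E → ι → ℂ} {x : E} (hf : ContDiffAt ℝ ∞ f x) : ContDiffAt ℝ ∞ (fun y => star (f y)) x :=
  contDiffAt_pi.2 fun i => Complex.conjCLE.contDiff.contDiffAt.comp x (contDiffAt_pi.1 hf i)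

/-- At the identity the reflecting vectors are twice the first two basis vectors, so nearby the
degenerate cases do not occur and the formulas for the double rotation are smooth in the matrix. -/
theorem exists_isLocalSection_complexQuadric (n : ℕ) :
    ∃ κ, IsLocalSection (SOComplex n) (complexQuadricParabolic n) κ := by
  have e0 : baseVec n 0 ⬝ᵥ baseVec n 0 ≠ 0 := by rw [baseVec_dotProduct_self]; exact one_ne_zero
  let w : Matrix (Fin 2 ⊕ Fin n) (Fin 2 ⊕ Fin n) ℂ → Fin 2 ⊕ Fin n → ℂ :=
    fun M => M *ᵥ complexIsotropic n Complex.I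
  let x := fun M => rePart (w M)
  let y := fun M => imPart (w M)
  let r := fun M => realLength (x M)
  let U := fun M => r M • baseVec n 0 + x M
  let y₁ := fun M => refl (baseVec n 0) *ᵥ (refl (U M) *ᵥ y M)
  let V := fun M => r M • baseVec n 1 + y₁ M
  have hx1 : x 1 = baseVec n 0 := by
    change rePart (1 *ᵥ complexIsotropic n Complex.I) = _
    rw [Matrix.one_mulVec, rePart_complexIsotropic]
  have hy1 : y 1 = baseVec n 1 := by
    change imPart (1 *ᵥ complexIsotropic n Complex.I) = _
    rw [Matrix.one_mulVec, imPart_complexIsotropic]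
  have hr1 : r 1 = 1 := by
    change realLength (x 1) = 1
    rw [hx1, realLength, baseVec_dotProduct_self]
    simp
  have hU1 : U 1 = (2 : ℂ) • baseVec n 0 := by
    change r 1 • baseVec n 0 + x 1 = _
    rw [hr1, hx1, one_smul, two_smul]
  have hy₁1 : y₁ 1 = baseVec n 1 := by
    change refl (baseVec n 0) *ᵥ (refl (U 1) *ᵥ y 1) = _
    have h : baseVec n 0 ⬝ᵥ baseVec n 1 = 0 := by rw [dotProduct_comm, baseVec_one_zero]
    have h' : refl ((2 : ℂ) • baseVec n 0) *ᵥ baseVec n 1 = baseVec n 1 :=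
      refl_mulVec_of_orthogonal (by rw [smul_dotProduct, h, smul_zero])
    rw [hU1, hy1, h', refl_mulVec_of_orthogonal h]
  have hV1 : V 1 = (2 : ℂ) • baseVec n 1 := by
    change r 1 • baseVec n 1 + y₁ 1 = _
    rw [hr1, hy₁1, one_smul, two_smul]
  have hUU : U 1 ⬝ᵥ U 1 ≠ 0 := by
    rw [hU1, smul_dotProduct, dotProduct_smul, baseVec_dotProduct_self]; norm_num
  have hVV : V 1 ⬝ᵥ V 1 ≠ 0 := by
    rw [hV1, smul_dotProduct, dotProduct_smul, baseVec_dotProduct_self]; norm_num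
  have hws : ContDiffAt ℝ ∞ w 1 := contDiffAt_mulVec contDiffAt_id contDiffAt_const
  have hxs : ContDiffAt ℝ ∞ x 1 := (hws.add (contDiffAt_star_vec hws)).const_smul (2⁻¹ : ℂ)
  have hys : ContDiffAt ℝ ∞ y 1 :=
    (hws.sub (contDiffAt_star_vec hws)).const_smul (2⁻¹ * -Complex.I : ℂ)
  have hrs : ContDiffAt ℝ ∞ r 1 := by
    have h1 : ContDiffAt ℝ ∞ (fun M => (x M ⬝ᵥ x M).re) 1 :=
      Complex.reCLM.contDiff.contDiffAt.comp _ (contDiffAt_dotProduct hxs hxs)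
    have h2 := h1.sqrt (by rw [hx1, baseVec_dotProduct_self]; simp)
    exact Complex.ofRealCLM.contDiff.contDiffAt.comp _ h2
  have hUs : ContDiffAt ℝ ∞ U 1 := (hrs.smul contDiffAt_const).add hxs
  have hy₁s : ContDiffAt ℝ ∞ y₁ 1 :=
    contDiffAt_mulVec contDiffAt_const (contDiffAt_mulVec (contDiffAt_refl hUs hUU) hys)
  have hVs : ContDiffAt ℝ ∞ V 1 := (hrs.smul contDiffAt_const).add hy₁s
  have hUev : ∀ᶠ M in 𝓝 1, U M ⬝ᵥ U M ≠ 0 :=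
    (contDiffAt_dotProduct hUs hUs).continuousAt.eventually_ne hUU
  have hVev : ∀ᶠ M in 𝓝 1, V M ⬝ᵥ V M ≠ 0 :=
    (contDiffAt_dotProduct hVs hVs).continuousAt.eventually_ne hVV
  refine ⟨fun M => doubleRotation (baseVec n 0) (baseVec n 1) (U M) (V M), ?_, ?_⟩
  · exact ((contDiffAt_refl hUs hUU).matrix_mul contDiffAt_const).matrix_mul
      ((contDiffAt_refl hVs hVV).matrix_mul contDiffAt_const)
  · filter_upwards [hUev, hVev] with M hU0 hV0 g hg
    have hiso : w M ⬝ᵥ w M = 0 := by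
      rw [← hg]; exact SOComplex_isotropic g
    have hw0 : w M ≠ 0 := by
      rw [← hg]; exact mat_mulVec_ne_zero g (complexIsotropic_ne_zero _)
    obtain ⟨h1, h2⟩ := isotropic_parts hiso
    have hr0 : r M ≠ 0 := realLength_ne_zero hiso hw0
    have hxx : x M ⬝ᵥ x M = r M * r M := realLength_mul_self (star_rePart _)
    have hsx : star (x M) = x M := star_rePart _
    have hsy : star (y M) = y M := star_imPart _
    have hsr : star (r M) = r M := star_realLength _
    have hUx := refl_mulVec_refl_mulVec (baseVec_dotProduct_self 0) hxx hU0
    have hsU : star (U M) = U M := by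
      change star (r M • baseVec n 0 + x M) = r M • baseVec n 0 + x M
      rw [star_add, star_smul, star_baseVec, hsx, hsr]
    have hyy : y₁ M ⬝ᵥ y₁ M = r M * r M := by
      change (refl (baseVec n 0) *ᵥ (refl (U M) *ᵥ y M)) ⬝ᵥ _ = _
      rw [refl_mulVec_dotProduct, refl_mulVec_refl e0, refl_mulVec_dotProduct,
        refl_mulVec_refl hU0, ← hxx]
      exact h1
    have hye : y₁ M ⬝ᵥ baseVec n 0 = 0 := by
      change (refl (baseVec n 0) *ᵥ (refl (U M) *ᵥ y M)) ⬝ᵥ _ = _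
      rw [refl_mulVec_dotProduct, refl_mulVec_dotProduct, hUx, dotProduct_smul]
      exact (congrArg _ h2).trans (smul_zero _)
    have hsy1 : star (y₁ M) = y₁ M := by
      have hstar : ∀ u z : Fin 2 ⊕ Fin n → ℂ, star u = u → star z = z →
          star (refl u *ᵥ z) = refl u *ᵥ z := by
        intro u z hu hz
        rw [Matrix.star_mulVec, hz, ← Matrix.star_eq_conjTranspose, star_refl hu,
          ← Matrix.mulVec_transpose, refl_transpose]
      exact hstar _ _ (star_baseVec 0) (hstar _ _ hsU hsy)
    have hVx := refl_mulVec_refl_mulVec (baseVec_dotProduct_self 1) hyy hV0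
    have hsV : star (V M) = V M := by
      change star (r M • baseVec n 1 + y₁ M) = r M • baseVec n 1 + y₁ M
      rw [star_add, star_smul, star_baseVec, hsy1, hsr]
    have hVe : V M ⬝ᵥ baseVec n 0 = 0 := by
      change (r M • baseVec n 1 + y₁ M) ⬝ᵥ _ = _
      rw [add_dotProduct, smul_dotProduct, baseVec_one_zero, hye, smul_zero, add_zero]
    obtain ⟨k, hk, hkm, hkw⟩ := doubleRotation_baseVec hsU hsV hU0 hV0 hVe hUx hVx
    refine ⟨k, hk, hkm, inv_mul_mem_stab_line (complexIsotropic_ne_zero _) (c := r M) ?_⟩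
    rw [hkw, hg]
    change w M = r M • (r M)⁻¹ • (rePart (w M) + Complex.I • imPart (w M))
    rw [rePart_add_imPart, smul_smul, mul_inv_cancel₀ hr0, one_smul]

end LocalSection

/-! ### Elements commuting with the involution, and the complex quadric. -/

section Commute

variable {ι : Type*} [Fintype ι] [DecidableEq ι] {F : Type*} [Field F]

/-- Multiplying by `k` on the left scales `v` by `c`. On the right it applies `kᵀ = k⁻¹` to `w`,
which scales it by `d⁻¹ = c`. -/
theorem mul_vecMulVec_comm {k : Matrix ι ι F} (hk : kᵀ * k = 1) {v w : ι → F} {c d : F}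
    (hv : k *ᵥ v = c • v) (hw : k *ᵥ w = d • w) (hcd : c * d = 1) :
    k * Matrix.vecMulVec v w = Matrix.vecMulVec v w * k := by
  have h1 : kᵀ *ᵥ w = c • w := by
    have h2 : kᵀ *ᵥ (k *ᵥ w) = w := by rw [Matrix.mulVec_mulVec, hk, Matrix.one_mulVec]
    rw [hw, Matrix.mulVec_smul] at h2
    calc kᵀ *ᵥ w = (c * d) • kᵀ *ᵥ w := by rw [hcd, one_smul]
      _ = c • w := by rw [mul_smul, h2]
  rw [Matrix.mul_vecMulVec, Matrix.vecMulVec_mul, hv, ← Matrix.mulVec_transpose, h1,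
    Matrix.smul_vecMulVec, Matrix.vecMulVec_smul]

theorem dotProduct_mulVec_of_orthogonal {k : Matrix ι ι F} (hk : kᵀ * k = 1) (v w : ι → F) :
    (k *ᵥ v) ⬝ᵥ (k *ᵥ w) = v ⬝ᵥ w := by
  rw [Matrix.dotProduct_mulVec, ← Matrix.mulVec_transpose, Matrix.mulVec_mulVec, hk,
    Matrix.one_mulVec]

theorem isClosed_bilinGroup {F : Type*} [NormedField F] (S : Matrix ι ι F) :
    IsClosed (bilinGroup S : Set (GLin ι F)) := by
  have h : Continuous fun g : GLin ι F => (g : Matrix ι ι F) := Units.continuous_val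
  exact isClosed_eq ((h.matrix_transpose.matrix_mul continuous_const).matrix_mul h)
    continuous_const

end Commute

section ComplexQuadric

variable {n : ℕ}

theorem transpose_mul_self_SOComplex (g : SOComplex n) : (mat g)ᵀ * mat g = 1 := by
  have h : (mat g)ᵀ * 1 * mat g = 1 := g.2.1
  rwa [mul_one] at h

theorem star_mat_SOComplex {k : SOComplex n} (hk : k ∈ maxCompact (SOComplex n)) :
    star (mat k) = (mat k)ᵀ :=
  left_inv_eq_right_inv (mem_maxCompact.1 hk)
    (mul_eq_one_comm.1 (transpose_mul_self_SOComplex k))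

theorem star_mulVec_SOComplex {k : SOComplex n} (hk : k ∈ maxCompact (SOComplex n))
    (w : Fin 2 ⊕ Fin n → ℂ) : star (mat k *ᵥ w) = mat k *ᵥ star w := by
  rw [Matrix.star_mulVec, ← Matrix.star_eq_conjTranspose, star_mat_SOComplex hk,
    Matrix.vecMul_transpose]

/-- A unitary complex orthogonal matrix is real, so it also preserves the conjugate line, with the
conjugate eigenvalue. The pairing of the two lines is nonzero and invariant, so the eigenvalues are
inverse. -/
theorem exists_of_mem_complexQuadricParabolic {k : SOComplex n} (hk : k ∈ maxCompact (SOComplex n))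
    (hP : k ∈ complexQuadricParabolic n) :
    ∃ c d : ℂ, c * d = 1 ∧ mat k *ᵥ complexIsotropic n Complex.I = c • complexIsotropic n Complex.I ∧
      mat k *ᵥ complexIsotropic n (-Complex.I) = d • complexIsotropic n (-Complex.I) := by
  obtain ⟨c, hc⟩ := exists_of_mem_stab_line hP
  have hd : mat k *ᵥ complexIsotropic n (-Complex.I) = star c • complexIsotropic n (-Complex.I) := by
    rw [← star_complexIsotropic, ← star_mulVec_SOComplex hk, hc, star_smul]
  refine ⟨c, star c, ?_, hc, hd⟩
  have h1 := dotProduct_mulVec_of_orthogonal (transpose_mul_self_SOComplex k)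
    (complexIsotropic n Complex.I) (complexIsotropic n (-Complex.I))
  have h2 : complexIsotropic n Complex.I ⬝ᵥ complexIsotropic n (-Complex.I) = 2 := by
    simp only [complexIsotropic_eq, add_dotProduct, dotProduct_add, smul_dotProduct,
      dotProduct_smul, smul_eq_mul, baseVec_dotProduct_self,
      dotProduct_comm (baseVec n 0) (baseVec n 1), baseVec_one_zero]
    linear_combination -Complex.I_mul_I
  rw [hc, hd, smul_dotProduct, dotProduct_smul, h2, smul_eq_mul, smul_eq_mul, ← mul_assoc] at h1
  exact mul_right_cancel₀ two_ne_zero (h1.trans (one_mul 2).symm)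

/-- Writing the projection in isotropic vectors makes `mul_vecMulVec_comm` applicable to elements
that scale both lines. -/
theorem two_smul_blockProj :
    (2 : ℂ) • blockProj 2 n ℂ =
      Matrix.vecMulVec (complexIsotropic n Complex.I) (complexIsotropic n (-Complex.I)) +
      Matrix.vecMulVec (complexIsotropic n (-Complex.I)) (complexIsotropic n Complex.I) := by
  ext i j
  rcases i with i | i <;> rcases j with j | j
  · fin_cases i <;> fin_cases j <;>
      simp [blockProj, complexIsotropic, Matrix.vecMulVec_apply] <;> norm_num
  · simp [blockProj, complexIsotropic, Matrix.vecMulVec_apply]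
  · simp [blockProj, complexIsotropic, Matrix.vecMulVec_apply]
  · simp [blockProj, complexIsotropic, Matrix.vecMulVec_apply]

theorem mem_complexQuadricParabolic_of_commute {k : SOComplex n}
    (h : mat k * blockProj 2 n ℂ = blockProj 2 n ℂ * mat k) :
    ((mat k).toBlocks₁₁.det = 1 ∨ (mat k).toBlocks₁₁.det = -1) ∧
    ((mat k).toBlocks₁₁.det = 1 → k ∈ complexQuadricParabolic n) := by
  have h0 : (mat k).toBlocks₂₁ = 0 := by
    rw [← mul_blockProj_eq_iff, ← h, mul_assoc, blockProj_mul_self]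
  set A := (mat k).toBlocks₁₁ with hA
  have hk : mat k = Matrix.fromBlocks A (mat k).toBlocks₁₂ 0 (mat k).toBlocks₂₂ := by
    rw [← h0, Matrix.fromBlocks_toBlocks]
  have h1 := transpose_mul_self_SOComplex k
  rw [hk, Matrix.fromBlocks_transpose, Matrix.fromBlocks_multiply, ← Matrix.fromBlocks_one,
    Matrix.fromBlocks_inj] at h1
  have h2 : Aᵀ * A = 1 := by simpa using h1.1
  have h3 : A.det * A.det = 1 := by
    rw [← Matrix.det_one (n := Fin 2) (R := ℂ), ← h2, Matrix.det_mul, Matrix.det_transpose]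
  refine ⟨mul_self_eq_one_iff.1 h3, fun hd => ?_⟩
  -- An orthogonal two by two matrix of determinant one has rows `(a, b)` and `(-b, a)`, so `(1, i)`
  -- is an eigenvector with eigenvalue `a + bi`.
  have h4 : Aᵀ = A.adjugate :=
    left_inv_eq_right_inv h2 (by rw [Matrix.mul_adjugate, hd, one_smul])
  rw [Matrix.adjugate_fin_two] at h4
  have h5 : A 0 0 = A 1 1 := congrFun (congrFun h4 0) 0
  have h6 : A 1 0 = -A 0 1 := congrFun (congrFun h4 0) 1
  refine mem_stab_line (complexIsotropic_ne_zero _) (c := A 0 0 + A 0 1 * Complex.I) ?_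
  rw [hk, complexIsotropic, Matrix.fromBlocks_mulVec]
  ext i
  rcases i with i | i
  · fin_cases i
    · simp
    · simp
      rw [h6, ← h5]
      linear_combination (-(A 0 1)) * Complex.I_mul_I
  · simp

/-- The fixed group of the block reflection consists of the block diagonal elements of `K`. The
determinant of the two by two block is the sign that separates those preserving the isotropic line
from those exchanging it with its conjugate. -/
theorem isCompactSymmetricRealization_complexQuadric (hn : 0 < n) :
    IsCompactSymmetricRealization (SOComplex n) (complexQuadricParabolic n)
      (complexQuadricLevi n) := by
  have hU : IsCompact (unitarySet (Fin 2 ⊕ Fin n) ℂ) := isCompact_unitarySet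
  obtain ⟨κ, hκ⟩ := exists_isLocalSection_complexQuadric n
  have hs : (blockRefl 2 n ℂ).val * (blockRefl 2 n ℂ).val = 1 := by
    rw [← Units.val_mul, blockRefl_mul_self, Units.val_one]
  refine ⟨isCompact_maxCompact hU ((isClosed_bilinGroup 1).inter isClosed_detOne),
    isPretransitive_maxCompact _ _ (transitive_SOComplex hn), ?_, ?_,
    exists_homeomorph_quotient _ _ (transitive_SOComplex hn) hκ⟩
  · ext k
    constructor
    · rintro ⟨h1, h2⟩
      obtain ⟨c, d, -, -, h⟩ := exists_of_mem_complexQuadricParabolic h2 h1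
      exact ⟨⟨h1, mem_stab_line (complexIsotropic_ne_zero _) h⟩, h2⟩
    · rintro ⟨h1, h2⟩
      exact ⟨h1.1, h2⟩
  · refine isSymmetricSubgroup_of_conj _ _ (blockRefl 2 n ℂ) blockRefl_mul_self star_blockRefl
      ?_ ?_ (fun M => M.toBlocks₁₁.det) ?_ ?_ ?_ ?_
    · rintro g ⟨hg1, hg2⟩
      have h1 : blockRefl 2 n ℂ ∈ bilinGroup (1 : Matrix (Fin 2 ⊕ Fin n) (Fin 2 ⊕ Fin n) ℂ) := by
        change (blockRefl 2 n ℂ).valᵀ * 1 * (blockRefl 2 n ℂ).val = 1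
        have h2 : (blockRefl 2 n ℂ).valᵀ = (blockRefl 2 n ℂ).val := by
          rw [val_blockRefl, blockProj, two_mul]
          simp [Matrix.fromBlocks_transpose]
        rw [h2, mul_one, hs]
      refine ⟨mul_mem (mul_mem h1 hg1) h1, ?_⟩
      change ((blockRefl 2 n ℂ).val * g.val * (blockRefl 2 n ℂ).val).det = 1
      have hg' : g.val.det = 1 := hg2
      rw [Matrix.det_mul, Matrix.det_mul, hg', mul_one, ← Matrix.det_mul, hs, Matrix.det_one]
    · intro k hk hP
      obtain ⟨c, d, hcd, h1, h2⟩ := exists_of_mem_complexQuadricParabolic hk hP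
      have h3 := transpose_mul_self_SOComplex k
      rw [blockRefl_commute_iff]
      have h4 : mat k * ((2 : ℂ) • blockProj 2 n ℂ) = ((2 : ℂ) • blockProj 2 n ℂ) * mat k := by
        rw [two_smul_blockProj, mul_add, add_mul, mul_vecMulVec_comm h3 h1 h2 hcd,
          mul_vecMulVec_comm h3 h2 h1 ((mul_comm d c).trans hcd)]
      rw [Matrix.mul_smul, Matrix.smul_mul] at h4
      exact smul_right_injective _ (two_ne_zero' ℂ) h4
    · exact Continuous.matrix_det (continuous_id.matrix_submatrix Sum.inl Sum.inl)
    · rw [← Matrix.fromBlocks_one, Matrix.toBlocks_fromBlocks₁₁, Matrix.det_one]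
    · intro k _ h
      exact (mem_complexQuadricParabolic_of_commute ((blockRefl_commute_iff _).1 h)).1
    · intro k _ h
      exact (mem_complexQuadricParabolic_of_commute ((blockRefl_commute_iff _).1 h)).2

end ComplexQuadric

/-! ### Identity components of subgroups. -/

section IdentityComponent

variable {X : Type*} [TopologicalSpace X] [Group X] [IsTopologicalGroup X]

theorem subset_map_connectedComponentOfOne {H : Subgroup X} {s : Set X} (hs : IsPreconnected s)
    (h1 : (1 : X) ∈ s) (hsH : s ⊆ H) :
    s ⊆ (Subgroup.connectedComponentOfOne H).map H.subtype := by
  have h2 : ((↑) : H → X) '' (((↑) : H → X) ⁻¹' s) = s := by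
    exact (Subtype.image_preimage_coe (H : Set X) s).trans (Set.inter_eq_right.2 hsH)
  have h3 : IsPreconnected (((↑) : H → X) ⁻¹' s) :=
    Topology.IsInducing.subtypeVal.isPreconnected_image.1 (h2.symm ▸ hs)
  intro g hg
  exact ⟨⟨g, hsH hg⟩, h3.subset_connectedComponent (x := 1) h1 hg, rfl⟩

theorem map_connectedComponentOfOne_le (H : Subgroup X) :
    (Subgroup.connectedComponentOfOne H).map H.subtype ≤ H := by
  rintro _ ⟨h, -, rfl⟩
  exact h.2

theorem isPreconnected_map_connectedComponentOfOne (H : Subgroup X) :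
    IsPreconnected ((Subgroup.connectedComponentOfOne H).map H.subtype : Set X) := by
  rw [Subgroup.coe_map]
  exact (isPreconnected_connectedComponent (x := (1 : H))).image _ continuous_subtype_val.continuousOn

theorem isClosed_map_connectedComponentOfOne {H : Subgroup X} (hH : IsClosed (H : Set X)) :
    IsClosed ((Subgroup.connectedComponentOfOne H).map H.subtype : Set X) := by
  rw [Subgroup.coe_map]
  exact hH.isClosedEmbedding_subtypeVal.isClosedMap _ (isClosed_connectedComponent (x := (1 : H)))

/-- The involution `s` need not lie in the identity component: the conjugate of the component is
again connected, contains `1`, and stays in `H`. -/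
theorem mul_mul_mem_map_connectedComponentOfOne {H : Subgroup X} {s : X} (hs : s * s = 1)
    (hsH : s ∈ H) {g : X} (hg : g ∈ (Subgroup.connectedComponentOfOne H).map H.subtype) :
    s * g * s ∈ (Subgroup.connectedComponentOfOne H).map H.subtype := by
  have hc : Continuous fun g : X => s * g * s := by fun_prop
  refine subset_map_connectedComponentOfOne
    ((isPreconnected_map_connectedComponentOfOne H).image _ hc.continuousOn)
    ⟨1, one_mem _, by simp only [mul_one, hs]⟩ ?_ ⟨g, hg, rfl⟩
  rintro _ ⟨h, hh, rfl⟩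
  exact mul_mem (mul_mem hsH (map_connectedComponentOfOne_le H hh)) hsH

end IdentityComponent

section Continuity

attribute [local instance] Matrix.normedAddCommGroup Matrix.normedSpace

theorem continuousAt_refl {ι : Type*} [Fintype ι] [DecidableEq ι] {u : ι → ℝ} (h : u ≠ 0) :
    ContinuousAt (fun u : ι → ℝ => refl u) u :=
  (contDiffAt_refl contDiffAt_id fun h' => h (dotProduct_self_eq_zero.1 h')).continuousAt

end Continuity

/-! ### Positive and negative parts, and rotations in the identity component of the real group. -/

section RealQuadric

variable {p q : ℕ}

/-- The first standard basis vector of the positive definite block. -/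
noncomputable def firstVec (p q : ℕ) : Fin (p + 1) ⊕ Fin (q + 1) → ℝ := Pi.single (Sum.inl 0) 1

/-- The first standard basis vector of the negative definite block. -/
noncomputable def lastVec (p q : ℕ) : Fin (p + 1) ⊕ Fin (q + 1) → ℝ := Pi.single (Sum.inr 0) 1

theorem firstVec_dotProduct_self : firstVec p q ⬝ᵥ firstVec p q = 1 := by simp [firstVec]

theorem lastVec_dotProduct_self : lastVec p q ⬝ᵥ lastVec p q = 1 := by simp [lastVec]

theorem realIsotropic_eq (c : ℝ) : realIsotropic p q c = firstVec p q + c • lastVec p q := by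
  ext i
  rcases i with i | i <;> by_cases h : i = 0 <;>
    simp [realIsotropic, firstVec, lastVec, h]

theorem realIsotropic_ne_zero (c : ℝ) : realIsotropic p q c ≠ 0 := by
  intro h
  have := congrFun h (Sum.inl 0)
  simp [realIsotropic] at this

theorem formI_mul_self : formI p q ℝ * formI p q ℝ = 1 := by
  simp [formI, Matrix.fromBlocks_multiply]

theorem formI_transpose : (formI p q ℝ)ᵀ = formI p q ℝ := by
  simp [formI, Matrix.fromBlocks_transpose]

theorem formI_mulVec (w : Fin p ⊕ Fin q → ℝ) :
    formI p q ℝ *ᵥ w = Sum.elim (w ∘ Sum.inl) (-(w ∘ Sum.inr)) := by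
  rw [formI, Matrix.fromBlocks_mulVec]
  simp [Matrix.neg_mulVec]

theorem formI_mulVec_firstVec :
    formI (p + 1) (q + 1) ℝ *ᵥ firstVec p q = firstVec p q := by
  rw [formI_mulVec]
  ext i
  rcases i with i | i <;> simp [firstVec]

theorem formI_mulVec_lastVec :
    formI (p + 1) (q + 1) ℝ *ᵥ lastVec p q = -lastVec p q := by
  rw [formI_mulVec]
  ext i
  rcases i with i | i <;> simp [lastVec]

theorem formI_mulVec_formI_mulVec (w : Fin p ⊕ Fin q → ℝ) :
    formI p q ℝ *ᵥ (formI p q ℝ *ᵥ w) = w := by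
  rw [Matrix.mulVec_mulVec, formI_mul_self, Matrix.one_mulVec]

theorem formI_dotProduct (v w : Fin p ⊕ Fin q → ℝ) :
    v ⬝ᵥ (formI p q ℝ *ᵥ w) = (formI p q ℝ *ᵥ v) ⬝ᵥ w := by
  rw [Matrix.dotProduct_mulVec, ← Matrix.mulVec_transpose, formI_transpose]

theorem dotProduct_eq_zero_of_formI {v w : Fin p ⊕ Fin q → ℝ} (hv : formI p q ℝ *ᵥ v = v)
    (hw : formI p q ℝ *ᵥ w = -w) : w ⬝ᵥ v = 0 := by
  have h := formI_dotProduct w v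
  rw [hv, hw, neg_dotProduct] at h
  linarith

theorem lastVec_dotProduct_firstVec : lastVec p q ⬝ᵥ firstVec p q = 0 :=
  dotProduct_eq_zero_of_formI formI_mulVec_firstVec formI_mulVec_lastVec

/-- The projection of a vector to the subspace where the form is positive definite. -/
noncomputable def posPart (w : Fin p ⊕ Fin q → ℝ) : Fin p ⊕ Fin q → ℝ :=
  (2⁻¹ : ℝ) • (w + formI p q ℝ *ᵥ w)

/-- The projection of a vector to the subspace where the form is negative definite. -/
noncomputable def negPart (w : Fin p ⊕ Fin q → ℝ) : Fin p ⊕ Fin q → ℝ :=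
  (2⁻¹ : ℝ) • (w - formI p q ℝ *ᵥ w)

theorem posPart_add_negPart (w : Fin p ⊕ Fin q → ℝ) : posPart w + negPart w = w := by
  ext i
  simp only [posPart, negPart, Pi.add_apply, Pi.smul_apply, Pi.sub_apply, smul_eq_mul]
  ring

theorem formI_mulVec_posPart (w : Fin p ⊕ Fin q → ℝ) : formI p q ℝ *ᵥ posPart w = posPart w := by
  rw [posPart, Matrix.mulVec_smul, Matrix.mulVec_add, formI_mulVec_formI_mulVec, add_comm]

theorem formI_mulVec_negPart (w : Fin p ⊕ Fin q → ℝ) : formI p q ℝ *ᵥ negPart w = -negPart w := by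
  rw [negPart, Matrix.mulVec_smul, Matrix.mulVec_sub, formI_mulVec_formI_mulVec, ← smul_neg, neg_sub]

theorem negPart_dotProduct_self {w : Fin p ⊕ Fin q → ℝ} (h : w ⬝ᵥ (formI p q ℝ *ᵥ w) = 0) :
    negPart w ⬝ᵥ negPart w = posPart w ⬝ᵥ posPart w := by
  have h1 := dotProduct_eq_zero_of_formI (formI_mulVec_posPart w) (formI_mulVec_negPart w)
  have h2 : formI p q ℝ *ᵥ w = posPart w - negPart w := by
    conv_lhs => rw [← posPart_add_negPart w]
    rw [Matrix.mulVec_add, formI_mulVec_posPart, formI_mulVec_negPart, sub_eq_add_neg]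
  rw [h2] at h
  nth_rewrite 1 [← posPart_add_negPart w] at h
  rw [add_dotProduct, dotProduct_sub, dotProduct_sub, dotProduct_comm (posPart w) (negPart w),
    h1] at h
  linarith

theorem posPart_realIsotropic : posPart (realIsotropic p q 1) = firstVec p q := by
  rw [posPart, realIsotropic_eq, one_smul, Matrix.mulVec_add, formI_mulVec_firstVec,
    formI_mulVec_lastVec]
  ext i
  simp
  ring

theorem negPart_realIsotropic : negPart (realIsotropic p q 1) = lastVec p q := by
  rw [negPart, realIsotropic_eq, one_smul, Matrix.mulVec_add, formI_mulVec_firstVec,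
    formI_mulVec_lastVec]
  ext i
  simp
  ring

theorem refl_mul_formI {u : Fin p ⊕ Fin q → ℝ}
    (hu : formI p q ℝ *ᵥ u = u ∨ formI p q ℝ *ᵥ u = -u) :
    formI p q ℝ * refl u = refl u * formI p q ℝ := by
  obtain ⟨c, hc, hcu⟩ : ∃ c : ℝ, c * c = 1 ∧ formI p q ℝ *ᵥ u = c • u := by
    rcases hu with h | h
    · exact ⟨1, one_mul 1, by rw [h, one_smul]⟩
    · exact ⟨-1, by norm_num, by rw [h, neg_one_smul]⟩
  have h := mul_vecMulVec_comm (by rw [formI_transpose, formI_mul_self]) hcu hcu hc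
  rw [refl, mul_sub, sub_mul, mul_one, one_mul, Matrix.mul_smul, Matrix.smul_mul, h]

/-- Products of two reflections in the positive definite and in the negative definite subspace
preserve the form and have determinant one. -/
theorem exists_mem_bilinGroup_formI {U V : Fin (p + 1) ⊕ Fin (q + 1) → ℝ}
    (hU : formI _ _ ℝ *ᵥ U = U) (hV : formI _ _ ℝ *ᵥ V = -V) (hU0 : U ≠ 0) (hV0 : V ≠ 0) :
    ∃ k : GLin (Fin (p + 1) ⊕ Fin (q + 1)) ℝ,
      k.val = doubleRotation (firstVec p q) (lastVec p q) U V ∧ k⁻¹.val = k.valᵀ ∧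
      k ∈ (bilinGroup (formI (p + 1) (q + 1) ℝ) ⊓ detOne _ ℝ : Subgroup _) := by
  have hUU : U ⬝ᵥ U ≠ 0 := fun h => hU0 (dotProduct_self_eq_zero.1 h)
  have hVV : V ⬝ᵥ V ≠ 0 := fun h => hV0 (dotProduct_self_eq_zero.1 h)
  have h1 := doubleRotation_transpose_mul_self (firstVec_dotProduct_self (p := p) (q := q))
    lastVec_dotProduct_self hUU hVV
  have hc : formI _ _ ℝ * doubleRotation (firstVec p q) (lastVec p q) U V =
      doubleRotation (firstVec p q) (lastVec p q) U V * formI _ _ ℝ := by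
    have c1 := refl_mul_formI (Or.inl hU)
    have c2 := refl_mul_formI (Or.inl (formI_mulVec_firstVec (p := p) (q := q)))
    have c3 := refl_mul_formI (Or.inr hV)
    have c4 := refl_mul_formI (Or.inr (formI_mulVec_lastVec (p := p) (q := q)))
    have c1' : Commute _ _ := c1
    have c2' : Commute _ _ := c2
    have c3' : Commute _ _ := c3
    have c4' : Commute _ _ := c4
    exact (c1'.mul_right c2').mul_right (c3'.mul_right c4')
  refine ⟨⟨_, _, mul_eq_one_comm.1 h1, h1⟩, rfl, rfl, ?_,
    det_doubleRotation firstVec_dotProduct_self lastVec_dotProduct_self hUU hVV⟩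
  change (doubleRotation _ _ U V)ᵀ * _ * doubleRotation _ _ U V = _
  rw [mul_assoc, hc, ← mul_assoc, h1, one_mul]

theorem ne_zero_of_mem_segment {ι : Type*} [Fintype ι] {a u v : ι → ℝ} (ha : a ⬝ᵥ a = 1)
    (hu : u ≠ 0) (hua : 0 ≤ u ⬝ᵥ a) (hv : v ∈ segment ℝ a u) : v ≠ 0 := by
  obtain ⟨s, t, hs, ht, hst, rfl⟩ := hv
  rcases hs.eq_or_lt with rfl | hs
  · rw [zero_add] at hst
    rwa [hst, zero_smul, zero_add, one_smul]
  · intro h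
    have h1 : (s • a + t • u) ⬝ᵥ a = 0 := by rw [h, zero_dotProduct]
    rw [add_dotProduct, smul_dotProduct, smul_dotProduct, ha, smul_eq_mul, smul_eq_mul] at h1
    have := mul_nonneg ht hua
    linarith

theorem mulVec_eq_of_mem_segment {ι : Type*} [Fintype ι] {M : Matrix ι ι ℝ} {c : ℝ} {a u v : ι → ℝ}
    (ha : M *ᵥ a = c • a) (hu : M *ᵥ u = c • u) (hv : v ∈ segment ℝ a u) : M *ᵥ v = c • v := by
  obtain ⟨s, t, hs, ht, hst, rfl⟩ := hv
  rw [Matrix.mulVec_add, Matrix.mulVec_smul, Matrix.mulVec_smul, ha, hu, smul_add, smul_comm c s,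
    smul_comm c t]

/-- Let the reflecting vectors run through the segments from the basis vectors to `U` and `V`. At
the start the double rotation is `1`, because each reflection is squared, and the sign conditions
keep the segments away from `0`. -/
theorem exists_mem_SOIdComponent_of_nonneg {U V : Fin (p + 1) ⊕ Fin (q + 1) → ℝ}
    (hU : formI _ _ ℝ *ᵥ U = U) (hV : formI _ _ ℝ *ᵥ V = -V) (hU0 : U ≠ 0) (hV0 : V ≠ 0)
    (hUa : 0 ≤ U ⬝ᵥ firstVec p q) (hVb : 0 ≤ V ⬝ᵥ lastVec p q) :
    ∃ k ∈ SOIdComponent (p + 1) (q + 1),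
      k.val = doubleRotation (firstVec p q) (lastVec p q) U V := by
  set a := firstVec p q with ha
  set b := lastVec p q with hb
  have haa : a ⬝ᵥ a = 1 := firstVec_dotProduct_self
  have hbb : b ⬝ᵥ b = 1 := lastVec_dotProduct_self
  let A : Set ((Fin (p + 1) ⊕ Fin (q + 1) → ℝ) × (Fin (p + 1) ⊕ Fin (q + 1) → ℝ)) :=
    segment ℝ a U ×ˢ segment ℝ b V
  have hA1 : ∀ x : A, x.1.1 ≠ 0 := fun x => ne_zero_of_mem_segment haa hU0 hUa x.2.1
  have hA2 : ∀ x : A, x.1.2 ≠ 0 := fun x => ne_zero_of_mem_segment hbb hV0 hVb x.2.2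
  have hex : ∀ x : A, ∃ k : GLin (Fin (p + 1) ⊕ Fin (q + 1)) ℝ,
      k.val = doubleRotation a b x.1.1 x.1.2 ∧ k⁻¹.val = k.valᵀ ∧
      k ∈ (bilinGroup (formI (p + 1) (q + 1) ℝ) ⊓ detOne _ ℝ : Subgroup _) := by
    intro x
    refine exists_mem_bilinGroup_formI ?_ ?_ (hA1 x) (hA2 x)
    · have := mulVec_eq_of_mem_segment (c := 1) (by rw [ha, formI_mulVec_firstVec, one_smul])
        (by rw [hU, one_smul]) x.2.1
      rwa [one_smul] at this
    · have := mulVec_eq_of_mem_segment (c := -1) (by rw [hb, formI_mulVec_lastVec, neg_one_smul])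
        (by rw [hV, neg_one_smul]) x.2.2
      rwa [neg_one_smul] at this
  choose γ hγ1 hγ2 hγ3 using hex
  have hc : Continuous fun x : A => (γ x).val := by
    simp only [hγ1, doubleRotation]
    have h1 : Continuous fun x : A => refl x.1.1 := continuous_iff_continuousAt.2 fun x =>
      (continuousAt_refl (hA1 x)).comp (f := fun x : A => x.1.1) (by fun_prop)
    have h2 : Continuous fun x : A => refl x.1.2 := continuous_iff_continuousAt.2 fun x =>
      (continuousAt_refl (hA2 x)).comp (f := fun x : A => x.1.2) (by fun_prop)
    exact (h1.matrix_mul continuous_const).matrix_mul (h2.matrix_mul continuous_const)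
  have hγ : Continuous γ := by
    refine Units.continuous_iff.2 ⟨hc, ?_⟩
    simp only [hγ2]
    exact hc.matrix_transpose
  have hconn : IsPreconnected (Set.range γ) := by
    have : PreconnectedSpace A := Subtype.preconnectedSpace
      ((convex_segment a U).isPreconnected.prod (convex_segment b V).isPreconnected)
    exact isPreconnected_range hγ
  have hmem : ∀ x, γ x ∈ SOIdComponent (p + 1) (q + 1) := by
    intro x
    refine subset_map_connectedComponentOfOne hconn ?_ ?_ ⟨x, rfl⟩
    · refine ⟨⟨(a, b), left_mem_segment ℝ a U, left_mem_segment ℝ b V⟩, Units.ext ?_⟩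
      rw [hγ1, Units.val_one, doubleRotation, refl_mul_self, refl_mul_self, mul_one]
      · rw [hbb]; exact one_ne_zero
      · rw [haa]; exact one_ne_zero
    · rintro _ ⟨y, rfl⟩
      exact hγ3 y
  exact ⟨_, hmem ⟨(U, V), right_mem_segment ℝ a U, right_mem_segment ℝ b V⟩, hγ1 _⟩

/-- A reflection does not change when its vector is negated, so the sign conditions of
`exists_mem_SOIdComponent_of_nonneg` can always be met. -/
theorem exists_mem_maxCompact_SOIdComponent {U V : Fin (p + 1) ⊕ Fin (q + 1) → ℝ}
    (hU : formI _ _ ℝ *ᵥ U = U) (hV : formI _ _ ℝ *ᵥ V = -V) (hU0 : U ≠ 0) (hV0 : V ≠ 0) :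
    ∃ k ∈ maxCompact (SOIdComponent (p + 1) (q + 1)),
      mat k = doubleRotation (firstVec p q) (lastVec p q) U V := by
  obtain ⟨U', hU', hU0', hUa, hUr⟩ : ∃ U', formI _ _ ℝ *ᵥ U' = U' ∧ U' ≠ 0 ∧
      0 ≤ U' ⬝ᵥ firstVec p q ∧ refl U' = refl U := by
    rcases le_total 0 (U ⬝ᵥ firstVec p q) with h | h
    · exact ⟨U, hU, hU0, h, rfl⟩
    · exact ⟨-U, by rw [Matrix.mulVec_neg, hU], neg_ne_zero.2 hU0,
        by rw [neg_dotProduct]; linarith, refl_neg U⟩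
  obtain ⟨V', hV', hV0', hVb, hVr⟩ : ∃ V', formI _ _ ℝ *ᵥ V' = -V' ∧ V' ≠ 0 ∧
      0 ≤ V' ⬝ᵥ lastVec p q ∧ refl V' = refl V := by
    rcases le_total 0 (V ⬝ᵥ lastVec p q) with h | h
    · exact ⟨V, hV, hV0, h, rfl⟩
    · exact ⟨-V, by rw [Matrix.mulVec_neg, hV], neg_ne_zero.2 hV0,
        by rw [neg_dotProduct]; linarith, refl_neg V⟩
  obtain ⟨k, hk, hkm⟩ := exists_mem_SOIdComponent_of_nonneg hU' hV' hU0' hV0' hUa hVb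
  have h1 : k.val = doubleRotation (firstVec p q) (lastVec p q) U V := by
    rw [hkm, doubleRotation, doubleRotation, hUr, hVr]
  refine ⟨⟨k, hk⟩, mem_maxCompact.2 ?_, h1⟩
  change star k.val * k.val = 1
  rw [h1, star_doubleRotation (star_trivial _) (star_trivial _) (star_trivial _) (star_trivial _)]
  exact doubleRotation_transpose_mul_self firstVec_dotProduct_self lastVec_dotProduct_self
    (fun h => hU0 (dotProduct_self_eq_zero.1 h)) (fun h => hV0 (dotProduct_self_eq_zero.1 h))

end RealQuadric

/-! ### Transitivity, smooth section and symmetric subgroup for the real quadric. -/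

section RealQuadric

variable {p q : ℕ}

theorem exists_refl_of_pos {p : ℕ} (hp : 0 < p) {ι : Type*} [Fintype ι] [DecidableEq ι]
    {f : Fin (p + 1) → ι} (hf : Function.Injective f) {r : ℝ} (hr : r ≠ 0) {x : ι → ℝ}
    (hx : x ⬝ᵥ x = r * r) :
    ∃ u, (u = r • Pi.single (f 0) 1 + x ∨ ∃ i, u = Pi.single (f i) 1) ∧ u ≠ 0 ∧
      refl u *ᵥ (refl (Pi.single (f 0) 1) *ᵥ Pi.single (f 0) 1) = r⁻¹ • x := by
  let i : Fin (p + 1) := ⟨1, by omega⟩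
  have hi : f i ≠ f 0 := fun h => absurd (congrArg Fin.val (hf h)) one_ne_zero
  obtain ⟨u, hu, hu0, hux⟩ := exists_rotation (e := Pi.single (f 0) (1 : ℝ))
    (g := Pi.single (f i) (1 : ℝ)) (by simp) (by simp) (by simp [hi.symm]) hr hx
    dotProduct_self_eq_zero.1
  refine ⟨u, hu.imp_right fun h => ⟨i, h⟩, ?_, hux⟩
  rintro rfl
  exact hu0 (zero_dotProduct _)

/-- A replacement for `exists_rotation` when the block has no second basis vector: `r • e + x` and
`-r • e + x` are not both zero, so a change of the sign of `r` avoids the degenerate case. -/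
theorem exists_refl_or_neg {ι : Type*} [Fintype ι] [DecidableEq ι] {e : ι → ℝ} (he : e ⬝ᵥ e = 1)
    {r : ℝ} (hr : r ≠ 0) {x : ι → ℝ} (hx : x ⬝ᵥ x = r * r) :
    ∃ s, s ≠ 0 ∧ s * s = r * r ∧ s • e + x ≠ 0 ∧ refl (s • e + x) *ᵥ (refl e *ᵥ e) = s⁻¹ • x := by
  by_cases h : r • e + x = 0
  · have h1 : -r • e + x ≠ 0 := by
      have he0 : e ≠ 0 := by rintro rfl; simp at he
      have h2 : x = -(r • e) := (neg_eq_of_add_eq_zero_right h).symm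
      rw [h2, neg_smul, ← two_smul ℝ]
      exact smul_ne_zero two_ne_zero (neg_ne_zero.2 (smul_ne_zero hr he0))
    exact ⟨-r, neg_ne_zero.2 hr, neg_mul_neg r r, h1, refl_mulVec_refl_mulVec he
      (by rw [hx, neg_mul_neg]) fun h' => h1 (dotProduct_self_eq_zero.1 h')⟩
  · exact ⟨r, hr, rfl, h, refl_mulVec_refl_mulVec he hx fun h' => h (dotProduct_self_eq_zero.1 h')⟩

theorem formI_mulVec_single_inl (i : Fin (p + 1)) :
    formI (p + 1) (q + 1) ℝ *ᵥ Pi.single (Sum.inl i) 1 = Pi.single (Sum.inl i) 1 := by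
  rw [formI_mulVec]
  ext j
  rcases j with j | j <;> simp [Pi.single_apply]

theorem formI_mulVec_single_inr (i : Fin (q + 1)) :
    formI (p + 1) (q + 1) ℝ *ᵥ Pi.single (Sum.inr i) 1 = -Pi.single (Sum.inr i) 1 := by
  rw [formI_mulVec]
  ext j
  rcases j with j | j <;> simp [Pi.single_apply]

theorem formI_mulVec_pos {x : Fin (p + 1) ⊕ Fin (q + 1) → ℝ} (hx : formI _ _ ℝ *ᵥ x = x) (r : ℝ) :
    formI _ _ ℝ *ᵥ (r • firstVec p q + x) = r • firstVec p q + x := by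
  rw [Matrix.mulVec_add, Matrix.mulVec_smul, formI_mulVec_firstVec, hx]

theorem formI_mulVec_neg {y : Fin (p + 1) ⊕ Fin (q + 1) → ℝ} (hy : formI _ _ ℝ *ᵥ y = -y) (r : ℝ) :
    formI _ _ ℝ *ᵥ (r • lastVec p q + y) = -(r • lastVec p q + y) := by
  rw [Matrix.mulVec_add, Matrix.mulVec_smul, formI_mulVec_lastVec, hy, smul_neg, neg_add]

/-- The same scalar `s` must serve both blocks, so only one block may choose its sign. The other one
has dimension at least two and uses an extra basis vector instead. The sign itself is harmless, as
only the line counts. -/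
theorem exists_refl_pair (hpq : 0 < p + q) {x y : Fin (p + 1) ⊕ Fin (q + 1) → ℝ}
    (hx : formI _ _ ℝ *ᵥ x = x) (hy : formI _ _ ℝ *ᵥ y = -y) {r : ℝ} (hr : r ≠ 0)
    (hxx : x ⬝ᵥ x = r * r) (hyy : y ⬝ᵥ y = r * r) :
    ∃ (s : ℝ) (U V : Fin (p + 1) ⊕ Fin (q + 1) → ℝ), s ≠ 0 ∧ formI _ _ ℝ *ᵥ U = U ∧
      formI _ _ ℝ *ᵥ V = -V ∧ U ≠ 0 ∧ V ≠ 0 ∧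
      refl U *ᵥ (refl (firstVec p q) *ᵥ firstVec p q) = s⁻¹ • x ∧
      refl V *ᵥ (refl (lastVec p q) *ᵥ lastVec p q) = s⁻¹ • y := by
  rcases Nat.eq_zero_or_pos p with hp | hp
  · obtain ⟨s, hs, hss, hU0, hUx⟩ := exists_refl_or_neg firstVec_dotProduct_self hr hxx
    obtain ⟨V, hV, hV0, hVy⟩ := exists_refl_of_pos (show 0 < q by omega)
      (Sum.inr_injective (α := Fin (p + 1))) hs (hyy.trans hss.symm)
    refine ⟨s, _, V, hs, formI_mulVec_pos hx s, ?_, hU0, hV0, hUx, hVy⟩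
    rcases hV with rfl | ⟨i, rfl⟩
    · exact formI_mulVec_neg hy s
    · exact formI_mulVec_single_inr i
  · obtain ⟨s, hs, hss, hV0, hVy⟩ := exists_refl_or_neg lastVec_dotProduct_self hr hyy
    obtain ⟨U, hU, hU0, hUx⟩ := exists_refl_of_pos hp
      (Sum.inl_injective (β := Fin (q + 1))) hs (hxx.trans hss.symm)
    refine ⟨s, U, _, hs, ?_, formI_mulVec_neg hy s, hU0, hV0, hUx, hVy⟩
    rcases hU with rfl | ⟨i, rfl⟩
    · exact formI_mulVec_pos hx s
    · exact formI_mulVec_single_inl i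

theorem transpose_mul_formI_mul_SOIdComponent (g : SOIdComponent p q) :
    (mat g)ᵀ * formI p q ℝ * mat g = formI p q ℝ :=
  (map_connectedComponentOfOne_le _ g.2).1

theorem SOIdComponent_isotropic (g : SOIdComponent (p + 1) (q + 1)) :
    (mat g *ᵥ realIsotropic p q 1) ⬝ᵥ (formI _ _ ℝ *ᵥ (mat g *ᵥ realIsotropic p q 1)) = 0 := by
  rw [dotProduct_comm, Matrix.dotProduct_mulVec, ← Matrix.mulVec_transpose, Matrix.mulVec_mulVec,
    Matrix.mulVec_mulVec, transpose_mul_formI_mul_SOIdComponent, realIsotropic_eq,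
    one_smul, Matrix.mulVec_add, formI_mulVec_firstVec, formI_mulVec_lastVec]
  simp only [add_dotProduct, dotProduct_add, neg_dotProduct, firstVec_dotProduct_self,
    lastVec_dotProduct_self, dotProduct_comm (firstVec p q) (lastVec p q),
    lastVec_dotProduct_firstVec]
  norm_num

theorem doubleRotation_mulVec_realIsotropic {U V x y : Fin (p + 1) ⊕ Fin (q + 1) → ℝ} {r : ℝ}
    (hU : formI _ _ ℝ *ᵥ U = U) (hV : formI _ _ ℝ *ᵥ V = -V) (hU0 : U ≠ 0)
    (hy : formI _ _ ℝ *ᵥ y = -y)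
    (hUx : refl U *ᵥ (refl (firstVec p q) *ᵥ firstVec p q) = r⁻¹ • x)
    (hVy : refl V *ᵥ (refl (lastVec p q) *ᵥ lastVec p q) = r⁻¹ • y) :
    doubleRotation (firstVec p q) (lastVec p q) U V *ᵥ realIsotropic p q 1 = r⁻¹ • (x + y) := by
  have h1 : refl (firstVec p q) *ᵥ (refl U *ᵥ y) = y := by
    have h2 : refl U *ᵥ y = y :=
      refl_mulVec_of_orthogonal (by rw [dotProduct_comm, dotProduct_eq_zero_of_formI hU hy])
    rw [h2, refl_mulVec_of_orthogonal
      (by rw [dotProduct_comm, dotProduct_eq_zero_of_formI formI_mulVec_firstVec hy])]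
  rw [realIsotropic_eq, one_smul, Matrix.mulVec_add,
    doubleRotation_mulVec_left lastVec_dotProduct_firstVec
      (dotProduct_eq_zero_of_formI formI_mulVec_firstVec hV) hUx,
    doubleRotation_mulVec_right firstVec_dotProduct_self
      (fun h => hU0 (dotProduct_self_eq_zero.1 h)) (y := y) (by rw [h1, hVy]), smul_add]

theorem real_dotProduct_self_nonneg {ι : Type*} [Fintype ι] (v : ι → ℝ) : 0 ≤ v ⬝ᵥ v :=
  Finset.sum_nonneg fun i _ => mul_self_nonneg (v i)

theorem sqrt_posPart_ne_zero {w : Fin p ⊕ Fin q → ℝ} (h : w ⬝ᵥ (formI p q ℝ *ᵥ w) = 0)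
    (hw : w ≠ 0) : √(posPart w ⬝ᵥ posPart w) ≠ 0 := by
  intro h0
  have h1 : posPart w ⬝ᵥ posPart w = 0 := by
    rw [← Real.mul_self_sqrt (real_dotProduct_self_nonneg _), h0, mul_zero]
  have h2 := negPart_dotProduct_self h
  rw [h1] at h2
  apply hw
  rw [← posPart_add_negPart w, dotProduct_self_eq_zero.1 h1, dotProduct_self_eq_zero.1 h2, add_zero]

theorem transitive_SOIdComponent (hpq : 0 < p + q) (g : SOIdComponent (p + 1) (q + 1)) :
    ∃ k ∈ maxCompact (SOIdComponent (p + 1) (q + 1)), k⁻¹ * g ∈ realQuadricParabolic p q := by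
  set w := mat g *ᵥ realIsotropic p q 1 with hw
  have hiso : w ⬝ᵥ (formI _ _ ℝ *ᵥ w) = 0 := SOIdComponent_isotropic g
  have hw0 : w ≠ 0 := mat_mulVec_ne_zero g (realIsotropic_ne_zero _)
  have hxx := (Real.mul_self_sqrt (real_dotProduct_self_nonneg (posPart w))).symm
  obtain ⟨s, U, V, hs, hU, hV, hU0, hV0, hUx, hVy⟩ := exists_refl_pair hpq (formI_mulVec_posPart w)
    (formI_mulVec_negPart w) (sqrt_posPart_ne_zero hiso hw0) hxx
    ((negPart_dotProduct_self hiso).trans hxx)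
  obtain ⟨k, hk, hkm⟩ := exists_mem_maxCompact_SOIdComponent hU hV hU0 hV0
  refine ⟨k, hk, inv_mul_mem_stab_line (realIsotropic_ne_zero _) (c := s) ?_⟩
  rw [hkm, doubleRotation_mulVec_realIsotropic hU hV hU0 (formI_mulVec_negPart w) hUx hVy,
    posPart_add_negPart, smul_smul, mul_inv_cancel₀ hs, one_smul]

section LocalSection

attribute [local instance] Matrix.normedAddCommGroup Matrix.normedSpace

/-- At the identity the reflecting vectors are twice the first vectors of the blocks, so the
construction is nondegenerate and smooth nearby, with the positive root as length. -/
theorem exists_isLocalSection_realQuadric (p q : ℕ) :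
    ∃ κ, IsLocalSection (SOIdComponent (p + 1) (q + 1)) (realQuadricParabolic p q) κ := by
  let w : Matrix (Fin (p + 1) ⊕ Fin (q + 1)) (Fin (p + 1) ⊕ Fin (q + 1)) ℝ →
    Fin (p + 1) ⊕ Fin (q + 1) → ℝ := fun M => M *ᵥ realIsotropic p q 1
  let r := fun M => √(posPart (w M) ⬝ᵥ posPart (w M))
  let U := fun M => r M • firstVec p q + posPart (w M)
  let V := fun M => r M • lastVec p q + negPart (w M)
  have hx1 : posPart (w 1) = firstVec p q := by
    change posPart (1 *ᵥ realIsotropic p q 1) = _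
    rw [Matrix.one_mulVec, posPart_realIsotropic]
  have hy1 : negPart (w 1) = lastVec p q := by
    change negPart (1 *ᵥ realIsotropic p q 1) = _
    rw [Matrix.one_mulVec, negPart_realIsotropic]
  have hr1 : r 1 = 1 := by
    change √(posPart (w 1) ⬝ᵥ posPart (w 1)) = 1
    rw [hx1, firstVec_dotProduct_self, Real.sqrt_one]
  have hUU : U 1 ⬝ᵥ U 1 ≠ 0 := by
    change (r 1 • firstVec p q + posPart (w 1)) ⬝ᵥ (r 1 • firstVec p q + posPart (w 1)) ≠ 0
    rw [hr1, hx1, one_smul, ← two_smul ℝ, smul_dotProduct, dotProduct_smul,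
      firstVec_dotProduct_self]
    norm_num
  have hVV : V 1 ⬝ᵥ V 1 ≠ 0 := by
    change (r 1 • lastVec p q + negPart (w 1)) ⬝ᵥ (r 1 • lastVec p q + negPart (w 1)) ≠ 0
    rw [hr1, hy1, one_smul, ← two_smul ℝ, smul_dotProduct, dotProduct_smul,
      lastVec_dotProduct_self]
    norm_num
  have hws : ContDiffAt ℝ ∞ w 1 := contDiffAt_mulVec contDiffAt_id contDiffAt_const
  have hIs : ContDiffAt ℝ ∞ (fun M => formI (p + 1) (q + 1) ℝ *ᵥ w M) 1 :=
    contDiffAt_mulVec contDiffAt_const hws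
  have hxs : ContDiffAt ℝ ∞ (fun M => posPart (w M)) 1 := (hws.add hIs).const_smul (2⁻¹ : ℝ)
  have hys : ContDiffAt ℝ ∞ (fun M => negPart (w M)) 1 := (hws.sub hIs).const_smul (2⁻¹ : ℝ)
  have hrs : ContDiffAt ℝ ∞ r 1 := (contDiffAt_dotProduct hxs hxs).sqrt
    (by rw [hx1, firstVec_dotProduct_self]; exact one_ne_zero)
  have hUs : ContDiffAt ℝ ∞ U 1 := (hrs.smul contDiffAt_const).add hxs
  have hVs : ContDiffAt ℝ ∞ V 1 := (hrs.smul contDiffAt_const).add hys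
  refine ⟨fun M => doubleRotation (firstVec p q) (lastVec p q) (U M) (V M), ?_, ?_⟩
  · exact ((contDiffAt_refl hUs hUU).matrix_mul contDiffAt_const).matrix_mul
      ((contDiffAt_refl hVs hVV).matrix_mul contDiffAt_const)
  · filter_upwards [(contDiffAt_dotProduct hUs hUs).continuousAt.eventually_ne hUU,
      (contDiffAt_dotProduct hVs hVs).continuousAt.eventually_ne hVV] with M hUM hVM g hg
    have hiso : w M ⬝ᵥ (formI _ _ ℝ *ᵥ w M) = 0 := by
      rw [← hg]; exact SOIdComponent_isotropic g
    have hw0 : w M ≠ 0 := by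
      rw [← hg]; exact mat_mulVec_ne_zero g (realIsotropic_ne_zero _)
    have hr0 : r M ≠ 0 := sqrt_posPart_ne_zero hiso hw0
    have hxx : posPart (w M) ⬝ᵥ posPart (w M) = r M * r M :=
      (Real.mul_self_sqrt (real_dotProduct_self_nonneg (posPart (w M)))).symm
    have hU : formI _ _ ℝ *ᵥ U M = U M := formI_mulVec_pos (formI_mulVec_posPart _) _
    have hV : formI _ _ ℝ *ᵥ V M = -V M := formI_mulVec_neg (formI_mulVec_negPart _) _
    have hU0 : U M ≠ 0 := fun h => hUM (by rw [h, zero_dotProduct])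
    have hV0 : V M ≠ 0 := fun h => hVM (by rw [h, zero_dotProduct])
    obtain ⟨k, hk, hkm⟩ := exists_mem_maxCompact_SOIdComponent hU hV hU0 hV0
    refine ⟨k, hk, hkm, inv_mul_mem_stab_line (realIsotropic_ne_zero _) (c := r M) ?_⟩
    rw [hkm, doubleRotation_mulVec_realIsotropic hU hV hU0 (formI_mulVec_negPart (w M))
      (refl_mulVec_refl_mulVec firstVec_dotProduct_self hxx hUM)
      (refl_mulVec_refl_mulVec lastVec_dotProduct_self
        ((negPart_dotProduct_self hiso).trans hxx) hVM), hg,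
      posPart_add_negPart, smul_smul, mul_inv_cancel₀ hr0, one_smul]

end LocalSection

theorem transpose_mul_self_of_mem_maxCompact {k : SOIdComponent p q}
    (hk : k ∈ maxCompact (SOIdComponent p q)) : (mat k)ᵀ * mat k = 1 := by
  have h := mem_maxCompact.1 hk
  rwa [Matrix.star_eq_conjTranspose, Matrix.conjTranspose_eq_transpose_of_trivial] at h

theorem formI_mul_mat_of_mem_maxCompact {k : SOIdComponent p q}
    (hk : k ∈ maxCompact (SOIdComponent p q)) : formI p q ℝ * mat k = mat k * formI p q ℝ := by
  have h1 := mul_eq_one_comm.1 (transpose_mul_self_of_mem_maxCompact hk)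
  have h2 := transpose_mul_formI_mul_SOIdComponent k
  calc formI p q ℝ * mat k = mat k * (mat k)ᵀ * formI p q ℝ * mat k := by rw [h1, one_mul]
    _ = mat k * ((mat k)ᵀ * formI p q ℝ * mat k) := by simp only [mul_assoc]
    _ = mat k * formI p q ℝ := by rw [h2]

theorem mul_self_eq_one_of_mulVec_eq {ι : Type*} [Fintype ι] [DecidableEq ι] {k : Matrix ι ι ℝ}
    (hk : kᵀ * k = 1) {e : ι → ℝ} (he : e ⬝ᵥ e = 1) {c : ℝ} (h : k *ᵥ e = c • e) : c * c = 1 := by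
  have h1 := dotProduct_mulVec_of_orthogonal hk e e
  rwa [h, smul_dotProduct, dotProduct_smul, he, smul_eq_mul, smul_eq_mul, mul_one] at h1

/-- An orthogonal matrix preserving the form commutes with `formI`, hence with the projections to
the positive and negative parts. Both parts of the isotropic eigenvector therefore have its
eigenvalue. -/
theorem exists_of_mem_realQuadricParabolic {k : SOIdComponent (p + 1) (q + 1)}
    (hk : k ∈ maxCompact (SOIdComponent (p + 1) (q + 1))) (hP : k ∈ realQuadricParabolic p q) :
    ∃ c : ℝ, c * c = 1 ∧ mat k *ᵥ firstVec p q = c • firstVec p q ∧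
      mat k *ᵥ lastVec p q = c • lastVec p q := by
  obtain ⟨c, hc⟩ := exists_of_mem_stab_line hP
  have hI : ∀ w, mat k *ᵥ (formI _ _ ℝ *ᵥ w) = formI _ _ ℝ *ᵥ (mat k *ᵥ w) := fun w => by
    rw [Matrix.mulVec_mulVec, Matrix.mulVec_mulVec, formI_mul_mat_of_mem_maxCompact hk]
  have h1 : mat k *ᵥ firstVec p q = c • firstVec p q := by
    rw [← posPart_realIsotropic, posPart, Matrix.mulVec_smul, Matrix.mulVec_add, hI, hc,
      Matrix.mulVec_smul, ← smul_add, smul_comm]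
  have h2 : mat k *ᵥ lastVec p q = c • lastVec p q := by
    rw [← negPart_realIsotropic, negPart, Matrix.mulVec_smul, Matrix.mulVec_sub, hI, hc,
      Matrix.mulVec_smul, ← smul_sub, smul_comm]
  exact ⟨c, mul_self_eq_one_of_mulVec_eq (transpose_mul_self_of_mem_maxCompact hk)
    firstVec_dotProduct_self h1, h1, h2⟩

/-- The product of the reflections in the first vector of either block, as an involution in the
orthogonal group of the form. -/
theorem exists_quadricRefl (p q : ℕ) :
    ∃ s : GLin (Fin (p + 1) ⊕ Fin (q + 1)) ℝ,
      s.val = refl (firstVec p q) * refl (lastVec p q) ∧ s * s = 1 ∧ star s.val = s.val ∧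
      s ∈ (bilinGroup (formI (p + 1) (q + 1) ℝ) ⊓ detOne _ ℝ : Subgroup _) := by
  have e0 : firstVec p q ⬝ᵥ firstVec p q ≠ 0 := by
    rw [firstVec_dotProduct_self]; exact one_ne_zero
  have e1 : lastVec p q ⬝ᵥ lastVec p q ≠ 0 := by
    rw [lastVec_dotProduct_self]; exact one_ne_zero
  have hcomm : refl (firstVec p q) * refl (lastVec p q) =
      refl (lastVec p q) * refl (firstVec p q) := by
    have h := mul_vecMulVec_comm (k := refl (firstVec p q)) (v := lastVec p q) (w := lastVec p q)
      (c := 1) (d := 1) (by rw [refl_transpose, refl_mul_self e0])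
      (by rw [refl_mulVec_of_orthogonal (by rw [dotProduct_comm, lastVec_dotProduct_firstVec]),
        one_smul])
      (by rw [refl_mulVec_of_orthogonal (by rw [dotProduct_comm, lastVec_dotProduct_firstVec]),
        one_smul]) (one_mul 1)
    change _ * (1 - _) = (1 - _) * _
    rw [mul_sub, sub_mul, mul_one, one_mul, Matrix.mul_smul, Matrix.smul_mul, h]
  have h1 : refl (firstVec p q) * refl (lastVec p q) *
      (refl (firstVec p q) * refl (lastVec p q)) = 1 := by
    nth_rewrite 1 [hcomm]
    rw [mul_assoc, ← mul_assoc (refl (firstVec p q)), refl_mul_self e0, one_mul, refl_mul_self e1]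
  have h2 : (refl (firstVec p q) * refl (lastVec p q))ᵀ =
      refl (firstVec p q) * refl (lastVec p q) := by
    rw [Matrix.transpose_mul, refl_transpose, refl_transpose, hcomm]
  refine ⟨⟨_, _, h1, h1⟩, rfl, Units.ext h1, ?_, ?_, ?_⟩
  · rwa [Matrix.star_eq_conjTranspose, Matrix.conjTranspose_eq_transpose_of_trivial]
  · change (refl (firstVec p q) * refl (lastVec p q))ᵀ * formI _ _ ℝ *
      (refl (firstVec p q) * refl (lastVec p q)) = _
    have c1 : Commute _ _ := refl_mul_formI (Or.inl (formI_mulVec_firstVec (p := p) (q := q)))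
    have c2 : Commute _ _ := refl_mul_formI (Or.inr (formI_mulVec_lastVec (p := p) (q := q)))
    rw [h2, mul_assoc, (c1.mul_right c2).eq, ← mul_assoc, h1, one_mul]
  · change (refl (firstVec p q) * refl (lastVec p q)).det = 1
    rw [Matrix.det_mul, det_refl e0, det_refl e1]
    norm_num

theorem eq_smul_of_refl_mulVec_eq_neg {ι : Type*} [Fintype ι] [DecidableEq ι] {a v : ι → ℝ}
    (ha : a ⬝ᵥ a = 1) (h : refl a *ᵥ v = -v) : v = (a ⬝ᵥ v) • a := by
  rw [refl_mulVec, ha, div_one] at h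
  ext i
  have h1 := congrFun h i
  simp only [Pi.sub_apply, Pi.smul_apply, Pi.neg_apply, smul_eq_mul] at h1 ⊢
  linarith

/-- The `-1` eigenspace of the involution is the plane of the two first vectors, and it meets the
eigenspaces of `formI` in the two coordinate lines. A matrix commuting with both preserves each
line. -/
theorem mulVec_eq_of_commute {M : Matrix (Fin (p + 1) ⊕ Fin (q + 1)) (Fin (p + 1) ⊕ Fin (q + 1)) ℝ}
    (hI : formI _ _ ℝ * M = M * formI _ _ ℝ)
    (h : refl (firstVec p q) * refl (lastVec p q) * M = M * (refl (firstVec p q) * refl (lastVec p q))) :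
    M *ᵥ firstVec p q = M (Sum.inl 0) (Sum.inl 0) • firstVec p q ∧
    M *ᵥ lastVec p q = M (Sum.inr 0) (Sum.inr 0) • lastVec p q := by
  set a := firstVec p q with ha
  set b := lastVec p q with hb
  have haa : a ⬝ᵥ a = 1 := firstVec_dotProduct_self
  have hbb : b ⬝ᵥ b = 1 := lastVec_dotProduct_self
  have e0 : a ⬝ᵥ a ≠ 0 := by rw [haa]; exact one_ne_zero
  have e1 : b ⬝ᵥ b ≠ 0 := by rw [hbb]; exact one_ne_zero
  have hba : b ⬝ᵥ a = 0 := lastVec_dotProduct_firstVec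
  have hs : ∀ v, refl a *ᵥ (refl b *ᵥ (M *ᵥ v)) = M *ᵥ (refl a *ᵥ (refl b *ᵥ v)) := fun v => by
    simpa only [Matrix.mulVec_mulVec, mul_assoc] using congrArg (· *ᵥ v) h
  have hIv : ∀ v, formI _ _ ℝ *ᵥ (M *ᵥ v) = M *ᵥ (formI _ _ ℝ *ᵥ v) := fun v => by
    rw [Matrix.mulVec_mulVec, hI, ← Matrix.mulVec_mulVec]
  constructor
  · have h1 : b ⬝ᵥ (M *ᵥ a) = 0 := dotProduct_eq_zero_of_formI
      (by rw [hIv, ha, formI_mulVec_firstVec]) formI_mulVec_lastVec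
    have h2 := hs a
    rw [refl_mulVec_of_orthogonal h1, refl_mulVec_of_orthogonal hba, refl_mulVec_self e0,
      Matrix.mulVec_neg] at h2
    have h3 : a ⬝ᵥ (M *ᵥ a) = M (Sum.inl 0) (Sum.inl 0) := by simp [ha, firstVec]
    rw [← h3]
    exact eq_smul_of_refl_mulVec_eq_neg haa h2
  · have h1 : a ⬝ᵥ (M *ᵥ b) = 0 := by
      rw [dotProduct_comm]
      exact dotProduct_eq_zero_of_formI formI_mulVec_firstVec
        (by rw [hIv, hb, formI_mulVec_lastVec, Matrix.mulVec_neg])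
    have h2 := congrArg (refl a *ᵥ ·) (hs b)
    simp only [refl_mulVec_refl e0, refl_mulVec_self e1, Matrix.mulVec_neg,
      refl_mulVec_of_orthogonal ((dotProduct_comm a b).trans hba),
      refl_mulVec_of_orthogonal h1] at h2
    have h3 : b ⬝ᵥ (M *ᵥ b) = M (Sum.inr 0) (Sum.inr 0) := by simp [hb, lastVec]
    rw [← h3]
    exact eq_smul_of_refl_mulVec_eq_neg hbb h2

/-- An element of `K` fixed by the involution multiplies the first vector of each block by a sign.
It preserves the isotropic line when the signs agree, so their product is the function that detects
`P`. -/
theorem isCompactSymmetricRealization_realQuadric (hpq : 0 < p + q) :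
    IsCompactSymmetricRealization (SOIdComponent (p + 1) (q + 1))
      (realQuadricParabolic p q) (realQuadricLevi p q) := by
  have hU : IsCompact (unitarySet (Fin (p + 1) ⊕ Fin (q + 1)) ℝ) := isCompact_unitarySet
  obtain ⟨κ, hκ⟩ := exists_isLocalSection_realQuadric p q
  obtain ⟨s, hsv, hss, hst, hsH⟩ := exists_quadricRefl p q
  refine ⟨isCompact_maxCompact hU (isClosed_map_connectedComponentOfOne
      ((isClosed_bilinGroup _).inter isClosed_detOne)),
    isPretransitive_maxCompact _ _ (transitive_SOIdComponent hpq), ?_, ?_,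
    exists_homeomorph_quotient _ _ (transitive_SOIdComponent hpq) hκ⟩
  · ext k
    constructor
    · rintro ⟨h1, h2⟩
      obtain ⟨c, -, hc1, hc2⟩ := exists_of_mem_realQuadricParabolic h2 h1
      refine ⟨⟨h1, mem_stab_line (realIsotropic_ne_zero _) (c := c) ?_⟩, h2⟩
      rw [realIsotropic_eq, Matrix.mulVec_add, Matrix.mulVec_smul, hc1, hc2, smul_add, smul_comm]
    · rintro ⟨h1, h2⟩
      exact ⟨h1.1, h2⟩
  · have key : ∀ k ∈ maxCompact (SOIdComponent (p + 1) (q + 1)), s.val * mat k = mat k * s.val →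
        mat k *ᵥ firstVec p q = mat k (Sum.inl 0) (Sum.inl 0) • firstVec p q ∧
        mat k *ᵥ lastVec p q = mat k (Sum.inr 0) (Sum.inr 0) • lastVec p q := by
      intro k hk h
      rw [hsv] at h
      exact mulVec_eq_of_commute (formI_mul_mat_of_mem_maxCompact hk) h
    have hsq : ∀ k ∈ maxCompact (SOIdComponent (p + 1) (q + 1)), s.val * mat k = mat k * s.val →
        mat k (Sum.inl 0) (Sum.inl 0) * mat k (Sum.inl 0) (Sum.inl 0) = 1 ∧
        mat k (Sum.inr 0) (Sum.inr 0) * mat k (Sum.inr 0) (Sum.inr 0) = 1 := fun k hk h =>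
      ⟨mul_self_eq_one_of_mulVec_eq (transpose_mul_self_of_mem_maxCompact hk)
        firstVec_dotProduct_self (key k hk h).1,
      mul_self_eq_one_of_mulVec_eq (transpose_mul_self_of_mem_maxCompact hk)
        lastVec_dotProduct_self (key k hk h).2⟩
    refine isSymmetricSubgroup_of_conj _ _ s hss hst
      (fun g hg => mul_mul_mem_map_connectedComponentOfOne hss hsH hg) ?_
      (fun M => ((M (Sum.inl 0) (Sum.inl 0) * M (Sum.inr 0) (Sum.inr 0) : ℝ) : ℂ)) ?_ ?_ ?_ ?_
    · intro k hk hP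
      obtain ⟨c, hcc, h1, h2⟩ := exists_of_mem_realQuadricParabolic hk hP
      have h3 := transpose_mul_self_of_mem_maxCompact hk
      have hrefl : ∀ e : Fin (p + 1) ⊕ Fin (q + 1) → ℝ, mat k *ᵥ e = c • e →
          Commute (refl e) (mat k) := fun e he => by
        change refl e * mat k = mat k * refl e
        rw [refl, mul_sub, sub_mul, mul_one, one_mul, Matrix.mul_smul, Matrix.smul_mul,
          mul_vecMulVec_comm h3 he he hcc]
      rw [hsv]
      exact (hrefl _ h1).mul_left (hrefl _ h2)
    · exact Complex.continuous_ofReal.comp (((continuous_id.matrix_elem _ _)).mul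
        (continuous_id.matrix_elem _ _))
    · simp
    · intro k hk h
      obtain ⟨h1, h2⟩ := hsq k hk h
      have h3 : (mat k (Sum.inl 0) (Sum.inl 0) * mat k (Sum.inr 0) (Sum.inr 0)) *
          (mat k (Sum.inl 0) (Sum.inl 0) * mat k (Sum.inr 0) (Sum.inr 0)) = 1 := by
        rw [mul_mul_mul_comm, h1, h2, one_mul]
      rcases mul_self_eq_one_iff.1 h3 with h | h
      · left; rw [h, Complex.ofReal_one]
      · right; rw [h, Complex.ofReal_neg, Complex.ofReal_one]
    · intro k hk h hf
      obtain ⟨h1, h2⟩ := hsq k hk h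
      obtain ⟨h3, h4⟩ := key k hk h
      have h5 : mat k (Sum.inl 0) (Sum.inl 0) * mat k (Sum.inr 0) (Sum.inr 0) = 1 :=
        Complex.ofReal_injective (hf.trans Complex.ofReal_one.symm)
      have h6 : mat k (Sum.inr 0) (Sum.inr 0) = mat k (Sum.inl 0) (Sum.inl 0) :=
        (left_inv_eq_right_inv h1 h5).symm
      refine mem_stab_line (realIsotropic_ne_zero _) (c := mat k (Sum.inl 0) (Sum.inl 0)) ?_
      rw [realIsotropic_eq, one_smul, Matrix.mulVec_add, h3, h4, h6, smul_add]

end RealQuadric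

end Grassmann

theorem mainTheorem12 :
    -- ordinary Grassmannians: `GL(p+q, F)`
    (∀ p q : ℕ,
      (Grassmann.IsBlockRealization (⊤ : Subgroup (Grassmann.GLin (Fin p ⊕ Fin q) ℝ)) ∧
        Grassmann.IsGrassmannRealization p q ℝ) ∧
      (Grassmann.IsBlockRealization (⊤ : Subgroup (Grassmann.GLin (Fin p ⊕ Fin q) ℂ)) ∧
        Grassmann.IsGrassmannRealization p q ℂ) ∧
      (Grassmann.IsBlockRealization (⊤ : Subgroup (Grassmann.GLin (Fin p ⊕ Fin q) ℍ[ℝ])) ∧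
        Grassmann.IsGrassmannRealization p q ℍ[ℝ])) ∧
    -- symplectic Lagrangian Grassmannians: `Sp(2n, F)`
    (∀ n : ℕ,
      Grassmann.IsBlockRealization (F := ℝ) (Grassmann.bilinGroup (Grassmann.formJ n ℝ)) ∧
      Grassmann.IsBlockRealization (F := ℂ) (Grassmann.bilinGroup (Grassmann.formJ n ℂ))) ∧
    -- orthogonal Lagrangian Grassmannians: `O(2n, ℂ)` and `SO(2n, ℂ)`
    (∀ n : ℕ,
      Grassmann.IsBlockRealization (F := ℂ) (Grassmann.bilinGroup (Grassmann.formD n ℂ)) ∧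
      Grassmann.IsBlockRealization (F := ℂ)
        (Grassmann.bilinGroup (Grassmann.formD n ℂ) ⊓ Grassmann.detOne (Fin n ⊕ Fin n) ℂ)) ∧
    -- Hermitian Lagrangian Grassmannians: `U(n, n; F)`
    (∀ n : ℕ,
      Grassmann.IsBlockRealization (F := ℝ) (Grassmann.sesqGroup (Grassmann.formD n ℝ)) ∧
      Grassmann.IsBlockRealization (F := ℂ) (Grassmann.sesqGroup (Grassmann.formD n ℂ)) ∧
      Grassmann.IsBlockRealization (F := ℍ[ℝ]) (Grassmann.sesqGroup (Grassmann.formD n ℍ[ℝ]))) ∧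
    -- skew Hermitian quaternionic Lagrangian Grassmannians: `SO^*(4n)`
    (∀ n : ℕ,
      Grassmann.IsBlockRealization (F := ℍ[ℝ]) (Grassmann.sesqGroup (Grassmann.formJ n ℍ[ℝ]))) ∧
    -- real quadrics: `SO(p+1, q+1)_e`
    (∀ p q : ℕ, 2 < p + q →
      Grassmann.IsCompactSymmetricRealization (Grassmann.SOIdComponent (p + 1) (q + 1))
        (Grassmann.realQuadricParabolic p q) (Grassmann.realQuadricLevi p q)) ∧
    -- complex quadrics: `SO(n+2, ℂ)`
    (∀ n : ℕ, 3 ≤ n →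
      Grassmann.IsCompactSymmetricRealization (Grassmann.SOComplex n)
        (Grassmann.complexQuadricParabolic n) (Grassmann.complexQuadricLevi n)) := by
  refine ⟨fun p q => ⟨⟨?_, ?_⟩, ⟨?_, ?_⟩, ⟨?_, ?_⟩⟩, fun n => ⟨?_, ?_⟩, fun n => ⟨?_, ?_⟩,
    fun n => ⟨?_, ?_, ?_⟩, fun n => ?_, fun p q h => ?_, fun n hn => ?_⟩
  · exact Grassmann.isBlockRealization_top p q
  · exact Grassmann.isGrassmannRealization p q
  · exact Grassmann.isBlockRealization_top p q
  · exact Grassmann.isGrassmannRealization p q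
  · exact Grassmann.isBlockRealization_top p q
  · exact Grassmann.isGrassmannRealization p q
  · exact Grassmann.isBlockRealization_bilinGroup_formJ n
  · exact Grassmann.isBlockRealization_bilinGroup_formJ n
  · exact Grassmann.isBlockRealization_bilinGroup_formD n
  · exact Grassmann.isBlockRealization_specialOrthogonal n
  · exact Grassmann.isBlockRealization_sesqGroup_formD n
  · exact Grassmann.isBlockRealization_sesqGroup_formD n
  · exact Grassmann.isBlockRealization_sesqGroup_formD n
  · exact Grassmann.isBlockRealization_sesqGroup_formJ n
  · exact Grassmann.isCompactSymmetricRealization_realQuadric (by omega)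
  · exact Grassmann.isCompactSymmetricRealization_complexQuadric (by omega)
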